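/- **Setting.** Let $\Omega\subset\mathbb R^2$ be a bounded open polygonal set, let $\Gamma_D,\Gamma_N$ be disjoint with $\overline{\Gamma_D\cup\Gamma_N}=\partial\Omega$ and $|\Gamma_D|\neq 0$, and let $\mathbb A\in L^\infty(\Omega)^{2\times 2}$ be symmetric with $a_{\min}|\xi|^2\le \mathbb A(x)\xi\cdot\xi\le a_{\max}|\xi|^2$ for all $\xi\in\mathbb R^2$ and a.e. $x\in\Omega$, where $0<a_{\min}\le a_{\max}$. Let $f\in H^1(\Omega)$ and $g\in L^2(\Gamma_N)$. Put $V=\{v\in H^1(\Omega): v=0 \text{ on }\Gamma_D\}$ and let $u\in V$ satisfy $\int_\Omega \mathbb A\nabla u\cdot\nabla v=\int_\Omega fv+\int_{\Gamma_N}gv$ for all $v\in V$. Let $\mathcal T_h$ be a conforming triangular mesh that exactly covers $\Omega$ and each of whose boundary edges lies (up to its end points) in $\Gamma_D$ or in $\Gamma_N$. Let $h_K$ be the diameter of the triangle $K$, $\rho_K$ the diameter of the largest disc in $K$, and $h=\max_K h_K$. Assume that $h_K\le\gamma_0\rho_K$ for every $K$ and that every vertex belongs to at most $N$ triangles. Let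 $\phi_i$ be the continuous piecewise affine function equal to $1$ at the vertex $i$ and to $0$ at the other vertices, let $V_h$ be the space of continuous piecewise affine functions that vanish on $\Gamma_D$, let $u_h\in V_h$ satisfy $\int_\Omega \mathbb A\nabla u_h\cdot\nabla v=\int_\Omega fv+\int_{\Gamma_N}gv$ for all $v\in V_h$, and put $q_h=\mathbb A\nabla u_h$. Let $n_K$ be the outward unit normal of $K$. Assume: * (H1) $\operatorname{div} q_h=0$ in each triangle $K$; * (H2) $(q_{h|K}+q_{h|K'})\cdot n_K$ is constant on each edge shared by two triangles $K,K'$, and $q_{h|K}\cdot n_K$ is constant on each edge $\Gamma\subset\partial K$ on $\Gamma_D$; * (H3) $(q_{h|K}-q_{h|K'})\cdot n_K$ is constant on each edge shared by two triangles $K,K'$, and $g-q_{h|K}\cdot n_K$ is constant on each edge $\Gamma\subset\partial K$ on $\Gamma_N$. **The equilibrated flux (hybrid-flux technique).** Consider, for every triangle $K$ and every edge $\Gamma\subset\partial K$, a traction $\widehat g_K$ on $\Gamma$ such that: $\widehat g_K=g$ on $\Gamma_N$; $\widehat g_K=-\widehat g_{K'}$ on an edge shared by $K$ and $K'$; on each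 edge not on $\Gamma_N$, $\widehat g_K$ is a linear combination of the two functions $\phi_\ell,\phi_m$ attached to the end points of the edge; and, for every vertex $i$, the numbers $\widehat b_{K,\Gamma}(i)=\int_\Gamma \widehat g_K\phi_i$ ($i\in\Gamma\subset\partial K$) minimize $$\sum_{\Gamma\ni i,\ \Gamma\not\subset\Gamma_N}\frac{\big(b_{K,\Gamma}-b^m_{K,\Gamma}(i)\big)^2}{|\Gamma|^2}$$ (one of the triangles $K$ adjacent to $\Gamma$ being chosen for each $\Gamma$; the choice is immaterial) among all solutions $b$ of the system $$\sum_{\Gamma\subset\partial K,\ \Gamma\ni i} b_{K,\Gamma}=\int_K(q_h\cdot\nabla\phi_i-f\phi_i)\quad\text{for every } K\ni i,$$ with $b_{K,\Gamma}=-b_{K',\Gamma}$ on shared edges and $b_{K,\Gamma}=\int_\Gamma g\phi_i$ for $\Gamma$ on $\Gamma_N$. Here $b^m_{K,\Gamma}(i)=\frac12\int_\Gamma\phi_i\,(q_{h|K}+q_{h|K'})\cdot n_K$ if $\Gamma$ is shared by $K$ and $K'$, and $b^m_{K,\Gamma}(i)=\int_\Gamma\phi_i\, q_{h|K}\cdot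 n_K$ if $\Gamma$ is on $\Gamma_D$. Then $\widehat q_h$ is given in each $K$ by $\widehat q_h=\mathbb A\nabla w_K$, where $w_K\in H^1(K)$ satisfies $\int_K\mathbb A\nabla w_K\cdot\nabla v=\int_K fv+\int_{\partial K}\widehat g_K v$ for all $v\in H^1(K)$. **Claim.** Let $E^2_{\rm CRE}(u_h,\widehat q_h)=\frac12\int_\Omega\mathbb A^{-1}(\widehat q_h-\mathbb A\nabla u_h)\cdot(\widehat q_h-\mathbb A\nabla u_h)$. There is a constant $C$, depending only on $a_{\min},a_{\max},\gamma_0,N$ (in particular not on $h$), such that $$E^2_{\rm CRE}(u_h,\widehat q_h)\le C\,\|\mathbb A^{1/2}\nabla(u-u_h)\|^2_{0,\Omega}+C\,h^4\,\|\nabla f\|^2_{0,\Omega}.$$ -/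

import Mathlib

open MeasureTheory Filter Topology
open scoped ContDiff

noncomputable section

namespace CRE

/-- The Euclidean plane. -/
abbrev E2 : Type := EuclideanSpace ℝ (Fin 2)

/-- Matrix times vector in the Euclidean plane. -/
def mulV (B : Matrix (Fin 2) (Fin 2) ℝ) (ξ : E2) : E2 :=
  WithLp.toLp 2 (B.mulVec (WithLp.ofLp ξ))

/-! ### Sobolev functions, weak divergence, traces -/

/-- `v ∈ H¹(U)` with weak gradient `Dv`. -/
structure MemH1 (U : Set E2) (v : E2 → ℝ) (Dv : E2 → E2) : Prop where
  memLp : MemLp v 2 (volume.restrict U)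
  memLp_grad : MemLp Dv 2 (volume.restrict U)
  weak_grad : ∀ ψ : E2 → ℝ, ContDiff ℝ ∞ ψ → HasCompactSupport ψ → tsupport ψ ⊆ U →
    ∫ x in U, v x • gradient ψ x = - ∫ x in U, ψ x • Dv x

/-- `div q = d` in `U`, in the sense of distributions. -/
def HasWeakDiv (U : Set E2) (q : E2 → E2) (d : E2 → ℝ) : Prop :=
  ∀ ψ : E2 → ℝ, ContDiff ℝ ∞ ψ → HasCompactSupport ψ → tsupport ψ ⊆ U →
    ∫ x in U, inner ℝ (q x) (gradient ψ x) = - ∫ x in U, d x * ψ x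

/-- `t ∈ L²(S)` is the trace on the curve `S ⊆ ∂U` of the function `v ∈ H¹(U)` with weak
gradient `Dv`: there are smooth functions on the plane that converge to `v` in `H¹(U)` and whose
restrictions to `S` converge to `t` in `L²(S)`. It is only used for `U` an open triangle and
`S` one of its edges. -/
def HasTrace (U S : Set E2) (v : E2 → ℝ) (Dv : E2 → E2) (t : E2 → ℝ) : Prop :=
  MemLp t 2 ((Measure.hausdorffMeasure 1).restrict S) ∧
  ∃ w : ℕ → E2 → ℝ, (∀ n, ContDiff ℝ ∞ (w n)) ∧
    Tendsto (fun n => eLpNorm (fun x => w n x - v x) 2 (volume.restrict U)) atTop (𝓝 0) ∧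
    Tendsto (fun n => eLpNorm (fun x => gradient (w n) x - Dv x) 2 (volume.restrict U))
      atTop (𝓝 0) ∧
    Tendsto (fun n => eLpNorm (fun x => w n x - t x) 2
      ((Measure.hausdorffMeasure 1).restrict S)) atTop (𝓝 0)

/-! ### Triangles and edges, given by their finite sets of vertices -/

/-- The closed triangle (or closed segment) with the given vertices. -/
def hull (T : Finset E2) : Set E2 := convexHull ℝ (T : Set E2)

/-- The open triangle. -/
def elt (T : Finset E2) : Set E2 := interior (hull T)

/-- The three edges of a triangle. -/
def edgesOf (T : Finset E2) : Finset (Finset E2) := T.powersetCard 2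

/-- The edge without its end points. -/
def openEdge (e : Finset E2) : Set E2 := hull e \ (e : Set E2)

/-- Integral over the edge `e` with respect to arc length. -/
def edgeInt (e : Finset E2) (F : E2 → ℝ) : ℝ := ∫ x in hull e, F x ∂(Measure.hausdorffMeasure 1)

/-- The function `F` is constant (almost everywhere) on the edge `e`. -/
def ConstOn (e : Finset E2) (F : E2 → ℝ) : Prop :=
  ∃ c : ℝ, ∀ᵐ x ∂((Measure.hausdorffMeasure 1).restrict (hull e)), F x = c

/-- The field `q`, with divergence `d` in the triangle `T`, has the normal flux
`q|_T · n_T = η e ∈ L²(e)` on each edge `e` of `T`, where `n_T` is the outward unit normal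
(weak form of the normal trace, through Green's formula). -/
def HasNormalFlux (T : Finset E2) (q : E2 → E2) (d : E2 → ℝ) (η : Finset E2 → E2 → ℝ) : Prop :=
  (∀ e ∈ edgesOf T, MemLp (η e) 2 ((Measure.hausdorffMeasure 1).restrict (hull e))) ∧
  ∀ v : E2 → ℝ, ContDiff ℝ ∞ v →
    (∫ x in elt T, inner ℝ (q x) (gradient v x)) + (∫ x in elt T, d x * v x)
      = ∑ e ∈ edgesOf T, edgeInt e (fun x => η e x * v x)

/-- Diameter of the largest disc contained in the triangle. -/
def inDiam (T : Finset E2) : ℝ :=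
  sSup {d : ℝ | 0 ≤ d ∧ ∃ c : E2, Metric.closedBall c (d / 2) ⊆ hull T}

/-! ### Conforming triangular meshes -/

/-- A conforming triangular mesh: finitely many nondegenerate triangles, two of which meet
in the convex hull of their common vertices. -/
structure TriMesh where
  tri : Finset (Finset E2)
  nonempty : tri.Nonempty
  card_eq : ∀ T ∈ tri, T.card = 3
  indep : ∀ T ∈ tri, AffineIndependent ℝ ((↑) : T → E2)
  conform : ∀ T ∈ tri, ∀ T' ∈ tri,
    hull T ∩ hull T' = convexHull ℝ ((T : Set E2) ∩ (T' : Set E2))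

namespace TriMesh

variable (M : TriMesh)

open Classical in
/-- The vertices of the mesh. -/
def nodes : Finset E2 := M.tri.biUnion id

open Classical in
/-- The edges of the mesh. -/
def edges : Finset (Finset E2) := M.tri.biUnion edgesOf

open Classical in
/-- The triangles that have `e` as an edge. -/
def adj (e : Finset E2) : Finset (Finset E2) := M.tri.filter (fun T => e ⊆ T)

open Classical in
/-- The triangles that have `i` as a vertex. -/
def patch (i : E2) : Finset (Finset E2) := M.tri.filter (fun T => i ∈ T)

/-- Edges on the boundary: those that belong to a single triangle. -/
def IsBoundaryEdge (e : Finset E2) : Prop := e ∈ M.edges ∧ (M.adj e).card = 1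

/-- The mesh size `h`, the largest diameter of a triangle. -/
def meshSize : ℝ := M.tri.sup' M.nonempty (fun T => Metric.diam (hull T))

/-- Regularity of the mesh: `h_K ≤ γ₀ ρ_K` for every triangle `K`, and every vertex belongs
to at most `N` triangles. -/
structure Regular (γ₀ : ℝ) (N : ℕ) : Prop where
  shape : ∀ T ∈ M.tri, Metric.diam (hull T) ≤ γ₀ * inDiam T
  valence : ∀ i ∈ M.nodes, (M.patch i).card ≤ N

/-- Continuous functions that are affine on each triangle. -/
def IsP1 (v : E2 → ℝ) : Prop :=
  ∀ T ∈ M.tri, ∃ a : E2 →ᵃ[ℝ] ℝ, Set.EqOn v a (hull T)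

/-- `φ i`, for `i` a vertex of the mesh, is the P1 function equal to one at `i` and to zero
at the other vertices. -/
def IsNodalBasis (φ : E2 → E2 → ℝ) : Prop :=
  ∀ i ∈ M.nodes, M.IsP1 (φ i) ∧ φ i i = 1 ∧ ∀ j ∈ M.nodes, j ≠ i → φ i j = 0

end TriMesh

/-! ### The boundary value problem -/

/-- Data of the problem `-div (A ∇u) = f` in `Ω`, `u = 0` on `ΓD`, `(A ∇u)·n = g` on `ΓN`. -/
structure Problem where
  Ω : Set E2
  ΓD : Set E2
  ΓN : Set E2
  A : E2 → Matrix (Fin 2) (Fin 2) ℝ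
  f : E2 → ℝ
  g : E2 → ℝ

namespace Problem

variable (P : Problem)

/-- The standing assumptions on the data. -/
structure Admissible (amin amax : ℝ) : Prop where
  isOpen : IsOpen P.Ω
  bounded : Bornology.IsBounded P.Ω
  disjoint : Disjoint P.ΓD P.ΓN
  closure_eq : closure (P.ΓD ∪ P.ΓN) = frontier P.Ω
  dirichlet_pos : Measure.hausdorffMeasure 1 P.ΓD ≠ 0
  f_memLp : MemLp P.f 2 (volume.restrict P.Ω)
  g_memLp : MemLp P.g 2 ((Measure.hausdorffMeasure 1).restrict P.ΓN)
  A_meas : ∀ i j, AEStronglyMeasurable (fun x => P.A x i j) (volume.restrict P.Ω)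
  A_symm : ∀ᵐ x ∂(volume.restrict P.Ω), (P.A x).IsSymm
  A_elliptic : ∀ᵐ x ∂(volume.restrict P.Ω), ∀ ξ : E2,
    amin * ‖ξ‖ ^ 2 ≤ inner ℝ (mulV (P.A x) ξ) ξ ∧ inner ℝ (mulV (P.A x) ξ) ξ ≤ amax * ‖ξ‖ ^ 2

/-- Square of the energy norm of a function with gradient `D`: `‖A^{1/2} D‖²_{0,Ω}`. -/
def energySq (D : E2 → E2) : ℝ := ∫ x in P.Ω, inner ℝ (mulV (P.A x) (D x)) (D x)

/-- The flux `A ∇v` of a (piecewise differentiable) function `v`. -/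
def flux (v : E2 → ℝ) (x : E2) : E2 := mulV (P.A x) (gradient v x)

/-- The constitutive relation error functional
`E²_CRE(v, p) = ½ ∫_Ω A⁻¹ (p - A ∇v) · (p - A ∇v)`. -/
def creSq (v : E2 → ℝ) (p : E2 → E2) : ℝ :=
  (1 / 2) * ∫ x in P.Ω, inner ℝ (mulV (P.A x)⁻¹ (p x - P.flux v x)) (p x - P.flux v x)

variable (M : TriMesh)

/-- The mesh exactly covers `Ω` and respects the partition of the boundary. -/
structure Meshed : Prop where
  domain_eq : P.Ω = interior (⋃ T ∈ M.tri, hull T)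
  boundary : ∀ e, M.IsBoundaryEdge e → openEdge e ⊆ P.ΓD ∨ openEdge e ⊆ P.ΓN

/-- Edges of the mesh on `ΓD`. -/
def IsDirichletEdge (e : Finset E2) : Prop := M.IsBoundaryEdge e ∧ openEdge e ⊆ P.ΓD

/-- Edges of the mesh on `ΓN`. -/
def IsNeumannEdge (e : Finset E2) : Prop := M.IsBoundaryEdge e ∧ openEdge e ⊆ P.ΓN

open Classical in
/-- The edges of the mesh on `ΓN`. -/
def neumannEdges : Finset (Finset E2) := M.edges.filter (fun e => P.IsNeumannEdge M e)

/-- `v ∈ V`: `v ∈ H¹(Ω)` and `v = 0` on `ΓD`. The trace on a boundary edge is the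
trace of the restriction of `v` to the triangle that has this edge. -/
def MemV (v : E2 → ℝ) (Dv : E2 → E2) : Prop :=
  MemH1 P.Ω v Dv ∧
  ∀ T ∈ M.tri, ∀ e ∈ edgesOf T, P.IsDirichletEdge M e → HasTrace (elt T) (hull e) v Dv 0

/-- `u ∈ V`, with weak gradient `Du`, is the weak solution: for all `v ∈ V`,
`∫_Ω A ∇u · ∇v = ∫_Ω f v + ∫_ΓN g v`. -/
def IsWeakSolution (u : E2 → ℝ) (Du : E2 → E2) : Prop :=
  P.MemV M u Du ∧
  ∀ (v : E2 → ℝ) (Dv : E2 → E2), P.MemV M v Dv →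
    ∀ t : Finset E2 → E2 → ℝ,
      (∀ T ∈ M.tri, ∀ e ∈ edgesOf T, P.IsNeumannEdge M e →
        HasTrace (elt T) (hull e) v Dv (t e)) →
      ∫ x in P.Ω, inner ℝ (mulV (P.A x) (Du x)) (Dv x)
        = (∫ x in P.Ω, P.f x * v x)
          + ∑ e ∈ P.neumannEdges M, edgeInt e (fun x => P.g x * t e x)

/-- The P1 finite element space: P1 functions that vanish on `ΓD`. -/
def MemVh (v : E2 → ℝ) : Prop :=
  M.IsP1 v ∧ ∀ e, P.IsDirichletEdge M e → ∀ x ∈ hull e, v x = 0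

/-- `uh` is the finite element approximation. -/
def IsFESolution (uh : E2 → ℝ) : Prop :=
  P.MemVh M uh ∧
  ∀ v : E2 → ℝ, P.MemVh M v →
    ∫ x in P.Ω, inner ℝ (P.flux uh x) (gradient v x)
      = (∫ x in P.Ω, P.f x * v x)
        + ∑ e ∈ P.neumannEdges M, edgeInt e (fun x => P.g x * v x)

/-! ### The hybrid-flux construction

`η T e` is the normal flux `q_h|_T · n_T` on the edge `e` of the triangle `T`, where
`q_h = A ∇uh`. A unit normal is outward for one of the two triangles adjacent to an interior
edge and inward for the other, so that `(q_h|_T + q_h|_T')·n_T = η T e - η T' e` and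
`(q_h|_T - q_h|_T')·n_T = η T e + η T' e` there. -/

/-- `Q_i^T = ∫_T (q_h · ∇φ_i - f φ_i)`. -/
def nodeLoad (φ : E2 → E2 → ℝ) (uh : E2 → ℝ) (i : E2) (T : Finset E2) : ℝ :=
  ∫ x in elt T, (inner ℝ (P.flux uh x) (gradient (φ i) x) - P.f x * φ i x)

/-- The equations for the projections `b T e = ∫_e ĝ_T φ_i` at the vertex `i`:
continuity of the normal flux across interior edges, prescribed values on `ΓN`, and
the prolongation condition `∑_{e ⊂ ∂T, i ∈ e} b T e = Q_i^T` in each triangle `T` with vertex `i`. -/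
structure NodeSystem (φ : E2 → E2 → ℝ) (uh : E2 → ℝ) (i : E2)
    (b : Finset E2 → Finset E2 → ℝ) : Prop where
  cont : ∀ e ∈ M.edges, i ∈ e → ∀ T ∈ M.adj e, ∀ T' ∈ M.adj e, T ≠ T' → b T e = - b T' e
  neumann : ∀ e, P.IsNeumannEdge M e → i ∈ e → ∀ T ∈ M.adj e,
    b T e = edgeInt e (fun x => P.g x * φ i x)
  prolong : ∀ T ∈ M.patch i,
    ∑ e ∈ (edgesOf T).filter (fun e => i ∈ e), b T e = P.nodeLoad φ uh i T

open Classical in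
/-- The projection `∫_e φ_i · (average finite element normal flux, along n_T)`: on an interior
edge this is `½ ∫_e φ_i (q_h|_T + q_h|_T')·n_T`, on a boundary edge `∫_e φ_i q_h|_T·n_T`. -/
def meanProj (φ : E2 → E2 → ℝ) (η : Finset E2 → Finset E2 → E2 → ℝ)
    (i : E2) (T e : Finset E2) : ℝ :=
  edgeInt e (fun x => φ i x *
    (((M.adj e).card : ℝ)⁻¹ * ∑ T' ∈ M.adj e, (if T' = T then η T' e x else - η T' e x)))

open Classical in
/-- The cost `∑_e |e|⁻² (b_e - b^m_e)²`, over the edges `e` at the vertex `i` that are not on `ΓN`.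
The two sides of an interior edge give the same square, whence the average over the triangles
adjacent to `e`. -/
def nodeCost (φ : E2 → E2 → ℝ) (η : Finset E2 → Finset E2 → E2 → ℝ)
    (i : E2) (b : Finset E2 → Finset E2 → ℝ) : ℝ :=
  ∑ e ∈ M.edges.filter (fun e => i ∈ e ∧ ¬ P.IsNeumannEdge M e),
    (((M.adj e).card : ℝ)⁻¹ * ∑ T ∈ M.adj e, (b T e - meanProj M φ η i T e) ^ 2)
      / (Metric.diam (hull e)) ^ 2

/-- The equilibrated tractions `ĝ T e` on the edges `e` of the triangles `T`:
equal to `g` on `ΓN`, opposite on the two sides of an interior edge, a linear combination of the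
two nodal functions on any edge that is not on `ΓN`, and such that at each vertex `i` the
projections `∫_e ĝ_T φ_i` solve the node equations and minimize the cost among all solutions. -/
structure IsTraction (φ : E2 → E2 → ℝ) (uh : E2 → ℝ) (η : Finset E2 → Finset E2 → E2 → ℝ)
    (ghat : Finset E2 → Finset E2 → E2 → ℝ) : Prop where
  neumann : ∀ e, P.IsNeumannEdge M e → ∀ T ∈ M.adj e, ∀ x ∈ hull e, ghat T e x = P.g x
  cont : ∀ e ∈ M.edges, ∀ T ∈ M.adj e, ∀ T' ∈ M.adj e, T ≠ T' →
    ∀ x ∈ hull e, ghat T e x = - ghat T' e x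
  affine : ∀ e ∈ M.edges, ¬ P.IsNeumannEdge M e → ∀ T ∈ M.adj e,
    ∃ c : E2 → ℝ, ∀ x ∈ hull e, ghat T e x = ∑ l ∈ e, c l * φ l x
  system : ∀ i ∈ M.nodes,
    P.NodeSystem M φ uh i (fun T e => edgeInt e (fun x => ghat T e x * φ i x))
  minimal : ∀ i ∈ M.nodes, ∀ b : Finset E2 → Finset E2 → ℝ, P.NodeSystem M φ uh i b →
    P.nodeCost M φ η i (fun T e => edgeInt e (fun x => ghat T e x * φ i x))
      ≤ P.nodeCost M φ η i b

/-- `w ∈ H¹(T)`, with weak gradient `Dw`, solves the local Neumann problem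
`-div (A ∇w) = f` in `T`, `A ∇w · n_T = ĝ` on `∂T`. -/
def IsLocalSolution (T : Finset E2) (ghat : Finset E2 → E2 → ℝ)
    (w : E2 → ℝ) (Dw : E2 → E2) : Prop :=
  MemH1 (elt T) w Dw ∧
  ∀ (v : E2 → ℝ) (Dv : E2 → E2), MemH1 (elt T) v Dv →
    ∀ t : Finset E2 → E2 → ℝ,
      (∀ e ∈ edgesOf T, HasTrace (elt T) (hull e) v Dv (t e)) →
      ∫ x in elt T, inner ℝ (mulV (P.A x) (Dw x)) (Dv x)
        = (∫ x in elt T, P.f x * v x)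
          + ∑ e ∈ edgesOf T, edgeInt e (fun x => ghat e x * t e x)

/-- `qhat` is an equilibrated flux given by the hybrid-flux construction. -/
def IsHybridFlux (φ : E2 → E2 → ℝ) (uh : E2 → ℝ) (η : Finset E2 → Finset E2 → E2 → ℝ)
    (qhat : E2 → E2) : Prop :=
  ∃ ghat : Finset E2 → Finset E2 → E2 → ℝ, P.IsTraction M φ uh η ghat ∧
    ∀ T ∈ M.tri, ∃ (w : E2 → ℝ) (Dw : E2 → E2), P.IsLocalSolution T (ghat T) w Dw ∧
      ∀ᵐ x ∂(volume.restrict (elt T)), qhat x = mulV (P.A x) (Dw x)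

/-! ### Assumptions on the finite element flux -/

/-- Weak divergence of `q_h` vanishes in each triangle. -/
def FluxDivFree (uh : E2 → ℝ) : Prop :=
  ∀ T ∈ M.tri, HasWeakDiv (elt T) (P.flux uh) (fun _ => 0)

/-- `η T e = q_h|_T · n_T` on each edge of each triangle (for a flux with vanishing divergence
in each triangle). -/
def IsEdgeFlux (uh : E2 → ℝ) (η : Finset E2 → Finset E2 → E2 → ℝ) : Prop :=
  ∀ T ∈ M.tri, HasNormalFlux T (P.flux uh) (fun _ => 0) (η T)

/-- `(q_h|_T + q_h|_T')·n` is constant on each interior edge; on an edge on `ΓD`, where there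
is only one triangle `T`, `q_h|_T·n` is constant. -/
def FluxSumConst (η : Finset E2 → Finset E2 → E2 → ℝ) : Prop :=
  (∀ e ∈ M.edges, ∀ T ∈ M.adj e, ∀ T' ∈ M.adj e, T ≠ T' →
    ConstOn e (fun x => η T e x - η T' e x)) ∧
  ∀ e, P.IsDirichletEdge M e → ∀ T ∈ M.adj e, ConstOn e (η T e)

/-- `(q_h|_T - q_h|_T')·n` is constant on each interior edge; on an edge on `ΓN` the outer
flux is `g`, and `g - q_h|_T·n` is constant. -/
def FluxJumpConst (η : Finset E2 → Finset E2 → E2 → ℝ) : Prop :=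
  (∀ e ∈ M.edges, ∀ T ∈ M.adj e, ∀ T' ∈ M.adj e, T ≠ T' →
    ConstOn e (fun x => η T e x + η T' e x)) ∧
  ∀ e, P.IsNeumannEdge M e → ∀ T ∈ M.adj e, ConstOn e (fun x => P.g x - η T e x)

end Problem

end CRE

end

noncomputable section

namespace CRE

/-! ### Lipschitz functions and weak gradients -/

/-! On a triangle T put d = ∇w_T - ∇u_h. Since q̂_h - q_h = A d there, the functional is half the
sum of the local energies ∫_T A d·d, and it suffices to bound each of them by errors near T. As div
q_h = 0, subtracting Green's formula for q_h from the local Neumann problem gives ∫_T A d·∇v = ∫_T f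
v + Σ_e ∫_e (ĝ_T - q_h·n_T) v. The left side ignores constants, so v can be normalized by the
Poincaré inequality, and a trace inequality bounds the right side by ‖∇v‖ times the size of h_T ‖f‖
and of the traction defect ĝ_T - q_h·n_T (`abs_local_residual_le`). Taking v close to w_T - u_h
closes the local estimate (`integral_sq_local_le`). Smooth functions are dense in H¹ of a bounded
convex open set (`MemH1.exists_smooth_approx`), so that v can be kept smooth and its traces are
plain restrictions.

The load h_T ‖f‖ and the flux jumps times the edge lengths are bounded by testing the residual of
u_h with bubble functions, products of nodal functions (`width_mul_nrm_f_le`,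
`abs_jump_mul_len_le`). The element residual is f itself because div q_h = 0. It is replaced by a
constant at the cost of h_T² ‖∇f‖, which is the source of the h⁴ term. The jumps are constant by
(H3) and come out of the edge integrals.

By (H2) and (H3) the traction defect is affine on every edge (`exists_affine_traction`), hence
controlled by its two moments against the nodal functions (`sq_edgeInt_mul_le`). These are compared
with the averaged moments b^m. The one-sided moments of q_h differ from b^m by half a jump. The
moments of ĝ minimize a distance to b^m among the solutions of the node system, so it is enough to
exhibit one solution near b^m. Now b^m solves the system up to jumps and the terms ∫ f φ_i, and
correcting it is a linear system with coefficients 0, 1, -1 and with at most N equations and 3N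
unknowns, which is solvable because the moments of ĝ solve the node system. There are finitely many
such matrices, so some correction is bounded by the right side with a constant that depends on N
only (`exists_signSystem_const`, `exists_competitor`). The weights |Γ|⁻² do no harm because edges of
triangles linked around i through shared edges have comparable lengths, and the correction is made
in one such fan at a time (`abs_sub_meanProj_le`).

Each triangle enters the neighbourhoods of boundedly many others, so the squared local estimates add
up to the claim (`creSq_le_energySq`). -/

/-- A function that is `K`-Lipschitz on each of finitely many closed sets covering a normed space
is `K`-Lipschitz. -/
theorem lipschitzWith_of_finite_closed_cover {E F ι : Type*} [NormedAddCommGroup E]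
    [NormedSpace ℝ E] [PseudoMetricSpace F] [Finite ι] {C : ι → Set E} (hC : ∀ i, IsClosed (C i))
    (hcov : ∀ x, ∃ i, x ∈ C i) {f : E → F} {K : NNReal} (h : ∀ i, LipschitzOnWith K f (C i)) :
    LipschitzWith K f := by
  have hcont : Continuous f := by
    refine (locallyFinite_of_finite C).continuous ?_ hC (fun i => (h i).continuousOn)
    ext x; simpa using hcov x
  refine LipschitzWith.of_dist_le_mul fun y x => ?_
  set γ : ℝ → E := fun t => AffineMap.lineMap x y t with hγ
  have hγc : Continuous γ := AffineMap.lineMap_continuous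
  have hd : ∀ s t, dist (γ s) (γ t) = dist s t * dist x y := fun s t => by
    simp [hγ, dist_lineMap_lineMap]
  -- Continuous induction along the segment. `S` is closed and contains 0. If t < 1 is in `S`, one
  -- of the finitely many sets contains `γ s` for s arbitrarily close to t from the right, hence
  -- also `γ t` since it is closed, and its Lipschitz bound carries the estimate from t to such an
  -- s.
  set S : Set ℝ := {t | dist (f (γ t)) (f x) ≤ K * (t * dist x y)} with hS
  have hSc : IsClosed S := isClosed_le (by fun_prop) (by fun_prop)
  have key : (1 : ℝ) ∈ S := by
    refine (hSc.inter isClosed_Icc).mem_of_ge_of_forall_exists_gt (a := 0) ?_ zero_le_one ?_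
    · simp [hS, hγ]
    rintro t ⟨htS, ht0, ht1⟩
    have hfr : ∃ i, ∃ᶠ s in 𝓝[>] t, γ s ∈ C i := by
      by_contra! hcon
      have : ∀ᶠ s in 𝓝[>] t, ∀ i, γ s ∉ C i := by
        rw [eventually_all]; intro i; simpa using hcon i
      obtain ⟨s, hs⟩ := this.exists
      obtain ⟨i, hi⟩ := hcov (γ s)
      exact hs i hi
    obtain ⟨i, hi⟩ := hfr
    have hti : γ t ∈ C i := by
      have : ∃ᶠ s in 𝓝 t, γ s ∈ C i := hi.filter_mono nhdsWithin_le_nhds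
      exact ((hC i).preimage hγc).closure_subset (mem_closure_iff_frequently.2 this)
    obtain ⟨s, hsi, hs⟩ := (hi.and_eventually (Ioc_mem_nhdsGT ht1)).exists
    refine ⟨s, ?_, hs⟩
    have h1 := (h i).dist_le_mul _ hsi _ hti
    rw [hd, Real.dist_eq, abs_of_pos (sub_pos.2 hs.1)] at h1
    have h2 : dist (f (γ t)) (f x) ≤ K * (t * dist x y) := htS
    have h3 := dist_triangle (f (γ s)) (f (γ t)) (f x)
    show dist (f (γ s)) (f x) ≤ K * (s * dist x y)
    nlinarith
  have : dist (f (γ 1)) (f x) ≤ K * (1 * dist x y) := key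
  simpa [hγ, dist_comm x y] using this

/-! ### The classical gradient in the plane -/

theorem inner_gradient (f : E2 → ℝ) (x ξ : E2) : inner ℝ (gradient f x) ξ = fderiv ℝ f x ξ := by
  simp [gradient]

theorem norm_gradient (f : E2 → ℝ) (x : E2) : ‖gradient f x‖ = ‖fderiv ℝ f x‖ := by
  simp [gradient]

theorem gradient_eq_of_eventuallyEq {f g : E2 → ℝ} {x : E2} (h : f =ᶠ[𝓝 x] g) :
    gradient f x = gradient g x := by
  simp [gradient, h.fderiv_eq]

theorem contDiff_gradient {f : E2 → ℝ} (hf : ContDiff ℝ ∞ f) : Continuous (gradient f) := by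
  unfold gradient
  exact (LinearIsometryEquiv.continuous _).comp (hf.continuous_fderiv (by simp))

theorem gradient_mul {f g : E2 → ℝ} {x : E2} (hf : DifferentiableAt ℝ f x)
    (hg : DifferentiableAt ℝ g x) :
    gradient (fun y => f y * g y) x = f x • gradient g x + g x • gradient f x := by
  simp [gradient, fderiv_fun_mul hf hg]

theorem gradient_support {f : E2 → ℝ} : Function.support (gradient f) ⊆ tsupport f := by
  intro x hx
  by_contra h
  apply hx
  have : f =ᶠ[𝓝 x] fun _ => 0 := notMem_tsupport_iff_eventuallyEq.1 h
  rw [gradient_eq_of_eventuallyEq this]; simp [gradient]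

/-- The integral of the gradient of a compactly supported Lipschitz function vanishes. -/
theorem integral_gradient_eq_zero {F : E2 → ℝ} {K : NNReal} (hF : LipschitzWith K F)
    (hc : HasCompactSupport F) : ∫ x, gradient F x = 0 := by
  have hb : ∀ x, ‖gradient F x‖ ≤ K := fun x => by
    rw [norm_gradient]; exact norm_fderiv_le_of_lipschitz ℝ hF
  have hm : Measurable (gradient F) := by
    unfold gradient
    exact (LinearIsometryEquiv.continuous _).measurable.comp (measurable_fderiv ℝ F)
  have hintegrable : Integrable (gradient F) := by
    rw [← integrableOn_iff_integrable_of_support_subset gradient_support]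
    exact Measure.integrableOn_of_bounded (M := K) hc.isCompact.measure_lt_top.ne
      hm.aestronglyMeasurable (ae_of_all _ hb)
  refine ext_inner_right ℝ fun ξ => ?_
  rw [inner_zero_left, ← real_inner_comm, ← integral_inner hintegrable]
  -- Integration by parts against the constant 1. The direction is `-ξ` because the formula reverses
  -- it on the side where `F` is differentiated.
  have h0 := LipschitzWith.integral_lineDeriv_mul_eq (μ := (volume : Measure E2))
    (LipschitzWith.const (1 : ℝ)) hF hc (-ξ)
  have : ∀ x : E2, lineDeriv ℝ (fun _ : E2 => (1 : ℝ)) x (-ξ) = 0 := fun x => by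
    simp [lineDeriv]
  simp only [this, zero_mul, integral_zero, neg_neg, mul_one] at h0
  rw [h0]
  refine integral_congr_ae ?_
  filter_upwards [hF.ae_differentiableAt] with x hx
  rw [real_inner_comm, inner_gradient, hx.lineDeriv_eq_fderiv]

theorem exists_lipschitzOnWith_of_contDiff {F : E2 → ℝ} (hF : ContDiff ℝ ∞ F) {s : Set E2}
    (hs : IsCompact s) (hc : Convex ℝ s) : ∃ K : NNReal, LipschitzOnWith K F s := by
  obtain ⟨C, hC⟩ := hs.exists_bound_of_continuousOn (f := fderiv ℝ F)
    (hF.continuous_fderiv (by simp)).continuousOn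
  refine ⟨C.toNNReal, hc.lipschitzOnWith_of_nnnorm_fderiv_le
    (fun x _ => (hF.differentiable (by simp)).differentiableAt) fun x hx => ?_⟩
  rw [← NNReal.coe_le_coe, coe_nnnorm]
  exact (hC x hx).trans (Real.le_coe_toNNReal C)

theorem lipschitzWith_of_contDiff_hasCompactSupport {F : E2 → ℝ} (hF : ContDiff ℝ ∞ F)
    (hc : HasCompactSupport F) : ∃ K : NNReal, LipschitzWith K F :=
  hF.lipschitzWith_of_hasCompactSupport hc (by simp)

theorem memLp_of_continuous {G : Type*} [NormedAddCommGroup G]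
    [SecondCountableTopologyEither E2 G] {F : E2 → G} (hF : Continuous F)
    {U : Set E2} (hU : Bornology.IsBounded U) (hm : MeasurableSet U) {μ : Measure E2}
    (hμ : μ U ≠ ⊤) (p : ENNReal) : MemLp F p (μ.restrict U) := by
  obtain ⟨C, hC⟩ := hU.isCompact_closure.exists_bound_of_continuousOn hF.continuousOn
  have : IsFiniteMeasure (μ.restrict U) := ⟨by simpa using hμ.lt_top⟩
  refine MemLp.of_bound hF.aestronglyMeasurable C ?_
  exact ae_restrict_of_forall_mem hm fun x hx => hC x (subset_closure hx)

/-- Functions whose products with test functions are Lipschitz are weakly differentiable, and the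
weak gradient is the almost everywhere defined classical one. -/
theorem memH1_of_lipschitz {U : Set E2} (hU : IsOpen U) (hb : Bornology.IsBounded U)
    {v : E2 → ℝ} {Dv : E2 → E2} (hv : MemLp v 2 (volume.restrict U))
    (hDv : MemLp Dv 2 (volume.restrict U))
    (hgrad : ∀ᵐ x ∂(volume.restrict U), DifferentiableAt ℝ v x ∧ gradient v x = Dv x)
    (hlip : ∀ ψ : E2 → ℝ, ContDiff ℝ ∞ ψ → HasCompactSupport ψ → tsupport ψ ⊆ U →
      ∃ K, LipschitzWith K (fun x => ψ x * v x)) : MemH1 U v Dv := by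
  refine ⟨hv, hDv, fun ψ hψ hψc hψU => ?_⟩
  obtain ⟨K, hK⟩ := hlip ψ hψ hψc hψU
  have hfin : volume U ≠ ⊤ := hb.measure_lt_top.ne
  have hcs : HasCompactSupport (fun x => ψ x * v x) := hψc.mul_right
  -- Expanded by the product rule almost everywhere, ∫ ∇(ψ v) = 0 is the identity that defines the
  -- weak gradient.
  have h0 := integral_gradient_eq_zero hK hcs
  have hsub : Function.support (gradient fun x => ψ x * v x) ⊆ U :=
    gradient_support.trans ((tsupport_mul_subset_left (f := ψ) (g := v)).trans hψU)
  rw [← setIntegral_eq_integral_of_forall_compl_eq_zero (s := U)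
    (fun x hx => by_contra fun h => hx (hsub h))] at h0
  have hi1 : Integrable (fun x => v x • gradient ψ x) (volume.restrict U) := by
    rw [← memLp_one_iff_integrable]
    exact MemLp.smul (memLp_of_continuous (contDiff_gradient hψ) hb hU.measurableSet hfin 2) hv
  have hi2 : Integrable (fun x => ψ x • Dv x) (volume.restrict U) := by
    rw [← memLp_one_iff_integrable]
    exact MemLp.smul hDv (memLp_of_continuous hψ.continuous hb hU.measurableSet hfin 2)
  rw [eq_neg_iff_add_eq_zero, ← integral_add hi1 hi2, ← h0]
  refine integral_congr_ae ?_
  filter_upwards [hgrad] with x hx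
  rw [gradient_mul (hψ.differentiable (by simp)).differentiableAt hx.1, hx.2, add_comm]

/-- A smooth function on the plane is in `H¹` of any bounded open set. -/
theorem memH1_of_contDiff {F : E2 → ℝ} (hF : ContDiff ℝ ∞ F) {U : Set E2} (hU : IsOpen U)
    (hb : Bornology.IsBounded U) : MemH1 U F (gradient F) := by
  have hfin : volume U ≠ ⊤ := hb.measure_lt_top.ne
  refine memH1_of_lipschitz hU hb (memLp_of_continuous hF.continuous hb hU.measurableSet hfin 2)
    (memLp_of_continuous (contDiff_gradient hF) hb hU.measurableSet hfin 2)
    (ae_of_all _ fun x => ⟨(hF.differentiable (by simp)).differentiableAt, rfl⟩) ?_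
  intro ψ hψ hψc _
  exact lipschitzWith_of_contDiff_hasCompactSupport (hψ.mul hF) hψc.mul_right

theorem MemH1.mono {U U' : Set E2} {v : E2 → ℝ} {Dv : E2 → E2} (h : MemH1 U v Dv)
    (hU : U' ⊆ U) : MemH1 U' v Dv := by
  refine ⟨h.memLp.mono_measure (Measure.restrict_mono hU le_rfl),
    h.memLp_grad.mono_measure (Measure.restrict_mono hU le_rfl), fun ψ hψ hψc hψU => ?_⟩
  have key := h.weak_grad ψ hψ hψc (hψU.trans hU)
  have hg : ∀ x, x ∉ U' → gradient ψ x = 0 := fun x hx => by_contra fun hne =>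
    hx (hψU (gradient_support hne))
  have hp : ∀ x, x ∉ U' → ψ x = 0 := fun x hx => by_contra fun hne =>
    hx (hψU (subset_tsupport ψ hne))
  rw [setIntegral_eq_integral_of_forall_compl_eq_zero
      (fun x hx => by rw [hg x (fun h => hx (hU h)), smul_zero]),
    setIntegral_eq_integral_of_forall_compl_eq_zero
      (fun x hx => by rw [hp x (fun h => hx (hU h)), zero_smul])] at key
  rw [setIntegral_eq_integral_of_forall_compl_eq_zero (fun x hx => by rw [hg x hx, smul_zero]),
    setIntegral_eq_integral_of_forall_compl_eq_zero (fun x hx => by rw [hp x hx, zero_smul])]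
  exact key

/-! ### Density of smooth functions in `H¹` of a bounded convex open set -/

theorem lintegral_comp_smul_add (H : E2 → ENNReal) {s : ℝ} (hs : 0 < s) (a : E2) :
    ∫⁻ x, H (s • x + a) = ENNReal.ofReal (s ^ 2)⁻¹ * ∫⁻ x, H x := by
  have h1 : ∫⁻ x, H (s • x + a) = ∫⁻ y, H (y + a) ∂(Measure.map (fun x : E2 => s • x) volume) :=
    (lintegral_map_equiv (fun y => H (y + a))
      (Homeomorph.smul (isUnit_iff_ne_zero.2 hs.ne').unit).toMeasurableEquiv).symm
  rw [h1, Measure.map_addHaar_smul _ hs.ne', lintegral_smul_measure, smul_eq_mul,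
    lintegral_add_right_eq_self]
  simp [abs_of_pos hs]

theorem sq_eLpNorm_two {α G : Type*} [MeasurableSpace α] [NormedAddCommGroup G] (F : α → G)
    (μ : Measure α) : eLpNorm F 2 μ ^ 2 = ∫⁻ x, ‖F x‖ₑ ^ 2 ∂μ := by
  have := eLpNorm_nnreal_pow_eq_lintegral (f := F) (μ := μ) (p := 2) two_ne_zero
  simpa using this

/-- Jensen's inequality for the square, from the monotonicity of the Lᵖ norms of a probability
measure. -/
theorem enorm_integral_sq_le {α G : Type*} [MeasurableSpace α] [NormedAddCommGroup G]
    [NormedSpace ℝ G] {F : α → G} {ν : Measure α} [IsProbabilityMeasure ν]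
    (hF : AEStronglyMeasurable F ν) : ‖∫ z, F z ∂ν‖ₑ ^ 2 ≤ ∫⁻ z, ‖F z‖ₑ ^ 2 ∂ν := by
  rw [← sq_eLpNorm_two]
  gcongr
  calc ‖∫ z, F z ∂ν‖ₑ ≤ ∫⁻ z, ‖F z‖ₑ ∂ν := enorm_integral_le_lintegral_enorm _
    _ = eLpNorm F 1 ν := eLpNorm_one_eq_lintegral_enorm.symm
    _ ≤ eLpNorm F 2 ν := eLpNorm_le_eLpNorm_of_exponent_le (by norm_num) hF

/-- Averages `x ↦ ∫ G (s x + (1 - s) z) dν(z)` over a bounded set approximate `G` in `L²` as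
`s → 1`. -/
theorem tendsto_dilation_average {G : Type*} [NormedAddCommGroup G] [NormedSpace ℝ G]
    [CompleteSpace G] {F : E2 → G} (hF : StronglyMeasurable F) (hF2 : MemLp F 2 volume)
    {U : Set E2} (hU : Bornology.IsBounded U) (hUm : MeasurableSet U) {ν : Measure E2}
    [IsProbabilityMeasure ν] (hν : ∀ᵐ z ∂ν, z ∈ U) :
    Tendsto (fun s : ℝ => eLpNorm (fun x => (∫ z, F (s • x + (1 - s) • z) ∂ν) - F x) 2
      (volume.restrict U)) (𝓝[<] 1) (𝓝 0) := by
  have hfin : volume U ≠ ⊤ := hU.measure_lt_top.ne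
  have hUfin : IsFiniteMeasure (volume.restrict U) := ⟨by simpa using hfin.lt_top⟩
  set π : Measure (E2 × E2) := (volume.restrict U).prod ν with hπ
  set N : ℝ → (E2 → G) → ENNReal :=
    fun s H => eLpNorm (fun p : E2 × E2 => H (s • p.1 + (1 - s) • p.2) - H p.1) 2 π with hN
  have hmap : ∀ s : ℝ, Measurable fun p : E2 × E2 => s • p.1 + (1 - s) • p.2 := fun s => by
    fun_prop
  -- Jensen's inequality in z reduces the average to a norm on the product space. For an x whose
  -- slice is not integrable the Bochner integral is 0 by convention, but then the right side is
  -- infinite.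
  have hle : ∀ s, eLpNorm (fun x => (∫ z, F (s • x + (1 - s) • z) ∂ν) - F x) 2
      (volume.restrict U) ≤ N s F := by
    intro s
    have hsm : StronglyMeasurable (fun p : E2 × E2 => F (s • p.1 + (1 - s) • p.2) - F p.1) :=
      (hF.comp_measurable (hmap s)).sub (hF.comp_measurable measurable_fst)
    rw [← ENNReal.pow_le_pow_left_iff two_ne_zero, sq_eLpNorm_two, hN]
    simp only
    rw [sq_eLpNorm_two, hπ, lintegral_prod _ (by fun_prop)]
    refine lintegral_mono fun x => ?_
    have hsl : StronglyMeasurable (fun z => F (s • x + (1 - s) • z)) :=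
      hF.comp_measurable (by fun_prop)
    by_cases hintegrable : Integrable (fun z => F (s • x + (1 - s) • z)) ν
    · have : (∫ z, F (s • x + (1 - s) • z) ∂ν) - F x
          = ∫ z, (F (s • x + (1 - s) • z) - F x) ∂ν := by
        rw [integral_sub hintegrable (integrable_const _)]; simp
      rw [this]
      exact enorm_integral_sq_le (hsl.sub stronglyMeasurable_const).aestronglyMeasurable
    · have htop : ∫⁻ z, ‖F (s • x + (1 - s) • z) - F x‖ₑ ^ 2 ∂ν = ⊤ := by
        by_contra hne
        apply hintegrable
        have hm : MemLp (fun z => F (s • x + (1 - s) • z) - F x) 2 ν := by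
          refine ⟨(hsl.sub stronglyMeasurable_const).aestronglyMeasurable, ?_⟩
          rw [← sq_eLpNorm_two] at hne
          exact lt_of_le_of_ne le_top fun h => hne (by rw [h]; simp)
        have := (hm.integrable (by norm_num)).add (integrable_const (F x))
        refine this.congr (ae_of_all _ fun z => ?_)
        simp
      simp only [htop, le_top]
  refine tendsto_of_tendsto_of_tendsto_of_le_of_le tendsto_const_nhds ?_ (fun _ => zero_le) hle
  -- In the plane, dilation by s multiplies the squared norm by s⁻² ≤ 4, hence the norm by at most
  -- 2. The undilated term adds 1.
  have hbound : ∀ H : E2 → G, StronglyMeasurable H → ∀ s : ℝ, 1 / 2 < s → s < 1 →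
      N s H ≤ 3 * eLpNorm H 2 volume := by
    intro H hH s hs hs1
    have hm1 : StronglyMeasurable (fun p : E2 × E2 => H (s • p.1 + (1 - s) • p.2)) :=
      hH.comp_measurable (hmap s)
    have hm2 : StronglyMeasurable (fun p : E2 × E2 => H p.1) := hH.comp_measurable measurable_fst
    have e1 : eLpNorm (fun p : E2 × E2 => H (s • p.1 + (1 - s) • p.2)) 2 π
        ≤ 2 * eLpNorm H 2 volume := by
      rw [← ENNReal.pow_le_pow_left_iff two_ne_zero, mul_pow, sq_eLpNorm_two, sq_eLpNorm_two, hπ,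
        lintegral_prod_symm _ (hm1.enorm.pow_const 2).aemeasurable]
      calc ∫⁻ z, (∫⁻ x in U, ‖H (s • x + (1 - s) • z)‖ₑ ^ 2) ∂ν
          ≤ ∫⁻ z, ENNReal.ofReal (s ^ 2)⁻¹ * (∫⁻ x, ‖H x‖ₑ ^ 2) ∂ν := by
            refine lintegral_mono fun z => (setLIntegral_le_lintegral _ _).trans ?_
            rw [lintegral_comp_smul_add (fun y => ‖H y‖ₑ ^ 2) (by linarith)]
        _ = ENNReal.ofReal (s ^ 2)⁻¹ * (∫⁻ x, ‖H x‖ₑ ^ 2) := by simp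
        _ ≤ 2 ^ 2 * ∫⁻ x, ‖H x‖ₑ ^ 2 := by
            gcongr
            rw [show (2 : ENNReal) ^ 2 = ENNReal.ofReal 4 by
              rw [show (4 : ℝ) = ((2 : ℕ) : ℝ) ^ 2 by norm_num, ENNReal.ofReal_pow (by norm_num),
                ENNReal.ofReal_natCast]; norm_num]
            apply ENNReal.ofReal_le_ofReal
            rw [inv_le_comm₀ (by positivity) (by norm_num)]
            nlinarith
    have e2 : eLpNorm (fun p : E2 × E2 => H p.1) 2 π ≤ eLpNorm H 2 volume := by
      rw [← ENNReal.pow_le_pow_left_iff two_ne_zero, sq_eLpNorm_two, sq_eLpNorm_two, hπ,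
        lintegral_prod _ (hm2.enorm.pow_const 2).aemeasurable]
      simp only [lintegral_const, measure_univ, mul_one]
      exact setLIntegral_le_lintegral _ _
    calc N s H ≤ _ + _ := eLpNorm_sub_le hm1.aestronglyMeasurable hm2.aestronglyMeasurable
          (by norm_num)
      _ ≤ 2 * eLpNorm H 2 volume + eLpNorm H 2 volume := add_le_add e1 e2
      _ = 3 * eLpNorm H 2 volume := by ring
  rw [ENNReal.tendsto_nhds_zero]
  intro ε hε
  -- With the bound 3 above, an approximation within ε/6 costs ε/2. The other half is left for the
  -- continuous function `g`, where uniform continuity applies because the displacement (1 - s)(z -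
  -- x) tends to 0 uniformly on bounded sets.
  obtain ⟨g, hgc, hgε, hgcont, -⟩ := hF2.exists_hasCompactSupport_eLpNorm_sub_le
    (by norm_num) (ε := ε / 6) (by simp [hε.ne'])
  have hgN : Tendsto (fun s => N s g) (𝓝[<] 1) (𝓝 0) := by
    obtain ⟨R, hR⟩ := hU.exists_norm_le
    have hR0 : 0 ≤ |R| := abs_nonneg R
    have hguc := hgc.uniformContinuous_of_continuous hgcont
    rw [ENNReal.tendsto_nhds_zero]
    intro ε' hε'
    set m : ENNReal := (π Set.univ) ^ (2 : ENNReal).toReal⁻¹ with hm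
    have hmtop : m ≠ ⊤ := by
      refine ENNReal.rpow_ne_top_of_nonneg (by positivity) (measure_ne_top _ _)
    obtain ⟨δ, hδ, hδm⟩ : ∃ δ : ℝ, 0 < δ ∧ m * ENNReal.ofReal δ ≤ ε' := by
      have : Tendsto (fun δ : ℝ => m * ENNReal.ofReal δ) (𝓝[>] 0) (𝓝 (m * ENNReal.ofReal 0)) :=
        (ENNReal.Tendsto.const_mul (ENNReal.tendsto_ofReal tendsto_id) (Or.inr hmtop)).mono_left
          nhdsWithin_le_nhds
      rw [ENNReal.ofReal_zero, mul_zero, ENNReal.tendsto_nhds_zero] at this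
      obtain ⟨δ, h1, h2⟩ := ((this ε' hε').and self_mem_nhdsWithin).exists
      exact ⟨δ, h2, h1⟩
    obtain ⟨η, hη, hηg⟩ := Metric.uniformContinuous_iff.1 hguc δ hδ
    have hs : ∀ᶠ s : ℝ in 𝓝[<] 1, 1 - s < η / (2 * |R| + 1) := by
      have : Tendsto (fun s : ℝ => 1 - s) (𝓝[<] 1) (𝓝 (1 - 1)) :=
        (tendsto_const_nhds.sub tendsto_id).mono_left nhdsWithin_le_nhds
      rw [sub_self] at this
      exact this.eventually_lt_const (by positivity)
    filter_upwards [hs, self_mem_nhdsWithin] with s hs hs1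
    have hs1 : s < 1 := hs1
    refine (eLpNorm_le_of_ae_bound (C := δ) ?_).trans hδm
    have hU1 : ∀ᵐ p ∂π, p.1 ∈ U :=
      Measure.quasiMeasurePreserving_fst.ae (ae_restrict_mem hUm)
    have hU2 : ∀ᵐ p ∂π, p.2 ∈ U := Measure.quasiMeasurePreserving_snd.ae hν
    filter_upwards [hU1, hU2] with p h1 h2
    rw [← dist_eq_norm]
    refine (hηg ?_).le
    rw [dist_eq_norm, show s • p.1 + (1 - s) • p.2 - p.1 = (1 - s) • (p.2 - p.1) by module,
      norm_smul, Real.norm_of_nonneg (by linarith)]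
    have hn : ‖p.2 - p.1‖ ≤ 2 * |R| := by
      refine (norm_sub_le _ _).trans ?_
      have := (hR _ h1).trans (le_abs_self R)
      have := (hR _ h2).trans (le_abs_self R)
      linarith
    rw [lt_div_iff₀ (by positivity)] at hs
    nlinarith [norm_nonneg (p.2 - p.1)]
  have h12 : ∀ᶠ s : ℝ in 𝓝[<] 1, 1 / 2 < s :=
    (eventually_gt_nhds (by norm_num)).filter_mono nhdsWithin_le_nhds
  filter_upwards [(ENNReal.tendsto_nhds_zero.1 hgN) (ε / 2) (by simp [hε.ne']), h12,
    self_mem_nhdsWithin] with s hs hs12 hs1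
  have hgm : StronglyMeasurable g := hgcont.stronglyMeasurable_of_hasCompactSupport hgc
  have hsum : N s F ≤ N s (F - g) + N s g := by
    have : (fun p : E2 × E2 => F (s • p.1 + (1 - s) • p.2) - F p.1)
        = (fun p : E2 × E2 => (F - g) (s • p.1 + (1 - s) • p.2) - (F - g) p.1)
          + (fun p : E2 × E2 => g (s • p.1 + (1 - s) • p.2) - g p.1) := by
      ext p; simp; abel
    simp only [hN]
    rw [this]
    refine eLpNorm_add_le ?_ ?_ (by norm_num)
    · exact (((hF.sub hgm).comp_measurable (hmap s)).sub
        ((hF.sub hgm).comp_measurable measurable_fst)).aestronglyMeasurable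
    · exact ((hgm.comp_measurable (hmap s)).sub
        (hgm.comp_measurable measurable_fst)).aestronglyMeasurable
  calc N s F ≤ N s (F - g) + N s g := hsum
    _ ≤ 3 * (ε / 6) + ε / 2 := by
        gcongr
        exact (hbound _ (hF.sub hgm) s hs12 hs1).trans (by gcongr)
    _ = ε := by
        have h6 : (3 : ENNReal) * (ε / 6) = ε / 2 := by
          rw [show (6 : ENNReal) = 3 * 2 by norm_num, ENNReal.div_eq_inv_mul,
            ENNReal.mul_inv (by norm_num) (by norm_num), ← mul_assoc, ← mul_assoc,
            ENNReal.mul_inv_cancel (by norm_num) (by norm_num), one_mul, ENNReal.div_eq_inv_mul]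
        rw [h6, ENNReal.add_halves]

theorem MemH1.congr {U : Set E2} {v v' : E2 → ℝ} {Dv Dv' : E2 → E2} (h : MemH1 U v Dv)
    (hv : v =ᵐ[volume.restrict U] v') (hD : Dv =ᵐ[volume.restrict U] Dv') : MemH1 U v' Dv' := by
  refine ⟨h.memLp.ae_eq hv, h.memLp_grad.ae_eq hD, fun ψ h1 h2 h3 => ?_⟩
  have := h.weak_grad ψ h1 h2 h3
  have e1 : ∫ x in U, v x • gradient ψ x = ∫ x in U, v' x • gradient ψ x :=
    integral_congr_ae (hv.mono fun x hx => by simp only [hx])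
  have e2 : ∫ x in U, ψ x • Dv x = ∫ x in U, ψ x • Dv' x :=
    integral_congr_ae (hD.mono fun x hx => by simp only [hx])
  rw [← e1, ← e2, this]

/-- The change of variables that turns a dilation average into a convolution. -/
theorem integral_dilation_kernel {G : Type*} [NormedAddCommGroup G] [NormedSpace ℝ G]
    (ρ : E2 → ℝ) (F : E2 → G) {s : ℝ} (hs : s < 1) (x : E2) :
    ∫ z, ρ z • F (s • x + (1 - s) • z)
      = ∫ y, (((1 - s) ^ 2)⁻¹ * ρ ((-(1 - s)⁻¹) • (s • x - y))) • F y := by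
  have h1 : 0 < 1 - s := by linarith
  set Φ : E2 → G := fun y => ρ ((-(1 - s)⁻¹) • (s • x - y)) • F y with hΦ
  have e1 : ∀ z, ρ z • F (s • x + (1 - s) • z) = Φ (s • x + (1 - s) • z) := fun z => by
    simp only [hΦ]
    congr 2
    rw [show s • x - (s • x + (1 - s) • z) = (-(1 - s)) • z by module, smul_smul]
    field_simp
    simp
  simp_rw [e1]
  rw [Measure.integral_comp_smul_of_nonneg volume (fun y => Φ (s • x + y)) (1 - s) (hR := h1.le),
    integral_add_left_eq_self]
  simp only [hΦ, mul_smul]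
  rw [integral_smul]
  simp

set_option maxHeartbeats 1000000 in
/-- Smooth functions on the plane are dense in `H¹` of a bounded convex open set. -/
theorem MemH1.exists_smooth_approx {U : Set E2} (hU : IsOpen U) (hc : Convex ℝ U)
    (hb : Bornology.IsBounded U) (hne : U.Nonempty) {v : E2 → ℝ} {Dv : E2 → E2}
    (h : MemH1 U v Dv) {ε : ENNReal} (hε : 0 < ε) :
    ∃ w : E2 → ℝ, ContDiff ℝ ∞ w ∧ eLpNorm (fun x => w x - v x) 2 (volume.restrict U) ≤ ε ∧
      eLpNorm (fun x => gradient w x - Dv x) 2 (volume.restrict U) ≤ ε := by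
  wlog hsm : StronglyMeasurable v ∧ StronglyMeasurable Dv generalizing v Dv
  · have e1 := h.memLp.aestronglyMeasurable.ae_eq_mk
    have e2 := h.memLp_grad.aestronglyMeasurable.ae_eq_mk
    obtain ⟨w, hw, hw1, hw2⟩ := this (h.congr e1 e2)
      ⟨h.memLp.aestronglyMeasurable.stronglyMeasurable_mk,
        h.memLp_grad.aestronglyMeasurable.stronglyMeasurable_mk⟩
    refine ⟨w, hw, ?_, ?_⟩
    · refine le_trans (le_of_eq (eLpNorm_congr_ae ?_)) hw1
      exact e1.mono fun x hx => congrArg (w x - ·) hx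
    · refine le_trans (le_of_eq (eLpNorm_congr_ae ?_)) hw2
      exact e2.mono fun x hx => congrArg (gradient w x - ·) hx
  obtain ⟨hvm, hDm⟩ := hsm
  obtain ⟨c, hcU⟩ := hne
  obtain ⟨r, hr, hrU⟩ := Metric.nhds_basis_closedBall.mem_iff.1 (hU.mem_nhds hcU)
  set β : ContDiffBump c := ⟨r / 2, r, by positivity, by linarith⟩ with hβ
  set ρ : E2 → ℝ := β.normed volume with hρ
  have hρ0 : ∀ z, 0 ≤ ρ z := fun z => β.nonneg_normed z
  have hρs : ContDiff ℝ ∞ ρ := β.contDiff_normed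
  have hρt : tsupport ρ = Metric.closedBall c r := β.tsupport_normed_eq
  have hρc : HasCompactSupport ρ := β.hasCompactSupport_normed
  set ν : Measure E2 := volume.withDensity (fun z => ENNReal.ofReal (ρ z)) with hν
  have hνp : IsProbabilityMeasure ν := ⟨by
    rw [hν, withDensity_apply _ MeasurableSet.univ, Measure.restrict_univ,
      ← ofReal_integral_eq_lintegral_ofReal β.integrable_normed (ae_of_all _ hρ0),
      β.integral_normed, ENNReal.ofReal_one]⟩
  have hνU : ∀ᵐ z ∂ν, z ∈ U := by
    rw [hν, ae_withDensity_iff (hρs.continuous.measurable.ennreal_ofReal)]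
    refine ae_of_all _ fun z hz => hrU ?_
    rw [← hρt]
    exact subset_tsupport ρ (fun h0 : ρ z = 0 => hz (by simp [h0]))
  have hνi : ∀ {G : Type} [NormedAddCommGroup G] [NormedSpace ℝ G] (H : E2 → G),
      ∫ z, H z ∂ν = ∫ z, ρ z • H z := fun H => by
    rw [hν, integral_withDensity_eq_integral_toReal_smul
      hρs.continuous.measurable.ennreal_ofReal (ae_of_all _ fun _ => ENNReal.ofReal_lt_top)]
    simp [ENNReal.toReal_ofReal (hρ0 _)]
  set V : E2 → ℝ := U.indicator v with hV
  set DV : E2 → E2 := U.indicator Dv with hDV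
  have hV2 : MemLp V 2 volume := (memLp_indicator_iff_restrict hU.measurableSet).2 h.memLp
  have hDV2 : MemLp DV 2 volume := (memLp_indicator_iff_restrict hU.measurableSet).2 h.memLp_grad
  have hVi : Integrable V := by
    rw [hV, integrable_indicator_iff hU.measurableSet]
    have : IsFiniteMeasure (volume.restrict U) := ⟨by simpa using hb.measure_lt_top⟩
    exact h.memLp.integrable (by norm_num)
  have t1 := tendsto_dilation_average (hvm.indicator hU.measurableSet) hV2 hb hU.measurableSet hνU
  have t2 := tendsto_dilation_average (hDm.indicator hU.measurableSet) hDV2 hb hU.measurableSet hνU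
  have t3 : Tendsto (fun s : ℝ => ENNReal.ofReal (1 - s) * eLpNorm DV 2 (volume.restrict U))
      (𝓝[<] 1) (𝓝 0) := by
    have : Tendsto (fun s : ℝ => ENNReal.ofReal (1 - s)) (𝓝[<] 1) (𝓝 (ENNReal.ofReal (1 - 1))) :=
      ENNReal.tendsto_ofReal ((tendsto_const_nhds.sub tendsto_id).mono_left nhdsWithin_le_nhds)
    have := ENNReal.Tendsto.mul_const (b := eLpNorm DV 2 (volume.restrict U)) this
      (Or.inr (hDV2.mono_measure Measure.restrict_le_self).eLpNorm_ne_top)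
    simpa using this
  obtain ⟨s, ⟨⟨⟨hs1, hs2⟩, hs3⟩, hs0⟩, hs⟩ :=
    ((((((ENNReal.tendsto_nhds_zero.1 t1) ε hε).and ((ENNReal.tendsto_nhds_zero.1 t2) (ε / 2)
      (by simp [hε.ne']))).and ((ENNReal.tendsto_nhds_zero.1 t3) (ε / 2) (by simp [hε.ne']))).and
      ((eventually_gt_nhds (zero_lt_one' ℝ)).filter_mono nhdsWithin_le_nhds)).and
      self_mem_nhdsWithin).exists
  have hs : s < 1 := hs
  have hs' : 0 < 1 - s := by linarith
  set k : E2 → ℝ := fun u => ((1 - s) ^ 2)⁻¹ * ρ ((-(1 - s)⁻¹) • u) with hk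
  have hks : ContDiff ℝ ∞ k := contDiff_const.mul (hρs.comp (contDiff_const_smul _))
  have hkc : HasCompactSupport k := by
    have : HasCompactSupport fun u => ρ ((-(1 - s)⁻¹) • u) :=
      hρc.comp_smul (neg_ne_zero.2 (inv_ne_zero hs'.ne'))
    exact this.mul_left
  -- For x in U and z in the small ball, s x + (1 - s) z stays in U by convexity. Averaging over z
  -- therefore mollifies without leaving U, and neither an extension operator nor regularity of the
  -- boundary is needed.
  set w : E2 → ℝ := fun x => ∫ z, V (s • x + (1 - s) • z) ∂ν with hw
  have hwk : w = fun x => (MeasureTheory.convolution V k (ContinuousLinearMap.mul ℝ ℝ) volume)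
      (s • x) := by
    ext x
    rw [hw]
    simp only
    rw [hνi, integral_dilation_kernel ρ V hs x, convolution_def]
    refine integral_congr_ae (ae_of_all _ fun y => ?_)
    simp [hk, mul_comm]
  have hws : ContDiff ℝ ∞ w := by
    rw [hwk]
    exact (hkc.contDiff_convolution_right _ hVi.locallyIntegrable hks).comp (contDiff_const_smul s)
  have hwg : ∀ x ∈ U, gradient w x = s • ∫ z, DV (s • x + (1 - s) • z) ∂ν := by
    intro x hx
    have hkx : ContDiff ℝ ∞ fun y => k (s • x - y) := hks.comp (contDiff_const.sub contDiff_id)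
    -- The kernel is supported at the points y = s x + (1 - s) z with z in the ball. These lie in U,
    -- so the kernel is an admissible test function for the weak gradient of v.
    have hsupp : tsupport (fun y => k (s • x - y)) ⊆ U := by
      have hsub : Function.support (fun y => k (s • x - y))
          ⊆ (fun y => (-(1 - s)⁻¹) • (s • x - y)) ⁻¹' Metric.closedBall c r := by
        intro y hy
        rw [← hρt]
        refine subset_tsupport ρ fun h0 => hy ?_
        simp only [hk]
        rw [h0, mul_zero]
      have hcl : IsClosed ((fun y : E2 => (-(1 - s)⁻¹) • (s • x - y)) ⁻¹' Metric.closedBall c r) :=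
        Metric.isClosed_closedBall.preimage (by fun_prop)
      intro y hy
      have hy' := closure_minimal hsub hcl hy
      have hyU := hrU hy'
      have := hc hx hyU hs0.le hs'.le (by ring)
      convert this using 1
      rw [smul_smul, show (1 - s) * -(1 - s)⁻¹ = -1 by field_simp]
      module
    have hcs : HasCompactSupport fun y => k (s • x - y) :=
      HasCompactSupport.of_support_subset_isCompact (hb.subset hsupp).isCompact_closure
        ((subset_tsupport _).trans subset_closure)
    have hwk' := h.weak_grad _ hkx hcs hsupp
    have hgr : ∀ y, gradient (fun y => k (s • x - y)) y = - gradient k (s • x - y) := fun y => by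
      refine ext_inner_right ℝ fun ξ => ?_
      rw [inner_neg_left, inner_gradient, inner_gradient]
      have hd : HasFDerivAt (fun y => k (s • x - y))
          ((fderiv ℝ k (s • x - y)).comp (-ContinuousLinearMap.id ℝ E2)) y :=
        HasFDerivAt.comp (g := k) (f := fun y => s • x - y) y
          (hks.differentiable (by simp)).differentiableAt.hasFDerivAt
          ((hasFDerivAt_id y).const_sub (s • x))
      rw [hd.fderiv]; simp
    simp_rw [hgr, smul_neg, integral_neg, neg_inj] at hwk'
    refine ext_inner_right ℝ fun ξ => ?_
    have hd1 := hkc.hasFDerivAt_convolution_right (ContinuousLinearMap.mul ℝ ℝ)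
      hVi.locallyIntegrable (hks.of_le (by simp)) (s • x)
    have hd2 : HasFDerivAt (fun x : E2 => s • x) (s • ContinuousLinearMap.id ℝ E2) x :=
      (hasFDerivAt_id x).const_smul s
    have hd := HasFDerivAt.comp (g := convolution V k (ContinuousLinearMap.mul ℝ ℝ) volume) x hd1 hd2
    have hfd : fderiv ℝ w x ξ = s * ∫ y, V y * fderiv ℝ k (s • x - y) ξ := by
      rw [hwk]
      erw [hd.fderiv]
      simp only [ContinuousLinearMap.comp_apply, _root_.smul_apply,
        ContinuousLinearMap.id_apply, map_smul, smul_eq_mul]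
      rw [convolution_precompR_apply _ hVi.locallyIntegrable (hkc.fderiv ℝ)
        (hks.continuous_fderiv (by simp)), convolution_def]
      rfl
    rw [inner_gradient, hfd, hνi, integral_dilation_kernel ρ DV hs x, inner_smul_left]
    simp only [conj_trivial]
    congr 1
    have i1 : ∫ y, (((1 - s) ^ 2)⁻¹ * ρ ((-(1 - s)⁻¹) • (s • x - y))) • DV y
        = ∫ y in U, k (s • x - y) • Dv y := by
      rw [← integral_indicator hU.measurableSet]
      refine integral_congr_ae (ae_of_all _ fun y => ?_)
      by_cases hy : y ∈ U <;> simp [hDV, hk, hy]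
    rw [i1, ← hwk', ← real_inner_comm, ← integral_inner, ← integral_indicator hU.measurableSet]
    · refine integral_congr_ae (ae_of_all _ fun y => ?_)
      by_cases hy : y ∈ U
      · simp only [hV, hy, Set.indicator_of_mem, inner_smul_right]
        rw [real_inner_comm, inner_gradient]
      · simp [hV, hy]
    · rw [← memLp_one_iff_integrable]
      refine MemLp.smul (p := 2) (q := 2) ?_ h.memLp
      exact memLp_of_continuous ((contDiff_gradient hks).comp (by fun_prop)) hb hU.measurableSet
        hb.measure_lt_top.ne 2
  refine ⟨w, hws, ?_, ?_⟩
  · refine le_trans (le_of_eq (eLpNorm_congr_ae ?_)) hs1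
    filter_upwards [ae_restrict_mem hU.measurableSet] with x hx
    simp [hw, hV, hx]
  -- The chain rule puts a factor s in front of the averaged gradient. The resulting defect (1 - s)
  -- `DV` is the term that `t3` makes small.
  · have heq : (fun x => gradient w x - Dv x) =ᵐ[volume.restrict U]
        (fun x => s • ((∫ z, DV (s • x + (1 - s) • z) ∂ν) - DV x) - (1 - s) • DV x) := by
      filter_upwards [ae_restrict_mem hU.measurableSet] with x hx
      rw [hwg x hx]
      have : DV x = Dv x := by simp [hDV, hx]
      rw [this]; module
    have hSm : AEStronglyMeasurable (fun x => (∫ z, DV (s • x + (1 - s) • z) ∂ν))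
        (volume.restrict U) := by
      refine StronglyMeasurable.aestronglyMeasurable ?_
      exact StronglyMeasurable.integral_prod_right (f := fun x z => DV (s • x + (1 - s) • z))
        ((hDm.indicator hU.measurableSet).comp_measurable (by fun_prop))
    have hDVm := (hDV2.mono_measure (Measure.restrict_le_self (s := U))).aestronglyMeasurable
    rw [eLpNorm_congr_ae heq]
    refine (eLpNorm_sub_le ((hSm.sub hDVm).const_smul s) (hDVm.const_smul (1 - s))
      (by norm_num)).trans ?_
    rw [← ENNReal.add_halves ε]
    refine add_le_add ?_ ?_
    · rw [eLpNorm_const_smul (c := s)]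
      refine le_trans ?_ hs2
      refine mul_le_of_le_one_left' ?_
      rw [Real.enorm_eq_ofReal hs0.le, ENNReal.ofReal_le_one]; exact hs.le
    · refine le_trans (le_of_eq ?_) hs3
      rw [eLpNorm_const_smul (c := 1 - s), Real.enorm_eq_ofReal hs'.le]

/-! ### The `L²` norm -/

section LpNorm

variable {α G : Type*} [MeasurableSpace α] [NormedAddCommGroup G] {μ : Measure α}

theorem sq_lpNorm_two {F : α → G} (hF : MemLp F 2 μ) : lpNorm F 2 μ ^ 2 = ∫ x, ‖F x‖ ^ 2 ∂μ := by
  rw [← toReal_eLpNorm hF.1, ← ENNReal.toReal_pow, sq_eLpNorm_two,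
    integral_eq_lintegral_of_nonneg_ae (f := fun x => ‖F x‖ ^ 2)
      (ae_of_all _ fun x => by positivity) (hF.1.norm.pow 2)]
  congr 1
  refine lintegral_congr fun x => ?_
  rw [ENNReal.ofReal_pow (norm_nonneg _), ofReal_norm]

theorem sq_lpNorm_two_real {F : α → ℝ} (hF : MemLp F 2 μ) :
    lpNorm F 2 μ ^ 2 = ∫ x, F x ^ 2 ∂μ := by
  simpa using sq_lpNorm_two hF

theorem abs_integral_mul_le {F H : α → ℝ} (hF : MemLp F 2 μ) (hH : MemLp H 2 μ) :
    |∫ x, F x * H x ∂μ| ≤ lpNorm F 2 μ * lpNorm H 2 μ := by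
  have hi : MemLp (fun x => F x * H x) 1 μ := MemLp.mul hH hF
  have h : eLpNorm (fun x => F x * H x) 1 μ ≤ eLpNorm F 2 μ * eLpNorm H 2 μ :=
    eLpNorm_smul_le_mul_eLpNorm (p := 2) (q := 2) (r := 1) (φ := F) (f := H) hH.1 hF.1
  calc |∫ x, F x * H x ∂μ| ≤ ∫ x, ‖F x * H x‖ ∂μ :=
        norm_integral_le_integral_norm (fun x => F x * H x)
    _ = (eLpNorm (fun x => F x * H x) 1 μ).toReal := by
        rw [toReal_eLpNorm hi.1, lpNorm_one_eq_integral_norm hi.1]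
    _ ≤ (eLpNorm F 2 μ * eLpNorm H 2 μ).toReal :=
        ENNReal.toReal_mono (ENNReal.mul_ne_top hF.2.ne hH.2.ne) h
    _ = _ := by rw [ENNReal.toReal_mul, toReal_eLpNorm hF.1, toReal_eLpNorm hH.1]

theorem integrable_inner_of_memLp [InnerProductSpace ℝ G] {F H : α → G} (hF : MemLp F 2 μ)
    (hH : MemLp H 2 μ) : Integrable (fun x => inner ℝ (F x) (H x)) μ := by
  refine (MemLp.integrable_mul hF.norm hH.norm).mono (hF.1.inner hH.1) (ae_of_all _ fun x => ?_)
  simpa using norm_inner_le_norm (𝕜 := ℝ) (F x) (H x)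

theorem abs_integral_inner_le [InnerProductSpace ℝ G] {F H : α → G} (hF : MemLp F 2 μ)
    (hH : MemLp H 2 μ) : |∫ x, inner ℝ (F x) (H x) ∂μ| ≤ lpNorm F 2 μ * lpNorm H 2 μ := by
  calc |∫ x, inner ℝ (F x) (H x) ∂μ| ≤ ∫ x, ‖inner ℝ (F x) (H x)‖ ∂μ :=
        norm_integral_le_integral_norm (fun x => inner ℝ (F x) (H x))
    _ ≤ ∫ x, ‖F x‖ * ‖H x‖ ∂μ := by
        refine integral_mono (integrable_inner_of_memLp hF hH).norm
          (MemLp.integrable_mul hF.norm hH.norm) fun x => norm_inner_le_norm _ _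
    _ ≤ |∫ x, ‖F x‖ * ‖H x‖ ∂μ| := le_abs_self _
    _ ≤ lpNorm (fun x => ‖F x‖) 2 μ * lpNorm (fun x => ‖H x‖) 2 μ :=
        abs_integral_mul_le hF.norm hH.norm
    _ = _ := by rw [lpNorm_norm hF.1, lpNorm_norm hH.1]

theorem lpNorm_two_le_of_bound [IsFiniteMeasure μ] {F : α → G} {C : ℝ} (hC : 0 ≤ C)
    (h : ∀ᵐ x ∂μ, ‖F x‖ ≤ C) : lpNorm F 2 μ ≤ C * √(μ.real Set.univ) := by
  by_cases hF : AEStronglyMeasurable F μ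
  · have hm : MemLp F 2 μ := MemLp.of_bound hF C h
    refine le_of_sq_le_sq ?_ (by positivity)
    rw [sq_lpNorm_two hm, mul_pow, Real.sq_sqrt measureReal_nonneg]
    calc ∫ x, ‖F x‖ ^ 2 ∂μ ≤ ∫ _, C ^ 2 ∂μ := by
          refine integral_mono_of_nonneg (ae_of_all _ fun x => by positivity)
            (integrable_const _) ?_
          filter_upwards [h] with x hx
          exact pow_le_pow_left₀ (norm_nonneg _) hx 2
      _ = C ^ 2 * μ.real Set.univ := by simp [mul_comm]
  · rw [lpNorm_of_not_aestronglyMeasurable hF]; positivity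

end LpNorm

/-! ### The Poincaré inequality on a bounded convex open set -/

/-- The fundamental theorem of calculus along the segment from x to y, followed by Jensen's
inequality in t. -/
theorem enorm_sub_sq_le_lintegral_gradient {v : E2 → ℝ} (hv : ContDiff ℝ ∞ v) (x y : E2) :
    ‖v y - v x‖ₑ ^ 2 ≤ ‖y - x‖ₑ ^ 2
      * ∫⁻ t in Set.Icc (0 : ℝ) 1, ‖gradient v ((1 - t) • x + t • y)‖ₑ ^ 2 := by
  have hp : IsProbabilityMeasure (volume.restrict (Set.Icc (0 : ℝ) 1)) := ⟨by simp⟩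
  have hγ : ∀ t : ℝ, HasDerivAt (fun t : ℝ => (1 - t) • x + t • y) (y - x) t := fun t => by
    have h1 : HasDerivAt (fun t : ℝ => x + t • (y - x)) ((1 : ℝ) • (y - x)) t :=
      ((hasDerivAt_id t).smul_const (y - x)).const_add x
    rw [one_smul] at h1
    convert h1 using 1
    ext1 t; module
  have hc : Continuous fun t : ℝ => (1 - t) • x + t • y := by fun_prop
  have hd : ∀ t : ℝ, HasDerivAt (fun t : ℝ => v ((1 - t) • x + t • y))
      (inner ℝ (gradient v ((1 - t) • x + t • y)) (y - x)) t := fun t => by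
    rw [inner_gradient]
    exact ((hv.differentiable (by simp)).differentiableAt.hasFDerivAt).comp_hasDerivAt t (hγ t)
  have hcont : Continuous fun t : ℝ => inner ℝ (gradient v ((1 - t) • x + t • y)) (y - x) :=
    ((contDiff_gradient hv).comp hc).inner continuous_const
  have hftc := intervalIntegral.integral_eq_sub_of_hasDerivAt (a := 0) (b := 1)
    (fun t _ => hd t) (hcont.intervalIntegrable _ _)
  have e : v y - v x
      = ∫ t in Set.Icc (0 : ℝ) 1, inner ℝ (gradient v ((1 - t) • x + t • y)) (y - x) := by
    rw [integral_Icc_eq_integral_Ioc, ← intervalIntegral.integral_of_le zero_le_one, hftc]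
    simp
  rw [e]
  refine (enorm_integral_sq_le hcont.aestronglyMeasurable).trans ?_
  rw [← lintegral_const_mul' _ _ (by simp)]
  refine lintegral_mono fun t => ?_
  rw [← mul_pow, mul_comm]
  gcongr
  rw [← ofReal_norm, ← ofReal_norm, ← ofReal_norm, ← ENNReal.ofReal_mul (norm_nonneg _)]
  exact ENNReal.ofReal_le_ofReal (norm_inner_le_norm _ _)

/-- Poincaré inequality: a smooth function differs from one of its values by at most
`2 d ‖∇v‖` in `L²(U)`, for `U` convex of diameter at most `d`. -/
theorem exists_lpNorm_sub_const_le {U : Set E2} (hU : IsOpen U) (hc : Convex ℝ U)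
    (hb : Bornology.IsBounded U) (hne : U.Nonempty) {v : E2 → ℝ} (hv : ContDiff ℝ ∞ v) :
    ∃ c : ℝ, lpNorm (fun x => v x - c) 2 (volume.restrict U)
      ≤ 2 * Metric.diam U * lpNorm (gradient v) 2 (volume.restrict U) := by
  have hfin : volume U ≠ ⊤ := hb.measure_lt_top.ne
  have hfinm : IsFiniteMeasure (volume.restrict U) := ⟨by simpa using hfin.lt_top⟩
  have hpos : volume U ≠ 0 := (hU.measure_pos volume hne).ne'
  have hgc := contDiff_gradient hv
  set G : E2 → ENNReal := U.indicator (fun x => ‖gradient v x‖ₑ ^ 2) with hG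
  have hGm : Measurable G := (hgc.measurable.enorm.pow_const 2).indicator hU.measurableSet
  set g : ENNReal := ∫⁻ x, G x with hg
  have hgU : g = ∫⁻ x in U, ‖gradient v x‖ₑ ^ 2 := by
    rw [hg, hG, lintegral_indicator hU.measurableSet]
  set d : ENNReal := ENNReal.ofReal (Metric.diam U) with hd
  have hpt : ∀ x ∈ U, ∀ y ∈ U, ‖v x - v y‖ₑ ^ 2
      ≤ d ^ 2 * ∫⁻ t in Set.Icc (0 : ℝ) 1, G ((1 - t) • x + t • y) := by
    intro x hx y hy
    rw [enorm_sub_rev]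
    refine (enorm_sub_sq_le_lintegral_gradient hv x y).trans ?_
    refine mul_le_mul' ?_ ?_
    · gcongr
      rw [← edist_eq_enorm_sub, edist_dist, hd]
      exact ENNReal.ofReal_le_ofReal (Metric.dist_le_diam_of_mem hb hy hx)
    · refine setLIntegral_mono' measurableSet_Icc fun t ht => ?_
      have : (1 - t) • x + t • y ∈ U := hc hx hy (by linarith [ht.2]) ht.1 (by ring)
      simp [hG, this]
  have h4 : ∀ t : ℝ, 1 / 2 ≤ t → ENNReal.ofReal (t ^ 2)⁻¹ ≤ 4 := fun t ht => by
    rw [show (4 : ENNReal) = ENNReal.ofReal 4 by norm_num]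
    refine ENNReal.ofReal_le_ofReal ?_
    rw [inv_le_comm₀ (by positivity) (by norm_num)]
    nlinarith
  -- The variable whose coefficient is at least 1/2 is integrated first: y if t ≥ 1/2, x otherwise.
  -- The change of variables then costs at most 4, whatever the shape of U. This is why the Poincaré
  -- constant is 2 = √4 times the diameter.
  have htt : ∀ t ∈ Set.Icc (0 : ℝ) 1,
      ∫⁻ x in U, ∫⁻ y in U, G ((1 - t) • x + t • y) ≤ 4 * g * volume U := by
    intro t ht
    rcases le_total (1 / 2) t with h | h
    · calc ∫⁻ x in U, ∫⁻ y in U, G ((1 - t) • x + t • y) ≤ ∫⁻ x in U, 4 * g := by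
            refine lintegral_mono fun x => (setLIntegral_le_lintegral _ _).trans ?_
            simp_rw [add_comm ((1 - t) • x)]
            rw [lintegral_comp_smul_add G (by linarith)]
            exact mul_le_mul' (h4 t h) le_rfl
        _ = _ := by simp
    · rw [lintegral_lintegral_swap]
      · calc ∫⁻ y in U, ∫⁻ x in U, G ((1 - t) • x + t • y) ≤ ∫⁻ y in U, 4 * g := by
              refine lintegral_mono fun x => (setLIntegral_le_lintegral _ _).trans ?_
              rw [lintegral_comp_smul_add G (by linarith)]
              exact mul_le_mul' (h4 (1 - t) (by linarith)) le_rfl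
          _ = _ := by simp
      · exact (hGm.comp (by fun_prop)).aemeasurable
  have hdbl : ∫⁻ y in U, ∫⁻ x in U, ‖v x - v y‖ₑ ^ 2 ≤ d ^ 2 * (4 * g * volume U) := by
    rw [lintegral_lintegral_swap (by
      refine Measurable.aemeasurable ?_
      have := hv.continuous
      fun_prop)]
    calc ∫⁻ x in U, ∫⁻ y in U, ‖v x - v y‖ₑ ^ 2
        ≤ ∫⁻ x in U, ∫⁻ y in U, d ^ 2 * ∫⁻ t in Set.Icc (0 : ℝ) 1, G ((1 - t) • x + t • y) := by
          refine setLIntegral_mono' hU.measurableSet fun x hx => ?_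
          exact setLIntegral_mono' hU.measurableSet fun y hy => hpt x hx y hy
      _ = d ^ 2 * ∫⁻ x in U, ∫⁻ y in U, ∫⁻ t in Set.Icc (0 : ℝ) 1, G ((1 - t) • x + t • y) := by
          rw [← lintegral_const_mul' _ _ (by simp [hd])]
          refine lintegral_congr fun x => ?_
          rw [← lintegral_const_mul' _ _ (by simp [hd])]
      _ = d ^ 2 * ∫⁻ t in Set.Icc (0 : ℝ) 1, ∫⁻ x in U, ∫⁻ y in U, G ((1 - t) • x + t • y) := by
          congr 1
          have hsw : ∀ x, ∫⁻ y in U, ∫⁻ t in Set.Icc (0 : ℝ) 1, G ((1 - t) • x + t • y)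
              = ∫⁻ t in Set.Icc (0 : ℝ) 1, ∫⁻ y in U, G ((1 - t) • x + t • y) := fun x =>
            lintegral_lintegral_swap (hGm.comp (by fun_prop)).aemeasurable
          simp_rw [hsw]
          refine lintegral_lintegral_swap (Measurable.aemeasurable ?_)
          exact Measurable.lintegral_prod_right'
            (f := fun q : (E2 × ℝ) × E2 => G ((1 - q.1.2) • q.1.1 + q.1.2 • q.2))
            (hGm.comp (by fun_prop))
      _ ≤ d ^ 2 * ∫⁻ t in Set.Icc (0 : ℝ) 1, 4 * g * volume U := by
          gcongr 1
          exact setLIntegral_mono' measurableSet_Icc htt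
      _ = _ := by simp
  -- Some y does no worse than the average of the double integral over U, and `v y` is the constant
  -- to subtract.
  obtain ⟨y, hy, hyle⟩ := exists_le_setLAverage (μ := volume) (s := U)
    (f := fun y => ∫⁻ x in U, ‖v x - v y‖ₑ ^ 2) hpos hfin (by
      refine Measurable.aemeasurable ?_
      have := hv.continuous
      exact Measurable.lintegral_prod_right' (f := fun q : E2 × E2 => ‖v q.2 - v q.1‖ₑ ^ 2)
        (by fun_prop))
  refine ⟨v y, ?_⟩
  have hm1 : MemLp (fun x => v x - v y) 2 (volume.restrict U) :=
    memLp_of_continuous (hv.continuous.sub continuous_const) hb hU.measurableSet hfin 2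
  have hm2 : MemLp (gradient v) 2 (volume.restrict U) :=
    memLp_of_continuous hgc hb hU.measurableSet hfin 2
  have hkey : eLpNorm (fun x => v x - v y) 2 (volume.restrict U)
      ≤ 2 * d * eLpNorm (gradient v) 2 (volume.restrict U) := by
    rw [← ENNReal.pow_le_pow_left_iff two_ne_zero, mul_pow, sq_eLpNorm_two, sq_eLpNorm_two, ← hgU]
    refine hyle.trans ?_
    rw [setLAverage_eq]
    refine ENNReal.div_le_of_le_mul (hdbl.trans (le_of_eq ?_))
    ring
  rw [← toReal_eLpNorm hm1.1, ← toReal_eLpNorm hm2.1]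
  refine (ENNReal.toReal_mono (ENNReal.mul_ne_top (by simp [hd, ENNReal.mul_eq_top]) hm2.2.ne)
    hkey).trans (le_of_eq ?_)
  rw [ENNReal.toReal_mul, ENNReal.toReal_mul, hd, ENNReal.toReal_ofReal Metric.diam_nonneg]
  simp

/-! ### Affine functions -/

/-- The constant gradient of an affine function. -/
def agrad (a : E2 →ᵃ[ℝ] ℝ) : E2 :=
  (InnerProductSpace.toDual ℝ E2).symm (LinearMap.toContinuousLinearMap a.linear)

theorem inner_agrad (a : E2 →ᵃ[ℝ] ℝ) (ξ : E2) : inner ℝ (agrad a) ξ = a.linear ξ := by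
  simp [agrad]

theorem affine_sub_eq_inner (a : E2 →ᵃ[ℝ] ℝ) (x y : E2) : a x - a y = inner ℝ (agrad a) (x - y) := by
  rw [inner_agrad, ← vsub_eq_sub x y, AffineMap.linearMap_vsub, vsub_eq_sub]

theorem contDiff_affine (a : E2 →ᵃ[ℝ] ℝ) : ContDiff ℝ ∞ a := by
  have : (a : E2 → ℝ) = fun x => (LinearMap.toContinuousLinearMap a.linear) x + a 0 := by
    ext x
    have := a.map_vadd 0 x
    simpa using this
  rw [this]
  exact (ContinuousLinearMap.contDiff _).add contDiff_const

theorem continuous_affine (a : E2 →ᵃ[ℝ] ℝ) : Continuous a := (contDiff_affine a).continuous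

theorem differentiableAt_affine (a : E2 →ᵃ[ℝ] ℝ) (x : E2) : DifferentiableAt ℝ a x :=
  ((contDiff_affine a).differentiable (by simp)).differentiableAt

theorem gradient_affine (a : E2 →ᵃ[ℝ] ℝ) (x : E2) : gradient a x = agrad a := by
  have h : HasFDerivAt a (LinearMap.toContinuousLinearMap a.linear) x := by
    have : (a : E2 → ℝ) = fun x => (LinearMap.toContinuousLinearMap a.linear) x + a 0 := by
      ext x
      have := a.map_vadd 0 x
      simpa using this
    rw [this]
    exact (ContinuousLinearMap.hasFDerivAt _).add_const _
  rw [gradient, h.fderiv, agrad]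

/-! ### Nondegenerate triangles and barycentric coordinates -/

/-- Three affinely independent points. -/
def IsTriangle (T : Finset E2) : Prop := T.card = 3 ∧ AffineIndependent ℝ ((↑) : T → E2)

theorem TriMesh.isTriangle (M : TriMesh) {T : Finset E2} (hT : T ∈ M.tri) : IsTriangle T :=
  ⟨M.card_eq T hT, M.indep T hT⟩

theorem IsTriangle.affineSpan_eq_top {T : Finset E2} (hT : IsTriangle T) :
    affineSpan ℝ (Set.range ((↑) : T → E2)) = ⊤ := by
  rw [hT.2.affineSpan_eq_top_iff_card_eq_finrank_add_one]
  simp [hT.1]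

/-- The vertices of a triangle as an affine basis of the plane. -/
def IsTriangle.basis {T : Finset E2} (hT : IsTriangle T) : AffineBasis T ℝ E2 :=
  ⟨(↑), hT.2, hT.affineSpan_eq_top⟩

open Classical in
/-- The barycentric coordinate of the vertex `i` of the triangle `T`. -/
def bary (T : Finset E2) (i : E2) : E2 →ᵃ[ℝ] ℝ :=
  if h : IsTriangle T ∧ i ∈ T then h.1.basis.coord ⟨i, h.2⟩ else 0

namespace IsTriangle

variable {T : Finset E2} (hT : IsTriangle T)
include hT

theorem bary_eq {i : E2} (hi : i ∈ T) : bary T i = hT.basis.coord ⟨i, hi⟩ :=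
  dif_pos ⟨hT, hi⟩

theorem bary_self {i : E2} (hi : i ∈ T) : bary T i i = 1 := by
  rw [hT.bary_eq hi]; exact hT.basis.coord_apply_eq ⟨i, hi⟩

theorem bary_ne {i j : E2} (hi : i ∈ T) (hj : j ∈ T) (hij : i ≠ j) : bary T i j = 0 := by
  rw [hT.bary_eq hi]
  exact hT.basis.coord_apply_ne (i := ⟨i, hi⟩) (j := ⟨j, hj⟩) (fun h => hij (congrArg Subtype.val h))

theorem sum_bary (x : E2) : ∑ i ∈ T, bary T i x = 1 := by
  rw [← Finset.sum_coe_sort, ← hT.basis.sum_coord_apply_eq_one x]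
  exact Finset.sum_congr rfl fun i _ => by rw [hT.bary_eq i.2]

theorem hull_eq_range : hull T = convexHull ℝ (Set.range hT.basis) := by
  rw [hull]; congr 1
  exact (Subtype.range_coe (s := (T : Set E2))).symm

theorem mem_hull_iff {x : E2} : x ∈ hull T ↔ ∀ i ∈ T, 0 ≤ bary T i x := by
  rw [hT.hull_eq_range, hT.basis.convexHull_eq_nonneg_coord, Set.mem_ofPred_eq, Subtype.forall]
  exact forall₂_congr fun i hi => by rw [hT.bary_eq hi]

theorem mem_elt_iff {x : E2} : x ∈ elt T ↔ ∀ i ∈ T, 0 < bary T i x := by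
  rw [elt, hT.hull_eq_range, hT.basis.interior_convexHull, Set.mem_ofPred_eq, Subtype.forall]
  exact forall₂_congr fun i hi => by rw [hT.bary_eq hi]

theorem bary_le_one {x : E2} (hx : x ∈ hull T) {i : E2} (hi : i ∈ T) : bary T i x ≤ 1 := by
  rw [← hT.sum_bary x]
  exact Finset.single_le_sum (fun j hj => hT.mem_hull_iff.1 hx j hj) hi

theorem affine_apply_eq_sum (a : E2 →ᵃ[ℝ] ℝ) (x : E2) : a x = ∑ i ∈ T, bary T i x * a i := by
  have h := hT.basis.affineCombination_coord_eq_self x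
  conv_lhs => rw [← h, Finset.map_affineCombination _ _ _ (hT.basis.sum_coord_apply_eq_one x)]
  rw [Finset.affineCombination_eq_linear_combination _ _ _ (hT.basis.sum_coord_apply_eq_one x),
    ← Finset.sum_coe_sort T]
  exact Finset.sum_congr rfl fun i _ => by rw [hT.bary_eq i.2]; rfl

theorem affine_ext {a b : E2 →ᵃ[ℝ] ℝ} (h : ∀ i ∈ T, a i = b i) : a = b := by
  ext x
  rw [hT.affine_apply_eq_sum, hT.affine_apply_eq_sum b]
  exact Finset.sum_congr rfl fun i hi => by rw [h i hi]

end IsTriangle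

/-! ### Hulls, open triangles and inscribed discs -/

theorem subset_hull (T : Finset E2) : (T : Set E2) ⊆ hull T := subset_convexHull ℝ _

theorem convex_hull (T : Finset E2) : Convex ℝ (hull T) := convex_convexHull ℝ _

theorem hull_mono {S T : Finset E2} (h : S ⊆ T) : hull S ⊆ hull T :=
  convexHull_mono (by exact_mod_cast h)

theorem isCompact_hull (T : Finset E2) : IsCompact (hull T) :=
  (Set.Finite.isCompact_convexHull (𝕜 := ℝ) T.finite_toSet)

theorem isOpen_elt (T : Finset E2) : IsOpen (elt T) := isOpen_interior

theorem convex_elt (T : Finset E2) : Convex ℝ (elt T) := (convex_hull T).interior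

theorem elt_subset_hull (T : Finset E2) : elt T ⊆ hull T := interior_subset

theorem isBounded_elt (T : Finset E2) : Bornology.IsBounded (elt T) :=
  (isCompact_hull T).isBounded.subset (elt_subset_hull T)

theorem volume_elt_ne_top (T : Finset E2) : volume (elt T) ≠ ⊤ :=
  (isBounded_elt T).measure_lt_top.ne

instance isFiniteMeasure_restrict_elt (T : Finset E2) :
    IsFiniteMeasure (volume.restrict (elt T)) :=
  ⟨by simpa using (volume_elt_ne_top T).lt_top⟩

/-- The mesh width of a triangle. -/
def width (T : Finset E2) : ℝ := Metric.diam (hull T)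

theorem width_nonneg (T : Finset E2) : 0 ≤ width T := Metric.diam_nonneg

theorem dist_le_width {T : Finset E2} {x y : E2} (hx : x ∈ hull T) (hy : y ∈ hull T) :
    dist x y ≤ width T :=
  Metric.dist_le_diam_of_mem (isCompact_hull T).isBounded hx hy

theorem diam_elt_le (T : Finset E2) : Metric.diam (elt T) ≤ width T :=
  Metric.diam_mono (elt_subset_hull T) (isCompact_hull T).isBounded

/-- Area of the unit disc. -/
def discArea : ℝ := volume.real (Metric.ball (0 : E2) 1)

theorem discArea_pos : 0 < discArea :=
  ENNReal.toReal_pos (Metric.isOpen_ball.measure_pos _ ⟨0, by simp⟩).ne' measure_ball_lt_top.ne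

theorem volume_real_closedBall (c : E2) {r : ℝ} (hr : 0 ≤ r) :
    volume.real (Metric.closedBall c r) = r ^ 2 * discArea := by
  rw [measureReal_def, Measure.addHaar_closedBall _ _ hr, ENNReal.toReal_mul,
    ENNReal.toReal_ofReal (by positivity), discArea, measureReal_def]
  simp

/-- The triangle `T` contains a disc of radius `r`, and its diameter is at most `κ r`. -/
structure ShapeRegular (κ : ℝ) (T : Finset E2) (c : E2) (r : ℝ) : Prop where
  tri : IsTriangle T
  pos : 0 < r
  ball : Metric.closedBall c r ⊆ hull T
  diam : width T ≤ κ * r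

theorem exists_ne_of_card_three {T : Finset E2} (h : T.card = 3) (i : E2) :
    ∃ j ∈ T, j ≠ i := by
  by_contra! hcon
  have : T ⊆ {i} := fun j hj => by simpa using hcon j hj
  have := Finset.card_le_card this
  simp [h] at this

theorem IsTriangle.width_pos {T : Finset E2} (h : IsTriangle T) : 0 < width T := by
  obtain ⟨i, hi⟩ : T.Nonempty := Finset.card_pos.1 (by rw [h.1]; norm_num)
  obtain ⟨j, hj, hji⟩ := exists_ne_of_card_three h.1 i
  exact (dist_pos.2 hji).trans_le (dist_le_width (subset_hull T hj) (subset_hull T hi))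

/-- A disc of diameter d more than half the supremum `inDiam` spares the question of whether the
supremum is attained. This factor 2 and the passage from the diameter to the radius d/2 make the 4.
-/
theorem exists_shapeRegular {T : Finset E2} (h : IsTriangle T) {γ₀ : ℝ} (hγ : 0 < γ₀)
    (hs : Metric.diam (hull T) ≤ γ₀ * inDiam T) : ∃ c r, ShapeRegular (4 * γ₀) T c r := by
  have hpos : 0 < width T := h.width_pos
  have hin : 0 < inDiam T := by
    by_contra! hcon
    have : γ₀ * inDiam T ≤ 0 := mul_nonpos_of_nonneg_of_nonpos hγ.le hcon
    exact absurd (hs.trans this) (not_le.2 hpos)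
  have hne : {d : ℝ | 0 ≤ d ∧ ∃ c : E2, Metric.closedBall c (d / 2) ⊆ hull T}.Nonempty := by
    by_contra hcon
    rw [Set.not_nonempty_iff_eq_empty] at hcon
    rw [inDiam, hcon, Real.sSup_empty] at hin
    exact lt_irrefl _ hin
  obtain ⟨d, ⟨hd0, c, hc⟩, hd⟩ := exists_lt_of_lt_csSup hne (half_lt_self hin)
  refine ⟨c, d / 2, h, ?_, hc, ?_⟩
  · have : 0 < d := (half_pos hin).trans hd
    positivity
  · refine hs.trans ?_
    have : inDiam T < 2 * d := by
      have : inDiam T / 2 < d := hd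
      linarith
    nlinarith

/-- A displacement s in the direction of the gradient changes an affine function by s times the norm
of the gradient. With 0⁻¹ = 0 this also holds for a zero gradient, so no case distinction is needed
by its users. -/
theorem bary_add_smul_agrad (T : Finset E2) (c i : E2) (s : ℝ) :
    bary T i (c + s • ((‖agrad (bary T i)‖)⁻¹ • agrad (bary T i)))
      = bary T i c + s * ‖agrad (bary T i)‖ := by
  have := affine_sub_eq_inner (bary T i) (c + s • ((‖agrad (bary T i)‖)⁻¹ • agrad (bary T i))) c
  rw [add_sub_cancel_left, inner_smul_right, inner_smul_right, real_inner_self_eq_norm_sq] at this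
  have h2 : ‖agrad (bary T i)‖⁻¹ * ‖agrad (bary T i)‖ ^ 2 = ‖agrad (bary T i)‖ := by
    rcases eq_or_ne ‖agrad (bary T i)‖ 0 with h0 | h0
    · simp [h0]
    · field_simp
  rw [h2] at this
  linarith

theorem norm_inv_smul_le_one (g : E2) : ‖(‖g‖)⁻¹ • g‖ ≤ 1 := by
  rw [norm_smul, norm_inv, norm_norm]
  exact inv_mul_le_one

/-! ### Geometry of a triangle that contains a disc of comparable size -/

namespace ShapeRegular

variable {κ : ℝ} {T : Finset E2} {c : E2} {r : ℝ} (h : ShapeRegular κ T c r)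
include h

theorem mem_hull_add {u : E2} (hu : ‖u‖ ≤ 1) {s : ℝ} (hs : |s| ≤ r) : c + s • u ∈ hull T := by
  refine h.ball ?_
  rw [Metric.mem_closedBall, dist_eq_norm, add_sub_cancel_left, norm_smul, Real.norm_eq_abs]
  nlinarith [norm_nonneg u, abs_nonneg s]

/-- The coordinate is still nonnegative after moving from the centre a distance r against its
gradient. -/
theorem mul_norm_agrad_le_bary {i : E2} (hi : i ∈ T) : r * ‖agrad (bary T i)‖ ≤ bary T i c := by
  have h1 := h.tri.mem_hull_iff.1
    (h.mem_hull_add (norm_inv_smul_le_one (agrad (bary T i))) (s := -r) (by rw [abs_neg, abs_of_pos h.pos]))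
    i hi
  rw [bary_add_smul_agrad] at h1
  linarith

/-- Along a diameter of the disc parallel to the gradient the coordinate grows by 2 r ‖∇λ‖ while
staying in [0, 1]. -/
theorem norm_agrad_le {i : E2} (hi : i ∈ T) : ‖agrad (bary T i)‖ * (2 * r) ≤ 1 := by
  have h1 := h.tri.bary_le_one
    (h.mem_hull_add (norm_inv_smul_le_one (agrad (bary T i))) (s := r) (by rw [abs_of_pos h.pos])) hi
  rw [bary_add_smul_agrad] at h1
  have := h.mul_norm_agrad_le_bary hi
  linarith

theorem one_le_norm_agrad_mul_dist {i j : E2} (hi : i ∈ T) (hj : j ∈ T) (hij : i ≠ j) :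
    1 ≤ ‖agrad (bary T i)‖ * dist i j := by
  have := affine_sub_eq_inner (bary T i) i j
  rw [h.tri.bary_self hi, h.tri.bary_ne hi hj hij, sub_zero] at this
  rw [this, dist_eq_norm]
  exact real_inner_le_norm _ _

/-- Along a side the coordinate drops from 1 to 0, while its gradient is at most 1/(2r). -/
theorem two_mul_le_dist {i j : E2} (hi : i ∈ T) (hj : j ∈ T) (hij : i ≠ j) : 2 * r ≤ dist i j := by
  have h1 := h.one_le_norm_agrad_mul_dist hi hj hij
  have h2 := h.norm_agrad_le hi
  have h3 : 0 < ‖agrad (bary T i)‖ := by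
    by_contra! hcon
    nlinarith [norm_nonneg (agrad (bary T i)), dist_nonneg (x := i) (y := j)]
  nlinarith

theorem one_le_norm_agrad_mul_width {i : E2} (hi : i ∈ T) : 1 ≤ ‖agrad (bary T i)‖ * width T := by
  obtain ⟨j, hj, hji⟩ := exists_ne_of_card_three h.tri.1 i
  refine (h.one_le_norm_agrad_mul_dist hi hj hji.symm).trans ?_
  gcongr
  exact dist_le_width (subset_hull T hi) (subset_hull T hj)

theorem kappa_pos : 0 < κ := by
  have := h.tri.width_pos.trans_le h.diam
  exact pos_of_mul_pos_left this h.pos.le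

theorem ball_subset_elt : Metric.ball c r ⊆ elt T :=
  interior_maximal (Metric.ball_subset_closedBall.trans h.ball) Metric.isOpen_ball

theorem elt_nonempty : (elt T).Nonempty := ⟨c, h.ball_subset_elt (Metric.mem_ball_self h.pos)⟩

theorem volume_elt_ge : discArea * r ^ 2 ≤ volume.real (elt T) := by
  rw [mul_comm, ← volume_real_closedBall c h.pos.le, measureReal_def,
    Measure.addHaar_closedBall_eq_addHaar_ball, ← measureReal_def]
  exact measureReal_mono h.ball_subset_elt (volume_elt_ne_top T)

theorem volume_elt_le : volume.real (elt T) ≤ discArea * width T ^ 2 := by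
  rw [mul_comm, ← volume_real_closedBall c (width_nonneg T)]
  refine measureReal_mono ?_ (Metric.isBounded_closedBall.measure_lt_top.ne)
  intro x hx
  exact dist_le_width (elt_subset_hull T hx) (h.ball (Metric.mem_closedBall_self h.pos.le))

end ShapeRegular

/-! ### Arc length on an edge -/

open Classical in
theorem hull_pair (a b : E2) : hull {a, b} = segment ℝ a b := by
  rw [hull]; simp [convexHull_pair]

-- The arc length parametrization is an isometry of the line into the plane, so it carries the
-- one-dimensional Hausdorff measure of the line, which is Lebesgue measure, to that of its range.
-- Rescaling to [0, 1] produces the length as a factor.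
open Classical in
theorem hausdorffMeasure_restrict_edge {a b : E2} (hab : a ≠ b) :
    (Measure.hausdorffMeasure 1).restrict (hull {a, b})
      = ENNReal.ofReal (dist a b) • Measure.map (fun t : ℝ => a + t • (b - a))
          (volume.restrict (Set.Icc 0 1)) := by
  have hL : 0 < dist a b := dist_pos.2 hab
  set L := dist a b with hLd
  set u : E2 := L⁻¹ • (b - a) with hu
  have hun : ‖u‖ = 1 := by
    rw [hu, norm_smul, norm_inv, Real.norm_of_nonneg hL.le, ← dist_eq_norm, dist_comm, ← hLd]
    exact inv_mul_cancel₀ hL.ne'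
  set γ : ℝ → E2 := fun s => a + s • u with hγ
  have hiso : Isometry γ := Isometry.of_dist_eq fun s t => by
    simp only [hγ]
    rw [dist_add_left, dist_eq_norm, ← sub_smul, norm_smul, hun, mul_one, Real.dist_eq,
      Real.norm_eq_abs]
  have hemb : MeasurableEmbedding γ := hiso.isClosedEmbedding.measurableEmbedding
  have hcl : IsClosed (hull {a, b}) := (isCompact_hull _).isClosed
  have hseg : hull {a, b} ⊆ Set.range γ := by
    rw [hull_pair, segment_eq_image']
    rintro _ ⟨t, _, rfl⟩
    refine ⟨t * L, ?_⟩
    simp [hγ, hu, smul_smul, hL.ne']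
  have hpre : γ ⁻¹' hull {a, b} = Set.Icc 0 L := by
    ext s
    rw [Set.mem_preimage, hull_pair, segment_eq_image']
    constructor
    · rintro ⟨t, ht, hts⟩
      have hts' : γ (t * L) = γ s := by rw [← hts]; simp [hγ, hu, smul_smul, hL.ne']
      rw [← hiso.injective hts']
      exact ⟨by nlinarith [ht.1], by nlinarith [ht.2]⟩
    · intro hs
      refine ⟨s / L, ⟨div_nonneg hs.1 hL.le, (div_le_one hL).2 hs.2⟩, ?_⟩
      simp [hγ, hu, smul_smul, div_eq_mul_inv]
  have h1 : (Measure.hausdorffMeasure 1).restrict (hull {a, b})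
      = Measure.map γ (volume.restrict (Set.Icc 0 L)) := by
    rw [← hpre, ← hemb.restrict_map, ← hausdorffMeasure_real,
      hiso.map_hausdorffMeasure (Or.inl zero_le_one), Measure.restrict_restrict hcl.measurableSet,
      Set.inter_eq_self_of_subset_left hseg]
  have hemb2 : MeasurableEmbedding fun t : ℝ => L * t :=
    (Homeomorph.mulLeft₀ L hL.ne').measurableEmbedding
  have hpre2 : (fun t : ℝ => L * t) ⁻¹' Set.Icc 0 L = Set.Icc 0 1 := by
    ext t
    simp only [Set.mem_preimage, Set.mem_Icc]
    constructor
    · rintro ⟨h0, h1⟩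
      exact ⟨nonneg_of_mul_nonneg_right h0 hL, by nlinarith⟩
    · rintro ⟨h0, h1⟩
      exact ⟨by positivity, by nlinarith⟩
  have h2 : (volume : Measure ℝ).restrict (Set.Icc 0 L)
      = ENNReal.ofReal L • Measure.map (fun t : ℝ => L * t) (volume.restrict (Set.Icc 0 1)) := by
    have hv : (volume : Measure ℝ) = ENNReal.ofReal L • Measure.map (fun t : ℝ => L * t) volume := by
      have := Real.smul_map_volume_mul_left hL.ne'
      rw [abs_of_pos hL] at this
      exact this.symm
    conv_lhs => rw [hv]
    rw [Measure.restrict_smul, hemb2.restrict_map, hpre2]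
  rw [h1, h2, Measure.map_smul, Measure.map_map hemb.measurable hemb2.measurable]
  congr 2
  ext1 t
  simp [hγ, hu, smul_smul, hL.ne', mul_comm L t]

open Classical in
theorem edgeInt_pair {a b : E2} (hab : a ≠ b) {F : E2 → ℝ} :
    edgeInt {a, b} F = dist a b * ∫ t in Set.Icc (0 : ℝ) 1, F (a + t • (b - a)) := by
  have hemb : MeasurableEmbedding fun t : ℝ => a + t • (b - a) := by
    have : Topology.IsClosedEmbedding fun t : ℝ => a + t • (b - a) :=
      (Homeomorph.addLeft a).isClosedEmbedding.comp
        (isClosedEmbedding_smul_left (sub_ne_zero.2 hab.symm))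
    exact this.measurableEmbedding
  rw [edgeInt, hausdorffMeasure_restrict_edge hab, integral_smul_measure, hemb.integral_map,
    ENNReal.toReal_ofReal dist_nonneg, smul_eq_mul]

theorem exists_eq_pair {T e : Finset E2} (he : e ∈ edgesOf T) :
    ∃ a b, a ≠ b ∧ a ∈ T ∧ b ∈ T ∧ (∀ x, x ∈ e ↔ x = a ∨ x = b) := by
  rw [edgesOf, Finset.mem_powersetCard] at he
  obtain ⟨a, b, hab, rfl⟩ := Finset.card_eq_two.1 he.2
  exact ⟨a, b, hab, he.1 (by simp), he.1 (by simp), by simp⟩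

theorem edge_measure_ne_top {T e : Finset E2} (he : e ∈ edgesOf T) :
    (Measure.hausdorffMeasure 1) (hull e) ≠ (⊤ : ENNReal) := by
  classical
  obtain ⟨a, b, hab, -, -, hx⟩ := exists_eq_pair he
  have : e = {a, b} := by ext x; simp [hx]
  have h := congrArg (fun m : Measure E2 => m Set.univ) (hausdorffMeasure_restrict_edge hab)
  simp only [Measure.restrict_apply_univ] at h
  rw [this, h, Measure.smul_apply, smul_eq_mul]
  refine ENNReal.mul_ne_top ENNReal.ofReal_ne_top ?_
  have : IsFiniteMeasure (Measure.map (fun t : ℝ => a + t • (b - a))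
    (volume.restrict (Set.Icc 0 1))) := inferInstance
  exact measure_ne_top _ _

theorem memLp_edge {T e : Finset E2} (he : e ∈ edgesOf T) {F : E2 → ℝ} (hF : Continuous F) :
    MemLp F 2 ((Measure.hausdorffMeasure 1).restrict (hull e)) :=
  memLp_of_continuous hF (isCompact_hull e).isBounded (isCompact_hull e).isClosed.measurableSet
    (edge_measure_ne_top he) 2

/-! ### Green's formula with a radial field, and the trace inequality -/

/-- The substitution y = σ t on the slice over σ. It turns the reference triangle into a square,
with Jacobian σ. -/
theorem integral_triangle_param {s : Set (ℝ × ℝ)} (hs : s = {q | 0 < q.2 ∧ q.2 < q.1 ∧ q.1 < 1})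
    {H : ℝ × ℝ → ℝ} (hH : Continuous H) :
    ∫ q in s, H q = ∫ σ in (0 : ℝ)..1, ∫ t in (0 : ℝ)..1, σ * H (σ, σ * t) := by
  have hopen : IsOpen s := by
    rw [hs]
    exact (isOpen_lt continuous_const continuous_snd).inter
      ((isOpen_lt continuous_snd continuous_fst).inter (isOpen_lt continuous_fst continuous_const))
  have hsub : s ⊆ Set.Icc (0 : ℝ × ℝ) 1 := by
    rw [hs]
    rintro ⟨x, y⟩ ⟨h1, h2, h3⟩
    simp only at h1 h2 h3
    exact ⟨⟨by simp only [Prod.fst_zero]; linarith, h1.le⟩, ⟨h3.le, by simp only [Prod.snd_one]; linarith⟩⟩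
  have hintegrable : IntegrableOn H s :=
    (hH.continuousOn.integrableOn_compact isCompact_Icc).mono_set hsub
  rw [← integral_indicator hopen.measurableSet, Measure.volume_eq_prod, integral_prod _
    (by rw [← Measure.volume_eq_prod]; exact hintegrable.integrable_indicator hopen.measurableSet),
    intervalIntegral.integral_of_le zero_le_one, ← integral_Ioc_eq_integral_Ioo.symm,
    ← integral_indicator measurableSet_Ioo]
  refine integral_congr_ae (ae_of_all _ fun σ => ?_)
  by_cases hσ : σ ∈ Set.Ioo (0 : ℝ) 1
  · simp only [hσ, Set.indicator_of_mem]
    rw [intervalIntegral.integral_const_mul,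
      intervalIntegral.mul_integral_comp_mul_left (f := fun y => H (σ, y)), mul_zero, mul_one,
      intervalIntegral.integral_of_le hσ.1.le, integral_Ioc_eq_integral_Ioo,
      ← integral_indicator measurableSet_Ioo]
    refine integral_congr_ae (ae_of_all _ fun y => ?_)
    simp only [Set.indicator_apply, hs, Set.mem_ofPred_eq, Set.mem_Ioo]
    congr 1
    simp [hσ.2]
  · simp only [hσ, not_false_eq_true, Set.indicator_of_notMem]
    refine integral_eq_zero_of_ae (ae_of_all _ fun y => ?_)
    simp only [Set.indicator_apply, hs, Set.mem_ofPred_eq, Pi.zero_apply, ite_eq_right_iff]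
    rintro ⟨h1, h2, h3⟩
    exact absurd ⟨h1.trans h2, h3⟩ hσ

theorem IsTriangle.mem_iff {T : Finset E2} (hT : IsTriangle T) {p a b : E2} (hp : p ∈ T)
    (ha : a ∈ T) (hb : b ∈ T) (hpa : p ≠ a) (hpb : p ≠ b) (hab : a ≠ b) (x : E2) :
    x ∈ T ↔ x = p ∨ x = a ∨ x = b := by
  classical
  have h3 : ({p, a, b} : Finset E2).card = 3 := Finset.card_eq_three.2 ⟨p, a, b, hpa, hpb, hab, rfl⟩
  have hsub : ({p, a, b} : Finset E2) ⊆ T := by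
    intro y hy; simp only [Finset.mem_insert, Finset.mem_singleton] at hy
    rcases hy with rfl | rfl | rfl <;> assumption
  have := Finset.eq_of_subset_of_card_le hsub (by rw [h3, hT.1])
  rw [← this]; simp

theorem IsTriangle.sum_eq {T : Finset E2} (hT : IsTriangle T) {p a b : E2} (hp : p ∈ T)
    (ha : a ∈ T) (hb : b ∈ T) (hpa : p ≠ a) (hpb : p ≠ b) (hab : a ≠ b) {G : Type*}
    [AddCommMonoid G] (f : E2 → G) : ∑ i ∈ T, f i = f p + f a + f b := by
  classical
  have : T = {p, a, b} := by
    ext x; rw [hT.mem_iff hp ha hb hpa hpb hab]; simp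
  rw [this, Finset.sum_insert (by simp [hpa, hpb]), Finset.sum_insert (by simp [hab]),
    Finset.sum_singleton, add_assoc]

/-- Integrals over a triangle in coordinates. -/
theorem IsTriangle.exists_integral_eq {T : Finset E2} (hT : IsTriangle T) {p a b : E2} (hp : p ∈ T)
    (ha : a ∈ T) (hb : b ∈ T) (hpa : p ≠ a) (hpb : p ≠ b) (hab : a ≠ b) :
    ∃ J : ℝ, ∀ G : E2 → ℝ, Continuous G → ∫ x in elt T, G x
      = J * ∫ σ in (0 : ℝ)..1, ∫ t in (0 : ℝ)..1, σ * G (p + σ • ((a + t • (b - a)) - p)) := by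
  set Φ : ℝ × ℝ →ₗ[ℝ] E2 :=
    (LinearMap.toSpanSingleton ℝ E2 (a - p)).coprod (LinearMap.toSpanSingleton ℝ E2 (b - a)) with hΦ
  have hΦa : ∀ q : ℝ × ℝ, Φ q = q.1 • (a - p) + q.2 • (b - a) := fun q => by
    simp [hΦ, LinearMap.coprod_apply]
  have hval : ∀ (f : E2 →ᵃ[ℝ] ℝ) (q : ℝ × ℝ),
      f (p + Φ q) = f p + q.1 * (f a - f p) + q.2 * (f b - f a) := fun f q => by
    have := affine_sub_eq_inner f (p + Φ q) p
    rw [add_sub_cancel_left] at this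
    conv_rhs at this => rw [hΦa]
    rw [inner_add_right, inner_smul_right, inner_smul_right,
      ← affine_sub_eq_inner, ← affine_sub_eq_inner] at this
    linarith
  have hbp : ∀ q, bary T p (p + Φ q) = 1 - q.1 := fun q => by
    rw [hval, hT.bary_self hp, hT.bary_ne hp ha hpa, hT.bary_ne hp hb hpb]; ring
  have hba : ∀ q, bary T a (p + Φ q) = q.1 - q.2 := fun q => by
    rw [hval, hT.bary_self ha, hT.bary_ne ha hp hpa.symm, hT.bary_ne ha hb hab]; ring
  have hbb : ∀ q, bary T b (p + Φ q) = q.2 := fun q => by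
    rw [hval, hT.bary_self hb, hT.bary_ne hb hp hpb.symm, hT.bary_ne hb ha hab.symm]; ring
  have hinj : Function.Injective Φ := by
    intro q q' hqq
    have h1 : q.1 = q'.1 := by
      have := hbp q; rw [hqq, hbp] at this; linarith
    have h2 : q.2 = q'.2 := by
      have := hbb q; rw [hqq, hbb] at this; linarith
    exact Prod.ext h1 h2
  set Ψ : (ℝ × ℝ) ≃L[ℝ] E2 :=
    (LinearMap.linearEquivOfInjective Φ hinj (by simp)).toContinuousLinearEquiv with hΨ
  have hΨΦ : ∀ q, Ψ q = Φ q := fun q => rfl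
  -- Uniqueness of Haar measure up to a factor replaces the computation of the determinant. The
  -- factor is identified in `IsTriangle.integral_radial` by integrating 1.
  obtain ⟨c, hc⟩ : ∃ c : NNReal, (volume : Measure E2) = c • Measure.map Ψ volume :=
    ⟨_, Measure.isAddLeftInvariant_eq_smul _ _⟩
  set s : Set (ℝ × ℝ) := {q | 0 < q.2 ∧ q.2 < q.1 ∧ q.1 < 1} with hs
  refine ⟨c, fun G hG => ?_⟩
  have hpre : ∀ q, p + Φ q ∈ elt T ↔ q ∈ s := fun q => by
    rw [hT.mem_elt_iff]
    simp only [hT.mem_iff hp ha hb hpa hpb hab, forall_eq_or_imp, forall_eq, hbp, hba, hbb]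
    simp only [hs, Set.mem_ofPred_eq]
    constructor
    · rintro ⟨h1, h2, h3⟩; exact ⟨h3, by linarith, by linarith⟩
    · rintro ⟨h1, h2, h3⟩; exact ⟨by linarith, by linarith, h1⟩
  have hcont : Continuous fun q : ℝ × ℝ => G (p + Φ q) :=
    hG.comp (continuous_const.add Ψ.continuous)
  have hmeas : MeasurableSet s := by
    refine IsOpen.measurableSet ?_
    exact (isOpen_lt continuous_const continuous_snd).inter
      ((isOpen_lt continuous_snd continuous_fst).inter (isOpen_lt continuous_fst continuous_const))
  rw [← integral_indicator (isOpen_elt T).measurableSet,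
    ← integral_add_left_eq_self ((elt T).indicator fun x => G x) p, hc, integral_smul_nnreal_measure,
    (show MeasurableEmbedding Ψ from Ψ.toHomeomorph.measurableEmbedding).integral_map, NNReal.smul_def, smul_eq_mul]
  congr 1
  have e1 : ∀ q, (elt T).indicator (fun x => G x) (p + Ψ q) = s.indicator (fun q => G (p + Φ q)) q :=
    fun q => by
      rw [hΨΦ]
      by_cases hq : q ∈ s
      · rw [Set.indicator_of_mem hq, Set.indicator_of_mem ((hpre q).2 hq)]
      · rw [Set.indicator_of_notMem hq, Set.indicator_of_notMem (fun h => hq ((hpre q).1 h))]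
  refine (integral_congr_ae (ae_of_all _ e1)).trans ?_
  rw [integral_indicator hmeas, integral_triangle_param hs hcont]
  refine intervalIntegral.integral_congr fun σ _ => intervalIntegral.integral_congr fun t _ => ?_
  congr 3
  rw [hΦa]; module

/-- Green's formula for the field `F (x - p)`, where `p` is the vertex opposite to the edge with
end points `a`, `b`. -/
theorem IsTriangle.integral_radial {T : Finset E2} (hT : IsTriangle T) {p a b : E2} (hp : p ∈ T)
    (ha : a ∈ T) (hb : b ∈ T) (hpa : p ≠ a) (hpb : p ≠ b) (hab : a ≠ b) {F : E2 → ℝ}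
    (hF : ContDiff ℝ ∞ F) :
    ∫ x in elt T, (2 * F x + inner ℝ (gradient F x) (x - p))
      = 2 * volume.real (elt T) * ∫ t in (0 : ℝ)..1, F (a + t • (b - a)) := by
  obtain ⟨J, hJ⟩ := hT.exists_integral_eq hp ha hb hpa hpb hab
  have hvol : J = 2 * volume.real (elt T) := by
    have := hJ (fun _ => 1) continuous_const
    simp at this
    linarith
  have hgc := contDiff_gradient hF
  have hFc := hF.continuous
  rw [hJ _ (by fun_prop), ← hvol]
  congr 1
  have hFc := hF.continuous
  have hcont : Continuous (Function.uncurry fun σ t : ℝ =>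
      σ * (2 * F (p + σ • ((a + t • (b - a)) - p))
        + inner ℝ (gradient F (p + σ • ((a + t • (b - a)) - p)))
          (p + σ • ((a + t • (b - a)) - p) - p))) := by
    simp only [Function.uncurry_def]
    fun_prop
  rw [intervalIntegral_intervalIntegral_swap (hcont.continuousOn.integrableOn_compact
    (isCompact_uIcc.prod isCompact_uIcc) |>.mono_set
      (Set.prod_mono Set.uIoc_subset_uIcc Set.uIoc_subset_uIcc))]
  refine intervalIntegral.integral_congr fun t _ => ?_
  set z := a + t • (b - a) - p with hz
  -- On the ray from p, the integrand with its Jacobian σ is the exact derivative of σ² F. The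
  -- contribution of σ = 0 vanishes and σ = 1 is the opposite edge.
  have hd : ∀ σ : ℝ, HasDerivAt (fun σ : ℝ => σ ^ 2 * F (p + σ • z))
      (σ * (2 * F (p + σ • z) + inner ℝ (gradient F (p + σ • z)) (p + σ • z - p))) σ := fun σ => by
    have h1 : HasDerivAt (fun σ : ℝ => p + σ • z) ((1 : ℝ) • z) σ :=
      ((hasDerivAt_id σ).smul_const z).const_add p
    have h2 : HasDerivAt (fun σ : ℝ => F (p + σ • z)) (fderiv ℝ F (p + σ • z) ((1 : ℝ) • z)) σ :=
      ((hF.differentiable (by simp)).differentiableAt.hasFDerivAt).comp_hasDerivAt σ h1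
    refine ((hasDerivAt_pow 2 σ).mul h2).congr_deriv ?_
    rw [add_sub_cancel_left, inner_smul_right, inner_gradient]
    simp
    ring
  rw [intervalIntegral.integral_eq_sub_of_hasDerivAt (fun σ _ => hd σ)
    (Continuous.intervalIntegrable (by fun_prop) _ _)]
  simp [hz]

/-- `a`, `b` are the end points of the edge `e` of the triangle `T`, and `p` is the opposite
vertex. -/
structure EdgeOf (T e : Finset E2) (p a b : E2) : Prop where
  tri : IsTriangle T
  hp : p ∈ T
  ha : a ∈ T
  hb : b ∈ T
  hpa : p ≠ a
  hpb : p ≠ b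
  hab : a ≠ b
  mem_iff : ∀ x, x ∈ e ↔ x = a ∨ x = b

theorem IsTriangle.exists_edgeOf {T e : Finset E2} (hT : IsTriangle T) (he : e ∈ edgesOf T) :
    ∃ p a b, EdgeOf T e p a b := by
  classical
  obtain ⟨a, b, hab, ha, hb, hx⟩ := exists_eq_pair he
  obtain ⟨p, hp, hpe⟩ : ∃ p ∈ T, p ∉ e := by
    by_contra! hcon
    have := Finset.card_le_card hcon
    rw [hT.1, (Finset.mem_powersetCard.1 he).2] at this
    omega
  rw [hx] at hpe
  push Not at hpe
  exact ⟨p, a, b, hT, hp, ha, hb, hpe.1, hpe.2, hab, hx⟩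

/-- Length of an edge. -/
def len (e : Finset E2) : ℝ := Metric.diam (hull e)

/-! ### Parametrization of an edge and moments of barycentric coordinates -/

namespace EdgeOf

variable {T e : Finset E2} {p a b : E2} (h : EdgeOf T e p a b)
include h

theorem swap : EdgeOf T e p b a :=
  ⟨h.tri, h.hp, h.hb, h.ha, h.hpb, h.hpa, h.hab.symm, fun x => by rw [h.mem_iff]; tauto⟩

open Classical in
theorem eq_pair : e = {a, b} := by ext x; simp [h.mem_iff]

theorem mem_edgesOf : e ∈ edgesOf T := by
  classical
  rw [edgesOf, Finset.mem_powersetCard, h.eq_pair]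
  refine ⟨fun x hx => ?_, Finset.card_pair h.hab⟩
  simp only [Finset.mem_insert, Finset.mem_singleton] at hx
  rcases hx with rfl | rfl
  exacts [h.ha, h.hb]

theorem subset : e ⊆ T := (Finset.mem_powersetCard.1 h.mem_edgesOf).1

theorem len_eq : len e = dist a b := by
  classical
  rw [len, hull, convexHull_diam, h.eq_pair]
  simp [Metric.diam_pair]

theorem len_pos : 0 < len e := by rw [h.len_eq]; exact dist_pos.2 h.hab

theorem len_le : len e ≤ width T := by
  rw [h.len_eq]; exact dist_le_width (subset_hull T h.ha) (subset_hull T h.hb)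

theorem edgeInt_eq (F : E2 → ℝ) :
    edgeInt e F = len e * ∫ t in (0 : ℝ)..1, F (a + t • (b - a)) := by
  classical
  have := edgeInt_pair h.hab (F := F)
  rw [← h.eq_pair] at this
  rw [this, h.len_eq, intervalIntegral.integral_of_le zero_le_one, integral_Icc_eq_integral_Ioc]

theorem bary_left (t : ℝ) : bary T a (a + t • (b - a)) = 1 - t := by
  have := affine_sub_eq_inner (bary T a) (a + t • (b - a)) a
  rw [add_sub_cancel_left, inner_smul_right, ← affine_sub_eq_inner, h.tri.bary_self h.ha,
    h.tri.bary_ne h.ha h.hb h.hab] at this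
  linarith

theorem bary_right (t : ℝ) : bary T b (a + t • (b - a)) = t := by
  have := affine_sub_eq_inner (bary T b) (a + t • (b - a)) a
  rw [add_sub_cancel_left, inner_smul_right, ← affine_sub_eq_inner, h.tri.bary_self h.hb,
    h.tri.bary_ne h.hb h.ha h.hab.symm] at this
  linarith

theorem mem_hull_iff {x : E2} : x ∈ hull e ↔ ∃ t ∈ Set.Icc (0 : ℝ) 1, x = a + t • (b - a) := by
  classical
  rw [h.eq_pair, hull_pair, segment_eq_image']
  simp only [Set.mem_image, eq_comm]

theorem bary_opposite {x : E2} (hx : x ∈ hull e) : bary T p x = 0 := by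
  obtain ⟨t, -, rfl⟩ := h.mem_hull_iff.1 hx
  have := affine_sub_eq_inner (bary T p) (a + t • (b - a)) a
  rw [add_sub_cancel_left, inner_smul_right, ← affine_sub_eq_inner, h.tri.bary_ne h.hp h.ha h.hpa,
    h.tri.bary_ne h.hp h.hb h.hpb] at this
  linarith

theorem sum_eq {G : Type*} [AddCommMonoid G] (f : E2 → G) : ∑ i ∈ e, f i = f a + f b := by
  classical
  rw [h.eq_pair, Finset.sum_pair h.hab]

theorem bary_add_bary {x : E2} (hx : x ∈ hull e) : bary T a x + bary T b x = 1 := by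
  have h1 := h.tri.sum_bary x
  rw [h.tri.sum_eq h.hp h.ha h.hb h.hpa h.hpb h.hab, h.bary_opposite hx, zero_add] at h1
  exact h1

theorem edgeInt_bary_mul_bary : edgeInt e (fun x => bary T a x * bary T b x) = len e / 6 := by
  rw [h.edgeInt_eq]
  simp only [h.bary_left, h.bary_right]
  have : ∀ t : ℝ, HasDerivAt (fun t : ℝ => t ^ 2 / 2 - t ^ 3 / 3) ((1 - t) * t) t := fun t => by
    have := ((hasDerivAt_pow 2 t).div_const 2).sub ((hasDerivAt_pow 3 t).div_const 3)
    refine this.congr_deriv ?_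
    norm_num; ring
  rw [intervalIntegral.integral_eq_sub_of_hasDerivAt (fun t _ => this t)
    (Continuous.intervalIntegrable (by fun_prop) _ _)]
  norm_num
  ring

theorem edgeInt_bary : edgeInt e (fun x => bary T a x) = len e / 2 := by
  rw [h.edgeInt_eq]
  simp only [h.bary_left]
  have : ∀ t : ℝ, HasDerivAt (fun t : ℝ => t - t ^ 2 / 2) (1 - t) t := fun t => by
    have := (hasDerivAt_id t).sub ((hasDerivAt_pow 2 t).div_const 2)
    refine this.congr_deriv ?_
    norm_num
  rw [intervalIntegral.integral_eq_sub_of_hasDerivAt (fun t _ => this t)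
    (Continuous.intervalIntegrable (by fun_prop) _ _)]
  norm_num
  ring

theorem edgeInt_bary_sq : edgeInt e (fun x => bary T a x * bary T a x) = len e / 3 := by
  rw [h.edgeInt_eq]
  simp only [h.bary_left]
  have : ∀ t : ℝ, HasDerivAt (fun t : ℝ => -(1 - t) ^ 3 / 3) ((1 - t) * (1 - t)) t := fun t => by
    have := ((((hasDerivAt_id t).const_sub 1).pow 3).neg).div_const 3
    refine this.congr_deriv ?_
    norm_num; ring
  rw [intervalIntegral.integral_eq_sub_of_hasDerivAt (fun t _ => this t)
    (Continuous.intervalIntegrable (by fun_prop) _ _)]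
  norm_num
  ring

end EdgeOf

/-- Length measure on an edge. -/
abbrev edgeMeasure (e : Finset E2) : Measure E2 := (Measure.hausdorffMeasure 1).restrict (hull e)

theorem ae_mem_hull (e : Finset E2) : ∀ᵐ x ∂(edgeMeasure e), x ∈ hull e :=
  ae_restrict_mem (isCompact_hull e).isClosed.measurableSet

namespace EdgeOf

variable {T e : Finset E2} {p a b : E2} (h : EdgeOf T e p a b)
include h

theorem memLp {F : E2 → ℝ} (hF : Continuous F) : MemLp F 2 (edgeMeasure e) :=
  memLp_edge h.mem_edgesOf hF

/-- The pairing of an affine function on an edge with `v`, in terms of the moments of the affine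
function. -/
theorem sq_edgeInt_mul_le {δ v : E2 → ℝ} {α β : ℝ}
    (hδ : ∀ᵐ x ∂(edgeMeasure e), δ x = α * bary T a x + β * bary T b x) (hv : Continuous v) :
    (edgeInt e fun x => δ x * v x) ^ 2
      ≤ 6 * ((edgeInt e fun x => δ x * bary T a x) ^ 2 + (edgeInt e fun x => δ x * bary T b x) ^ 2)
        * ∫ t in (0 : ℝ)..1, v (a + t • (b - a)) ^ 2 := by
  have hac := continuous_affine (bary T a)
  have hbc := continuous_affine (bary T b)
  set A : E2 → ℝ := fun x => α * bary T a x + β * bary T b x with hA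
  have hAc : Continuous A := by fun_prop
  have hcong : ∀ w : E2 → ℝ, edgeInt e (fun x => δ x * w x) = edgeInt e (fun x => A x * w x) :=
    fun w => integral_congr_ae (hδ.mono fun x hx => by simp only [hx, hA])
  have i1 : Integrable (fun x => bary T a x * bary T a x) (edgeMeasure e) :=
    (h.memLp hac).integrable_mul (h.memLp hac)
  have i2 : Integrable (fun x => bary T a x * bary T b x) (edgeMeasure e) :=
    (h.memLp hac).integrable_mul (h.memLp hbc)
  have i3 : Integrable (fun x => bary T b x * bary T b x) (edgeMeasure e) :=
    (h.memLp hbc).integrable_mul (h.memLp hbc)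
  have hMa : edgeInt e (fun x => A x * bary T a x) = len e * (α / 3 + β / 6) := by
    have e1 : edgeInt e (fun x => A x * bary T a x)
        = α * edgeInt e (fun x => bary T a x * bary T a x)
          + β * edgeInt e (fun x => bary T a x * bary T b x) := by
      unfold edgeInt
      rw [← integral_const_mul, ← integral_const_mul, ← integral_add (i1.const_mul _)
        (i2.const_mul _)]
      refine integral_congr_ae (ae_of_all _ fun x => ?_)
      simp only [hA]; ring
    rw [e1, h.edgeInt_bary_sq, h.edgeInt_bary_mul_bary]; ring
  have hMb : edgeInt e (fun x => A x * bary T b x) = len e * (α / 6 + β / 3) := by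
    have e1 : edgeInt e (fun x => A x * bary T b x)
        = α * edgeInt e (fun x => bary T a x * bary T b x)
          + β * edgeInt e (fun x => bary T b x * bary T b x) := by
      unfold edgeInt
      rw [← integral_const_mul, ← integral_const_mul, ← integral_add (i2.const_mul _)
        (i3.const_mul _)]
      refine integral_congr_ae (ae_of_all _ fun x => ?_)
      simp only [hA]; ring
    rw [e1, h.swap.edgeInt_bary_sq, h.edgeInt_bary_mul_bary]; ring
  have hAA : edgeInt e (fun x => A x * A x)
      = α * edgeInt e (fun x => A x * bary T a x) + β * edgeInt e (fun x => A x * bary T b x) := by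
    have j1 : Integrable (fun x => A x * bary T a x) (edgeMeasure e) :=
      (h.memLp hAc).integrable_mul (h.memLp hac)
    have j2 : Integrable (fun x => A x * bary T b x) (edgeMeasure e) :=
      (h.memLp hAc).integrable_mul (h.memLp hbc)
    unfold edgeInt
    rw [← integral_const_mul, ← integral_const_mul, ← integral_add (j1.const_mul _)
      (j2.const_mul _)]
    refine integral_congr_ae (ae_of_all _ fun x => ?_)
    simp only [hA]; ring
  rw [hcong, hcong, hcong]
  have hcs := abs_integral_mul_le (h.memLp hAc) (h.memLp hv)
  have hcs2 : (edgeInt e fun x => A x * v x) ^ 2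
      ≤ edgeInt e (fun x => A x * A x) * edgeInt e (fun x => v x ^ 2) := by
    have e1 := sq_lpNorm_two_real (h.memLp hAc)
    have e2 := sq_lpNorm_two_real (h.memLp hv)
    calc (edgeInt e fun x => A x * v x) ^ 2 = |edgeInt e fun x => A x * v x| ^ 2 := (sq_abs _).symm
      _ ≤ (lpNorm A 2 (edgeMeasure e) * lpNorm v 2 (edgeMeasure e)) ^ 2 := by
          gcongr; exact hcs
      _ = _ := by
          rw [mul_pow, e1, e2]
          simp only [edgeInt, pow_two]
  refine hcs2.trans ?_
  rw [h.edgeInt_eq (fun x => v x ^ 2), hAA, hMa, hMb, ← mul_assoc]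
  have hnn : 0 ≤ ∫ t in (0 : ℝ)..1, v (a + t • (b - a)) ^ 2 :=
    intervalIntegral.integral_nonneg zero_le_one fun t _ => by positivity
  refine mul_le_mul_of_nonneg_right ?_ hnn
  -- The factor 6 is the inverse of the smallest eigenvalue of the P1 mass matrix of the unit
  -- interval. The two sides differ by exactly `len e ^ 2 * (α + β) ^ 2 / 2`.
  nlinarith [mul_nonneg (sq_nonneg (len e)) (sq_nonneg (α + β)),
    mul_nonneg (sq_nonneg (len e)) (sq_nonneg (α - β))]

end EdgeOf

/-- Trace inequality on a shape regular triangle, for functions that satisfy the Poincaré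
inequality. -/
theorem ShapeRegular.trace_le {κ : ℝ} {T : Finset E2} {c : E2} {r : ℝ} (hs : ShapeRegular κ T c r)
    {e : Finset E2} {p a b : E2} (h : EdgeOf T e p a b) {v : E2 → ℝ} (hv : ContDiff ℝ ∞ v)
    (hP : lpNorm v 2 (volume.restrict (elt T))
      ≤ 2 * width T * lpNorm (gradient v) 2 (volume.restrict (elt T))) :
    ∫ t in (0 : ℝ)..1, v (a + t • (b - a)) ^ 2
      ≤ 6 * κ ^ 2 / discArea * lpNorm (gradient v) 2 (volume.restrict (elt T)) ^ 2 := by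
  set μ := volume.restrict (elt T) with hμ
  set D := lpNorm (gradient v) 2 μ with hD
  set V := lpNorm v 2 μ with hV
  have hD0 : 0 ≤ D := lpNorm_nonneg
  have hV0 : 0 ≤ V := lpNorm_nonneg
  have hh := width_nonneg T
  have hgc := contDiff_gradient hv
  have hm1 : MemLp v 2 μ := memLp_of_continuous hv.continuous (isBounded_elt T)
    (isOpen_elt T).measurableSet (volume_elt_ne_top T) 2
  have hm2 : MemLp (gradient v) 2 μ := memLp_of_continuous hgc (isBounded_elt T)
    (isOpen_elt T).measurableSet (volume_elt_ne_top T) 2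
  have hrad := h.tri.integral_radial h.hp h.ha h.hb h.hpa h.hpb h.hab (F := fun x => v x ^ 2)
    (hv.pow 2)
  set I := ∫ t in (0 : ℝ)..1, v (a + t • (b - a)) ^ 2 with hI
  have hle : ∫ x in elt T, (2 * v x ^ 2 + inner ℝ (gradient (fun x => v x ^ 2) x) (x - p))
      ≤ ∫ x in elt T, (2 * v x ^ 2 + 2 * width T * (‖v x‖ * ‖gradient v x‖)) := by
    have hint2 : Integrable (fun x => 2 * v x ^ 2 + 2 * width T * (‖v x‖ * ‖gradient v x‖)) μ :=
      (hm1.integrable_sq.const_mul 2).add ((hm1.norm.integrable_mul hm2.norm).const_mul _)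
    have hsq : ContDiff ℝ ∞ fun x => v x ^ 2 := hv.pow 2
    have hint1 : Integrable
        (fun x => 2 * v x ^ 2 + inner ℝ (gradient (fun x => v x ^ 2) x) (x - p)) μ := by
      have hc1 := contDiff_gradient hsq
      have hc2 := hv.continuous
      have := memLp_of_continuous (F := fun x =>
        2 * v x ^ 2 + inner ℝ (gradient (fun x => v x ^ 2) x) (x - p)) (by fun_prop)
        (isBounded_elt T) (isOpen_elt T).measurableSet (volume_elt_ne_top T) 1
      exact memLp_one_iff_integrable.1 this
    refine setIntegral_mono_on hint1 hint2 (isOpen_elt T).measurableSet fun x hx => ?_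
    have hdv : DifferentiableAt ℝ v x := (hv.differentiable (by simp)).differentiableAt
    have hg : gradient (fun x => v x ^ 2) x = (2 * v x) • gradient v x := by
      simp_rw [pow_two]
      rw [gradient_mul hdv hdv]; module
    rw [hg, inner_smul_left, conj_trivial]
    have h1 : |inner ℝ (gradient v x) (x - p)| ≤ ‖gradient v x‖ * width T := by
      refine (abs_real_inner_le_norm _ _).trans ?_
      gcongr
      rw [← dist_eq_norm]
      exact dist_le_width (elt_subset_hull T hx) (subset_hull T h.hp)
    have h2 : v x * inner ℝ (gradient v x) (x - p) ≤ ‖v x‖ * (‖gradient v x‖ * width T) := by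
      refine (le_abs_self _).trans ?_
      rw [abs_mul, ← Real.norm_eq_abs]
      gcongr
    nlinarith
  have hrhs : ∫ x in elt T, (2 * v x ^ 2 + 2 * width T * (‖v x‖ * ‖gradient v x‖))
      ≤ 2 * V ^ 2 + 2 * width T * (V * D) := by
    have hprod : Integrable (fun x => ‖v x‖ * ‖gradient v x‖) μ :=
      hm1.norm.integrable_mul hm2.norm
    rw [integral_add (hm1.integrable_sq.const_mul 2) (hprod.const_mul _), integral_const_mul, integral_const_mul,
      hV, sq_lpNorm_two_real hm1]
    have := (le_abs_self _).trans (abs_integral_mul_le hm1.norm hm2.norm)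
    rw [lpNorm_norm hm1.1, lpNorm_norm hm2.1] at this
    gcongr
  have hvol := hs.volume_elt_ge
  have hI0 : 0 ≤ I := intervalIntegral.integral_nonneg zero_le_one fun t _ => by positivity
  -- The Poincaré bound V ≤ 2 h D turns 2 V² + 2 h V D into (8 + 4) h² D². Together with the area
  -- bound `discArea * r ^ 2` and h ≤ κ r this gives the constant 6 κ² / `discArea`.
  have hkey : 2 * volume.real (elt T) * I ≤ 12 * width T ^ 2 * D ^ 2 := by
    rw [← hrad]
    refine (hle.trans hrhs).trans ?_
    have hVD : V * D ≤ 2 * width T * D * D := mul_le_mul_of_nonneg_right hP hD0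
    have hVV : V ^ 2 ≤ (2 * width T * D) ^ 2 := pow_le_pow_left₀ hV0 hP 2
    nlinarith
  have hr := hs.pos
  have hπ := discArea_pos
  have hh2 : width T ^ 2 ≤ (κ * r) ^ 2 := pow_le_pow_left₀ hh hs.diam 2
  rw [div_mul_eq_mul_div, le_div_iff₀ hπ]
  have h3 : discArea * r ^ 2 * I ≤ 6 * (κ * r) ^ 2 * D ^ 2 := by
    have a1 : discArea * r ^ 2 * I ≤ volume.real (elt T) * I := mul_le_mul_of_nonneg_right hvol hI0
    have a2 : width T ^ 2 * D ^ 2 ≤ (κ * r) ^ 2 * D ^ 2 :=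
      mul_le_mul_of_nonneg_right hh2 (sq_nonneg D)
    nlinarith
  have h4 : r ^ 2 * (I * discArea) ≤ r ^ 2 * (6 * κ ^ 2 * D ^ 2) := by nlinarith
  exact le_of_mul_le_mul_left h4 (by positivity)

/-! ### Conforming meshes -/

namespace TriMesh

variable (M : TriMesh)

theorem mem_adj {e T : Finset E2} : T ∈ M.adj e ↔ T ∈ M.tri ∧ e ⊆ T := by
  classical
  simp [adj]

theorem mem_patch {i : E2} {T : Finset E2} : T ∈ M.patch i ↔ T ∈ M.tri ∧ i ∈ T := by
  classical
  simp [patch]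

theorem mem_nodes {i : E2} : i ∈ M.nodes ↔ ∃ T ∈ M.tri, i ∈ T := by
  classical
  simp [nodes]

theorem mem_edges {e : Finset E2} : e ∈ M.edges ↔ ∃ T ∈ M.tri, e ∈ edgesOf T := by
  classical
  simp [edges]

theorem mem_edgesOf_iff {e T : Finset E2} (he : e ∈ M.edges) : e ∈ edgesOf T ↔ e ⊆ T := by
  obtain ⟨T', -, h⟩ := M.mem_edges.1 he
  rw [edgesOf, Finset.mem_powersetCard] at h ⊢
  exact ⟨fun h' => h'.1, fun h' => ⟨h', h.2⟩⟩

theorem mem_adj_of_mem_edgesOf {e T : Finset E2} (hT : T ∈ M.tri) (he : e ∈ edgesOf T) :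
    T ∈ M.adj e := M.mem_adj.2 ⟨hT, (Finset.mem_powersetCard.1 he).1⟩

variable {M}

/-- By conformity the intersection is the hull of the common vertices. The coordinate of i vanishes
at each of them, since i is not common. -/
theorem bary_eq_zero_of_mem_inter {T T' : Finset E2} (hT : T ∈ M.tri) (hT' : T' ∈ M.tri) {i : E2}
    (hi : i ∈ T) (hi' : i ∉ T') {x : E2} (hx : x ∈ hull T) (hx' : x ∈ hull T') :
    bary T i x = 0 := by
  have hmem : x ∈ convexHull ℝ ((T : Set E2) ∩ (T' : Set E2)) := by
    rw [← M.conform T hT T' hT']; exact ⟨hx, hx'⟩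
  have hsub : ((T : Set E2) ∩ (T' : Set E2)) ⊆ bary T i ⁻¹' {0} := by
    rintro j ⟨hj, hj'⟩
    refine (M.isTriangle hT).bary_ne hi hj ?_
    rintro rfl
    exact hi' hj'
  have hconv : Convex ℝ (bary T i ⁻¹' ({0} : Set ℝ)) := (convex_singleton 0).affine_preimage _
  exact convexHull_min hsub hconv hmem

theorem exists_mem_notMem {T T' : Finset E2} (hT : T ∈ M.tri) (hT' : T' ∈ M.tri) (h : T ≠ T') :
    ∃ i ∈ T, i ∉ T' := by
  by_contra! hcon
  exact h (Finset.eq_of_subset_of_card_le hcon (by rw [M.card_eq T hT, M.card_eq T' hT']))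

theorem disjoint_elt {T T' : Finset E2} (hT : T ∈ M.tri) (hT' : T' ∈ M.tri) (h : T ≠ T') :
    Disjoint (elt T) (elt T') := by
  rw [Set.disjoint_left]
  intro x hx hx'
  obtain ⟨i, hi, hi'⟩ := exists_mem_notMem hT hT' h
  have h0 := bary_eq_zero_of_mem_inter hT hT' hi hi' (elt_subset_hull _ hx) (elt_subset_hull _ hx')
  exact absurd h0 ((M.isTriangle hT).mem_elt_iff.1 hx i hi).ne'

/-- Two triangles with a common edge lie on opposite sides of it. -/
theorem bary_neg_of_adj {T T' e : Finset E2} (hT : T ∈ M.tri) (hT' : T' ∈ M.tri) (hne : T ≠ T')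
    {p p' a b : E2} (h : EdgeOf T e p a b) (h' : EdgeOf T' e p' a b) : bary T p p' < 0 := by
  have hp' : p' ∉ T := by
    intro hp'
    obtain ⟨i, hi, hiT⟩ := exists_mem_notMem hT' hT hne.symm
    rw [h'.tri.mem_iff h'.hp h'.ha h'.hb h'.hpa h'.hpb h'.hab] at hi
    rcases hi with rfl | rfl | rfl
    exacts [hiT hp', hiT h.ha, hiT h.hb]
  by_contra! hcon
  -- a point of `T'` close to the midpoint of the edge
  set m : E2 := a + (1 / 2 : ℝ) • (b - a) with hm
  have hval : ∀ (f : E2 →ᵃ[ℝ] ℝ) (s : ℝ), f (m + s • (p' - m)) = f m + s * (f p' - f m) := by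
    intro f s
    have := affine_sub_eq_inner f (m + s • (p' - m)) m
    rw [add_sub_cancel_left, inner_smul_right, ← affine_sub_eq_inner] at this
    linarith
  have hma : bary T a m = 1 / 2 := by rw [hm, h.bary_left]; norm_num
  have hmb : bary T b m = 1 / 2 := by rw [hm, h.bary_right]
  have hma' : bary T' a m = 1 / 2 := by rw [hm, h'.bary_left]; norm_num
  have hmb' : bary T' b m = 1 / 2 := by rw [hm, h'.bary_right]
  have hme : m ∈ hull e := h.mem_hull_iff.2 ⟨1 / 2, by norm_num, rfl⟩
  have hmp : bary T p m = 0 := h.bary_opposite hme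
  have hmp' : bary T' p' m = 0 := h'.bary_opposite hme
  -- The two coordinates at the ends of the edge are 1/2 at the midpoint, so they stay nonnegative
  -- for a small step towards p'. If p' were not on the negative side, the new point would lie in
  -- both triangles although its p'-coordinate is s > 0, against conformity.
  obtain ⟨s, hs0, hs1, hsa, hsb⟩ : ∃ s : ℝ, 0 < s ∧ s ≤ 1 ∧ 0 ≤ 1 / 2 + s * (bary T a p' - 1 / 2) ∧
      0 ≤ 1 / 2 + s * (bary T b p' - 1 / 2) := by
    set B := |bary T a p' - 1 / 2| + |bary T b p' - 1 / 2| + 1 with hB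
    have hB1 : 1 ≤ B := by
      have := abs_nonneg (bary T a p' - 1 / 2)
      have := abs_nonneg (bary T b p' - 1 / 2)
      linarith
    have hBp : 0 < B := by linarith
    have hs : 1 / (2 * B) * B = 1 / 2 := by field_simp
    have hsp : 0 < 1 / (2 * B) := by positivity
    refine ⟨1 / (2 * B), hsp, by nlinarith, ?_, ?_⟩
    · have := neg_abs_le (bary T a p' - 1 / 2)
      have := abs_nonneg (bary T b p' - 1 / 2)
      nlinarith
    · have := neg_abs_le (bary T b p' - 1 / 2)
      have := abs_nonneg (bary T a p' - 1 / 2)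
      nlinarith
  set x := m + s • (p' - m) with hx
  have hxT : x ∈ hull T := by
    rw [h.tri.mem_hull_iff]
    intro i hi
    rw [h.tri.mem_iff h.hp h.ha h.hb h.hpa h.hpb h.hab] at hi
    rw [hx, hval]
    rcases hi with rfl | rfl | rfl
    · rw [hmp]; nlinarith
    · rw [hma]; exact hsa
    · rw [hmb]; exact hsb
  have hxT' : x ∈ hull T' := by
    rw [h'.tri.mem_hull_iff]
    intro i hi
    rw [h'.tri.mem_iff h'.hp h'.ha h'.hb h'.hpa h'.hpb h'.hab] at hi
    rw [hx, hval]
    rcases hi with rfl | rfl | rfl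
    · rw [hmp', h'.tri.bary_self h'.hp]; linarith
    · rw [hma', h'.tri.bary_ne h'.ha h'.hp h'.hpa.symm]; linarith
    · rw [hmb', h'.tri.bary_ne h'.hb h'.hp h'.hpb.symm]; linarith
  have h0 := bary_eq_zero_of_mem_inter hT' hT h'.hp hp' hxT' hxT
  rw [hx, hval, hmp', h'.tri.bary_self h'.hp] at h0
  linarith

theorem exists_edgeOf_of_adj {T e : Finset E2} (hT : T ∈ M.adj e) (he : e ∈ M.edges) :
    ∃ p a b, EdgeOf T e p a b :=
  (M.isTriangle (M.mem_adj.1 hT).1).exists_edgeOf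
    ((M.mem_edgesOf_iff he).2 (M.mem_adj.1 hT).2)

theorem exists_edgeOf_of_adj' {T e : Finset E2} (hT : T ∈ M.adj e) (he : e ∈ M.edges) {a b : E2}
    (hab : a ≠ b) (hm : ∀ x, x ∈ e ↔ x = a ∨ x = b) : ∃ p, EdgeOf T e p a b := by
  obtain ⟨p, c, d, h⟩ := exists_edgeOf_of_adj hT he
  refine ⟨p, h.tri, h.hp, h.subset ((hm a).2 (Or.inl rfl)), h.subset ((hm b).2 (Or.inr rfl)),
    ?_, ?_, hab, hm⟩
  · rintro rfl
    rcases (h.mem_iff p).1 ((hm p).2 (Or.inl rfl)) with h1 | h1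
    exacts [h.hpa h1, h.hpb h1]
  · rintro rfl
    rcases (h.mem_iff p).1 ((hm p).2 (Or.inr rfl)) with h1 | h1
    exacts [h.hpa h1, h.hpb h1]

/-- An edge belongs to at most two triangles. -/
theorem eq_of_adj {e T₁ T₂ T₃ : Finset E2} (he : e ∈ M.edges) (h₁ : T₁ ∈ M.adj e)
    (h₂ : T₂ ∈ M.adj e) (h₃ : T₃ ∈ M.adj e) (h12 : T₁ ≠ T₂) (h13 : T₁ ≠ T₃) : T₂ = T₃ := by
  by_contra h23
  obtain ⟨p₁, a, b, e₁⟩ := exists_edgeOf_of_adj h₁ he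
  obtain ⟨p₂, e₂⟩ := exists_edgeOf_of_adj' h₂ he e₁.hab e₁.mem_iff
  obtain ⟨p₃, e₃⟩ := exists_edgeOf_of_adj' h₃ he e₁.hab e₁.mem_iff
  have t₁ := (M.mem_adj.1 h₁).1
  have t₂ := (M.mem_adj.1 h₂).1
  have t₃ := (M.mem_adj.1 h₃).1
  have n2 := bary_neg_of_adj t₁ t₂ h12 e₁ e₂
  have n3 := bary_neg_of_adj t₁ t₃ h13 e₁ e₃
  have n23 := bary_neg_of_adj t₂ t₃ h23 e₂ e₃
  -- Both coordinates vanish on the line through the edge, hence are proportional, with a negative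
  -- factor because `T₂` lies opposite to `T₁`. The third vertex `p₃` would make both of them
  -- negative, which is impossible.
  have hprop : bary T₁ p₁ = (bary T₁ p₁ p₂) • bary T₂ p₂ := by
    refine e₂.tri.affine_ext fun i hi => ?_
    rw [e₂.tri.mem_iff e₂.hp e₂.ha e₂.hb e₂.hpa e₂.hpb e₂.hab] at hi
    rcases hi with rfl | rfl | rfl
    · simp [e₂.tri.bary_self e₂.hp]
    · simp [e₂.tri.bary_ne e₂.hp e₂.ha e₂.hpa, e₁.tri.bary_ne e₁.hp e₁.ha e₁.hpa]
    · simp [e₂.tri.bary_ne e₂.hp e₂.hb e₂.hpb, e₁.tri.bary_ne e₁.hp e₁.hb e₁.hpb]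
  have := congrArg (fun f : E2 →ᵃ[ℝ] ℝ => f p₃) hprop
  simp only [AffineMap.coe_smul, Pi.smul_apply, smul_eq_mul] at this
  nlinarith

theorem adj_card_pos {e : Finset E2} (he : e ∈ M.edges) : 0 < (M.adj e).card := by
  obtain ⟨T, hT, h⟩ := M.mem_edges.1 he
  exact Finset.card_pos.2 ⟨T, M.mem_adj_of_mem_edgesOf hT h⟩

theorem adj_eq_pair {e T T' : Finset E2} (he : e ∈ M.edges) (h : T ∈ M.adj e) (h' : T' ∈ M.adj e)
    (hne : T ≠ T') (S : Finset E2) : S ∈ M.adj e ↔ S = T ∨ S = T' := by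
  constructor
  · intro hS
    by_cases hST : T = S
    · exact Or.inl hST.symm
    · exact Or.inr (eq_of_adj he h hS h' hST hne)
  · rintro (rfl | rfl) <;> assumption

end TriMesh

theorem TriMesh.IsNodalBasis.eqOn_bary {M : TriMesh} {φ : E2 → E2 → ℝ} (hφ : M.IsNodalBasis φ)
    {T : Finset E2} (hT : T ∈ M.tri) {i : E2} (hi : i ∈ T) : Set.EqOn (φ i) (bary T i) (hull T) := by
  obtain ⟨hP, h1, h0⟩ := hφ i (M.mem_nodes.2 ⟨T, hT, hi⟩)
  obtain ⟨a, ha⟩ := hP T hT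
  have : a = bary T i := by
    refine (M.isTriangle hT).affine_ext fun j hj => ?_
    rw [← ha (subset_hull T hj)]
    by_cases hji : j = i
    · rw [hji, h1, (M.isTriangle hT).bary_self hi]
    · rw [h0 j (M.mem_nodes.2 ⟨T, hT, hj⟩) hji, (M.isTriangle hT).bary_ne hi hj (Ne.symm hji)]
  rw [← this]; exact ha

theorem TriMesh.IsNodalBasis.eq_zero {M : TriMesh} {φ : E2 → E2 → ℝ} (hφ : M.IsNodalBasis φ)
    {T : Finset E2} (hT : T ∈ M.tri) {i : E2} (hi : i ∈ M.nodes) (hiT : i ∉ T) :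
    ∀ x ∈ hull T, φ i x = 0 := by
  obtain ⟨hP, h1, h0⟩ := hφ i hi
  obtain ⟨a, ha⟩ := hP T hT
  have : a = 0 := by
    refine (M.isTriangle hT).affine_ext fun j hj => ?_
    rw [← ha (subset_hull T hj), h0 j (M.mem_nodes.2 ⟨T, hT, hj⟩) (fun h => hiT (h ▸ hj))]
    rfl
  intro x hx
  rw [ha hx, this]; rfl

/-! ### Integration over the mesh and piecewise smooth functions -/

variable {P : Problem} {M : TriMesh}

theorem Problem.Meshed.elt_subset (h : P.Meshed M) {T : Finset E2} (hT : T ∈ M.tri) :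
    elt T ⊆ P.Ω := by
  rw [h.domain_eq]
  exact interior_mono (Set.subset_biUnion_of_mem (u := fun T => hull T) hT)

/-- The points of Ω outside the open triangles lie on frontiers of finitely many convex sets, and
these frontiers have measure zero. -/
theorem Problem.Meshed.ae_eq (h : P.Meshed M) :
    P.Ω =ᵐ[volume] (⋃ T ∈ M.tri, elt T : Set E2) := by
  refine Filter.EventuallyLE.antisymm ?_ (Filter.Eventually.of_forall ?_)
  · rw [ae_le_set]
    have hsub : P.Ω \ (⋃ T ∈ M.tri, elt T) ⊆ ⋃ T ∈ M.tri, frontier (hull T) := by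
      rintro x ⟨hx, hx'⟩
      have hx2 : x ∈ ⋃ T ∈ M.tri, hull T := by
        rw [h.domain_eq] at hx; exact interior_subset hx
      simp only [Set.mem_iUnion, exists_prop, not_exists, not_and] at hx2 hx' ⊢
      obtain ⟨T, hT, hxT⟩ := hx2
      exact ⟨T, hT, subset_closure hxT, hx' T hT⟩
    refine measure_mono_null hsub ?_
    exact (measure_biUnion_null_iff M.tri.countable_toSet).2
      fun T _ => (convex_hull T).addHaar_frontier volume
  · intro x hx
    obtain ⟨T, hT, hx⟩ := Set.mem_iUnion₂.1 hx
    exact h.elt_subset hT hx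

theorem Problem.Meshed.integral_eq_sum {G : Type*} [NormedAddCommGroup G] [NormedSpace ℝ G]
    (h : P.Meshed M) {F : E2 → G} (hF : Integrable F (volume.restrict P.Ω)) :
    ∫ x in P.Ω, F x = ∑ T ∈ M.tri, ∫ x in elt T, F x := by
  rw [setIntegral_congr_set h.ae_eq, integral_biUnion_finset]
  · exact fun T _ => (isOpen_elt T).measurableSet
  · intro T hT T' hT' hne
    exact TriMesh.disjoint_elt hT hT' hne
  · intro T hT
    exact hF.mono_measure (Measure.restrict_mono (h.elt_subset hT) le_rfl)

theorem Problem.Meshed.ae_restrict_iff (h : P.Meshed M) {p : E2 → Prop} :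
    (∀ᵐ x ∂(volume.restrict P.Ω), p x) ↔ ∀ T ∈ M.tri, ∀ᵐ x ∂(volume.restrict (elt T)), p x := by
  rw [Measure.restrict_congr_set h.ae_eq, ae_restrict_biUnion_finset_iff]

theorem Problem.Meshed.memLp (h : P.Meshed M) {G : Type*} [NormedAddCommGroup G] {F : E2 → G}
    (H : Finset E2 → E2 → G)
    (hFH : ∀ T ∈ M.tri, ∀ᵐ x ∂(volume.restrict (elt T)), F x = H T x)
    (hH : ∀ T ∈ M.tri, MemLp (H T) 2 (volume.restrict (elt T))) :
    MemLp F 2 (volume.restrict P.Ω) := by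
  have h1 : MemLp (fun x => ∑ T ∈ M.tri, (elt T).indicator (H T) x) 2 volume :=
    memLp_finsetSum _ fun T hT =>
      (memLp_indicator_iff_restrict (isOpen_elt T).measurableSet).2 (hH T hT)
  refine (h1.mono_measure Measure.restrict_le_self).ae_eq ?_
  refine h.ae_restrict_iff.2 fun T hT => ?_
  filter_upwards [hFH T hT, ae_restrict_mem (isOpen_elt T).measurableSet] with x hx hxT
  rw [Finset.sum_eq_single_of_mem T hT, Set.indicator_of_mem hxT, hx]
  intro T' hT' hne
  rw [Set.indicator_of_notMem]
  exact fun hx' => Set.disjoint_left.1 (TriMesh.disjoint_elt hT hT' hne.symm) hxT hx'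

/-- Functions that coincide on each triangle of the mesh with a smooth function. -/
def PiecewiseSmooth (M : TriMesh) (v : E2 → ℝ) : Prop :=
  ∀ T ∈ M.tri, ∃ w : E2 → ℝ, ContDiff ℝ ∞ w ∧ Set.EqOn v w (hull T)

theorem eventuallyEq_of_eqOn_hull {T : Finset E2} {v w : E2 → ℝ} (h : Set.EqOn v w (hull T))
    {x : E2} (hx : x ∈ elt T) : v =ᶠ[𝓝 x] w :=
  (h.mono (elt_subset_hull T)).eventuallyEq_of_mem ((isOpen_elt T).mem_nhds hx)

theorem gradient_eq_of_eqOn_hull {T : Finset E2} {v w : E2 → ℝ} (h : Set.EqOn v w (hull T))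
    {x : E2} (hx : x ∈ elt T) : gradient v x = gradient w x :=
  gradient_eq_of_eventuallyEq (eventuallyEq_of_eqOn_hull h hx)

theorem memLp_elt_of_contDiff {w : E2 → ℝ} (hw : ContDiff ℝ ∞ w) (T : Finset E2) :
    MemLp w 2 (volume.restrict (elt T)) :=
  memLp_of_continuous hw.continuous (isBounded_elt T) (isOpen_elt T).measurableSet
    (volume_elt_ne_top T) 2

theorem memLp_gradient_elt_of_contDiff {w : E2 → ℝ} (hw : ContDiff ℝ ∞ w) (T : Finset E2) :
    MemLp (gradient w) 2 (volume.restrict (elt T)) :=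
  memLp_of_continuous (contDiff_gradient hw) (isBounded_elt T) (isOpen_elt T).measurableSet
    (volume_elt_ne_top T) 2

theorem PiecewiseSmooth.memLp_gradient {v : E2 → ℝ} (hv : PiecewiseSmooth M v) (h : P.Meshed M) :
    MemLp (gradient v) 2 (volume.restrict P.Ω) := by
  choose! w hw hvw using hv
  refine h.memLp (fun T => gradient (w T)) (fun T hT => ?_)
    (fun T hT => memLp_gradient_elt_of_contDiff (hw T hT) T)
  exact ae_restrict_of_forall_mem (isOpen_elt T).measurableSet fun x hx =>
    gradient_eq_of_eqOn_hull (hvw T hT) hx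

/-- Agreement on the closed triangles forces continuity across the edges. The product with a test
function is Lipschitz on each closed triangle and zero on the complement of Ω, and these finitely
many closed sets cover the plane. -/
theorem PiecewiseSmooth.memH1 {v : E2 → ℝ} (hv : PiecewiseSmooth M v) (h : P.Meshed M)
    (ho : IsOpen P.Ω) (hb : Bornology.IsBounded P.Ω) : MemH1 P.Ω v (gradient v) := by
  have hg := hv.memLp_gradient h
  choose! w hw hvw using hv
  refine memH1_of_lipschitz ho hb ?_ hg ?_ ?_
  · refine h.memLp w (fun T hT => ?_) (fun T hT => memLp_elt_of_contDiff (hw T hT) T)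
    exact ae_restrict_of_forall_mem (isOpen_elt T).measurableSet fun x hx =>
      hvw T hT (elt_subset_hull T hx)
  · refine h.ae_restrict_iff.2 fun T hT => ?_
    refine ae_restrict_of_forall_mem (isOpen_elt T).measurableSet fun x hx => ⟨?_, rfl⟩
    exact (((hw T hT).differentiable (by simp)).differentiableAt).congr_of_eventuallyEq
      (eventuallyEq_of_eqOn_hull (hvw T hT) hx)
  · intro ψ hψ hψc hψΩ
    have hK : ∀ T ∈ M.tri, ∃ K : NNReal, LipschitzOnWith K (fun x => ψ x * v x) (hull T) := by
      intro T hT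
      obtain ⟨K, hK⟩ := exists_lipschitzOnWith_of_contDiff (hψ.mul (hw T hT)) (isCompact_hull T)
        (convex_hull T)
      refine ⟨K, fun x hx y hy => ?_⟩
      simp only [hvw T hT hx, hvw T hT hy]
      exact hK hx hy
    choose! K hK using hK
    refine ⟨M.tri.sup K, ?_⟩
    refine lipschitzWith_of_finite_closed_cover (ι := Option M.tri)
      (C := fun o => o.elim P.Ωᶜ fun T => hull T) ?_ ?_ ?_
    · rintro (_ | T)
      · exact ho.isClosed_compl
      · exact (isCompact_hull T).isClosed
    · intro x
      by_cases hx : x ∈ P.Ω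
      · rw [h.domain_eq] at hx
        obtain ⟨T, hT, hx⟩ := Set.mem_iUnion₂.1 (interior_subset hx)
        exact ⟨some ⟨T, hT⟩, hx⟩
      · exact ⟨none, hx⟩
    · rintro (_ | T)
      · intro x hx y hy
        have h0 : ∀ z, z ∈ P.Ωᶜ → ψ z = 0 := fun z hz => by
          by_contra hne
          exact hz (hψΩ (subset_tsupport ψ hne))
        simp [h0 x hx, h0 y hy]
      · exact (hK T T.2).weaken (Finset.le_sup (f := K) T.2)

/-- The smooth function that equals v on the closed triangle serves as a constant approximating
sequence. -/
theorem PiecewiseSmooth.hasTrace {v : E2 → ℝ} (hv : PiecewiseSmooth M v) {T e : Finset E2}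
    (hT : T ∈ M.tri) (he : e ∈ edgesOf T) {t : E2 → ℝ} (ht : Set.EqOn v t (hull e)) :
    HasTrace (elt T) (hull e) v (gradient v) t := by
  obtain ⟨w, hw, hvw⟩ := hv T hT
  have hsub : hull e ⊆ hull T := hull_mono (Finset.mem_powersetCard.1 he).1
  have hm : MeasurableSet (hull e) := (isCompact_hull e).isClosed.measurableSet
  have hwt : ∀ᵐ x ∂(edgeMeasure e), w x = t x := by
    filter_upwards [ae_mem_hull e] with x hx
    rw [← hvw (hsub hx), ht hx]
  refine ⟨(memLp_edge he hw.continuous).ae_eq hwt, fun _ => w, fun _ => hw, ?_, ?_, ?_⟩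
  · have : eLpNorm (fun x => w x - v x) 2 (volume.restrict (elt T)) = 0 := by
      rw [eLpNorm_congr_ae (g := 0) (ae_restrict_of_forall_mem (isOpen_elt T).measurableSet
        fun x hx => by simp [hvw (elt_subset_hull T hx)]), eLpNorm_zero]
    simp only [this, tendsto_const_nhds]
  · have : eLpNorm (fun x => gradient w x - gradient v x) 2 (volume.restrict (elt T)) = 0 := by
      rw [eLpNorm_congr_ae (g := 0) (ae_restrict_of_forall_mem (isOpen_elt T).measurableSet
        fun x hx => by simp [gradient_eq_of_eqOn_hull hvw hx]), eLpNorm_zero]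
    simp only [this, tendsto_const_nhds]
  · have : eLpNorm (fun x => w x - t x) 2 (edgeMeasure e) = 0 := by
      rw [eLpNorm_congr_ae (g := 0) (hwt.mono fun x hx => by simp [hx]), eLpNorm_zero]
    simp only [this, tendsto_const_nhds]

/-! ### The coefficient matrix -/

theorem mulV_add (B : Matrix (Fin 2) (Fin 2) ℝ) (ξ ζ : E2) :
    mulV B (ξ + ζ) = mulV B ξ + mulV B ζ := by
  rw [mulV, WithLp.ofLp_add, Matrix.mulVec_add, WithLp.toLp_add]; rfl

theorem mulV_sub (B : Matrix (Fin 2) (Fin 2) ℝ) (ξ ζ : E2) :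
    mulV B (ξ - ζ) = mulV B ξ - mulV B ζ := by
  rw [mulV, WithLp.ofLp_sub, Matrix.mulVec_sub, WithLp.toLp_sub]; rfl

theorem inner_mulV_comm {B : Matrix (Fin 2) (Fin 2) ℝ} (hB : B.IsSymm) (ξ ζ : E2) :
    inner ℝ (mulV B ξ) ζ = inner ℝ ξ (mulV B ζ) := by
  have h01 : B 1 0 = B 0 1 := hB.apply 0 1
  simp [mulV, PiLp.inner_apply, Fin.sum_univ_two, h01]
  ring

/-- Symmetry and the ellipticity bounds for one matrix. -/
structure Elliptic (amin amax : ℝ) (B : Matrix (Fin 2) (Fin 2) ℝ) : Prop where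
  symm : B.IsSymm
  lower : ∀ ξ : E2, amin * ‖ξ‖ ^ 2 ≤ inner ℝ (mulV B ξ) ξ
  upper : ∀ ξ : E2, inner ℝ (mulV B ξ) ξ ≤ amax * ‖ξ‖ ^ 2

/-- Polarization: take ζ parallel to Bξ and as long as ξ, so that Bξ·ζ = ‖ξ‖ ‖Bξ‖. This is a quarter
of the difference of the quadratic form at ξ + ζ and at ξ - ζ. The first is bounded above, the
second is nonnegative, and the parallelogram law concludes. -/
theorem Elliptic.norm_mulV_le {amin amax : ℝ} (hmin : 0 < amin)
    {B : Matrix (Fin 2) (Fin 2) ℝ} (h : Elliptic amin amax B) (ξ : E2) :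
    ‖mulV B ξ‖ ≤ amax * ‖ξ‖ := by
  rcases eq_or_ne ξ 0 with rfl | hξ
  · simp [mulV]
  have hξ' : 0 < ‖ξ‖ := norm_pos_iff.2 hξ
  rcases eq_or_ne (mulV B ξ) 0 with h0 | h0
  · rw [h0, norm_zero]
    have h1 := h.lower ξ
    have h2 := h.upper ξ
    have : 0 ≤ amax * ‖ξ‖ * ‖ξ‖ := by nlinarith [mul_pos hmin (pow_pos hξ' 2)]
    exact nonneg_of_mul_nonneg_left this hξ'
  have hA : 0 < ‖mulV B ξ‖ := norm_pos_iff.2 h0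
  set ζ : E2 := (‖ξ‖ * ‖mulV B ξ‖⁻¹) • mulV B ξ with hζ
  have hζn : ‖ζ‖ = ‖ξ‖ := by
    rw [hζ, norm_smul, norm_mul, norm_norm, norm_inv, norm_norm]
    field_simp
  have hin : inner ℝ (mulV B ξ) ζ = ‖ξ‖ * ‖mulV B ξ‖ := by
    rw [hζ, inner_smul_right, real_inner_self_eq_norm_sq]
    field_simp
  have hpol : inner ℝ (mulV B (ξ + ζ)) (ξ + ζ) - inner ℝ (mulV B (ξ - ζ)) (ξ - ζ)
      = 4 * inner ℝ (mulV B ξ) ζ := by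
    have hs : inner ℝ (mulV B ζ) ξ = inner ℝ (mulV B ξ) ζ := by
      rw [inner_mulV_comm h.symm, real_inner_comm]
    simp only [mulV_add, mulV_sub, inner_add_left, inner_add_right, inner_sub_left,
      inner_sub_right, hs]
    ring
  have h1 := h.upper (ξ + ζ)
  have h2 := h.lower (ξ - ζ)
  have h3 : ‖ξ + ζ‖ ^ 2 + ‖ξ - ζ‖ ^ 2 = 4 * ‖ξ‖ ^ 2 := by
    have := parallelogram_law_with_norm ℝ ξ ζ
    rw [hζn] at this
    nlinarith
  have h4 : 0 ≤ amax := by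
    have h5 := h.lower ξ
    have h6 := h.upper ξ
    have : 0 ≤ amax * ‖ξ‖ ^ 2 := by nlinarith [mul_pos hmin (pow_pos hξ' 2)]
    exact nonneg_of_mul_nonneg_left this (by positivity)
  have h7 : ‖ξ‖ * ‖mulV B ξ‖ ≤ ‖ξ‖ * (amax * ‖ξ‖) := by
    rw [hin] at hpol
    nlinarith [mul_nonneg hmin.le (sq_nonneg ‖ξ - ζ‖), mul_nonneg h4 (sq_nonneg ‖ξ - ζ‖)]
  exact le_of_mul_le_mul_left h7 hξ'

theorem Elliptic.inv_mulV {amin amax : ℝ} (hmin : 0 < amin)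
    {B : Matrix (Fin 2) (Fin 2) ℝ} (h : Elliptic amin amax B) (ξ : E2) :
    mulV B⁻¹ (mulV B ξ) = ξ := by
  have hdet : IsUnit B.det := by
    rw [isUnit_iff_ne_zero]
    intro h0
    obtain ⟨v, hv, hBv⟩ := Matrix.exists_mulVec_eq_zero_iff.2 h0
    have h1 := h.lower (WithLp.toLp 2 v)
    have h2 : mulV B (WithLp.toLp 2 v) = 0 := by simp [mulV, hBv]
    rw [h2, inner_zero_left] at h1
    have h3 : (0 : ℝ) < ‖WithLp.toLp 2 v‖ := by
      rw [norm_pos_iff]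
      intro hz
      apply hv
      simpa using hz
    nlinarith [mul_pos hmin (pow_pos h3 2)]
  rw [mulV, mulV, Matrix.mulVec_mulVec, Matrix.nonsing_inv_mul B hdet, Matrix.one_mulVec]

variable {P : Problem} {M : TriMesh} {amin amax : ℝ}

theorem Problem.Admissible.ae_elliptic (h : P.Admissible amin amax) :
    ∀ᵐ x ∂(volume.restrict P.Ω), Elliptic amin amax (P.A x) := by
  filter_upwards [h.A_symm, h.A_elliptic] with x h1 h2
  exact ⟨h1, fun ξ => (h2 ξ).1, fun ξ => (h2 ξ).2⟩

theorem Problem.Admissible.ae_elliptic_elt (h : P.Admissible amin amax) (hM : P.Meshed M)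
    {T : Finset E2} (hT : T ∈ M.tri) :
    ∀ᵐ x ∂(volume.restrict (elt T)), Elliptic amin amax (P.A x) :=
  hM.ae_restrict_iff.1 h.ae_elliptic T hT

theorem Problem.Admissible.memLp_mulV (h : P.Admissible amin amax) (hmin : 0 < amin)
    {U : Set E2} (hU : U ⊆ P.Ω) {F : E2 → E2} (hF : MemLp F 2 (volume.restrict U)) :
    MemLp (fun x => mulV (P.A x) (F x)) 2 (volume.restrict U) := by
  have hle : volume.restrict U ≤ volume.restrict P.Ω := Measure.restrict_mono hU le_rfl
  have hmeas : AEStronglyMeasurable (fun x => mulV (P.A x) (F x)) (volume.restrict U) := by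
    have hc : ∀ j, AEMeasurable (fun x => F x j) (volume.restrict U) := fun j =>
      ((EuclideanSpace.proj (𝕜 := ℝ) j).continuous.comp_aestronglyMeasurable hF.1).aemeasurable
    have hA : ∀ i j, AEMeasurable (fun x => P.A x i j) (volume.restrict U) := fun i j =>
      ((h.A_meas i j).mono_measure hle).aemeasurable
    refine AEMeasurable.aestronglyMeasurable ?_
    unfold mulV
    refine (WithLp.measurable_toLp 2 (Fin 2 → ℝ)).comp_aemeasurable (aemeasurable_pi_iff.2 fun i => ?_)
    simp only [Matrix.mulVec, dotProduct, Fin.sum_univ_two]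
    exact ((hA i 0).mul (hc 0)).add ((hA i 1).mul (hc 1))
  refine hF.of_le_mul (c := amax) hmeas ?_
  filter_upwards [ae_mono hle h.ae_elliptic] with x hx
  exact hx.norm_mulV_le hmin _

theorem Problem.Admissible.abs_integral_mulV_le (h : P.Admissible amin amax) (hmin : 0 < amin)
    (hmax : amin ≤ amax)
    {U : Set E2} (hU : U ⊆ P.Ω) {F G : E2 → E2} (hF : MemLp F 2 (volume.restrict U))
    (hG : MemLp G 2 (volume.restrict U)) :
    |∫ x in U, inner ℝ (mulV (P.A x) (F x)) (G x)|
      ≤ amax * lpNorm F 2 (volume.restrict U) * lpNorm G 2 (volume.restrict U) := by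
  have hle : volume.restrict U ≤ volume.restrict P.Ω := Measure.restrict_mono hU le_rfl
  have h0 : 0 ≤ amax := hmin.le.trans hmax
  refine (abs_integral_inner_le (h.memLp_mulV hmin hU hF) hG).trans ?_
  refine mul_le_mul_of_nonneg_right ?_ lpNorm_nonneg
  refine le_of_sq_le_sq ?_ (mul_nonneg h0 lpNorm_nonneg)
  rw [mul_pow, sq_lpNorm_two (h.memLp_mulV hmin hU hF), sq_lpNorm_two hF, ← integral_const_mul]
  refine integral_mono_ae (h.memLp_mulV hmin hU hF).norm.integrable_sq
    (hF.norm.integrable_sq.const_mul _) ?_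
  filter_upwards [ae_mono hle h.ae_elliptic] with x hx
  rw [← mul_pow]
  exact pow_le_pow_left₀ (norm_nonneg _) (hx.norm_mulV_le hmin _) 2

/-! ### The residual of the finite element solution -/

/-- The standing assumptions, with shape regularity in the form of inscribed discs. -/
structure Setting (amin amax κ : ℝ) (N : ℕ) (P : Problem) (M : TriMesh) (Df : E2 → E2)
    (u : E2 → ℝ) (Du : E2 → E2) (uh : E2 → ℝ) (φ : E2 → E2 → ℝ)
    (η : Finset E2 → Finset E2 → E2 → ℝ) : Prop where
  hmin : 0 < amin
  hmax : amin ≤ amax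
  adm : P.Admissible amin amax
  meshed : P.Meshed M
  shape : ∀ T ∈ M.tri, ∃ c r, ShapeRegular κ T c r
  valence : ∀ i ∈ M.nodes, (M.patch i).card ≤ N
  fH1 : MemH1 P.Ω P.f Df
  weak : P.IsWeakSolution M u Du
  uhP1 : M.IsP1 uh
  basis : M.IsNodalBasis φ
  edgeFlux : P.IsEdgeFlux M uh η
  sumConst : P.FluxSumConst M η
  jumpConst : P.FluxJumpConst M η

theorem TriMesh.IsP1.piecewiseSmooth {M : TriMesh} {v : E2 → ℝ} (h : M.IsP1 v) :
    PiecewiseSmooth M v := fun T hT => by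
  obtain ⟨a, ha⟩ := h T hT
  exact ⟨a, contDiff_affine a, ha⟩

theorem TriMesh.IsNodalBasis.eq_zero_on_edge {M : TriMesh} {φ : E2 → E2 → ℝ}
    (hφ : M.IsNodalBasis φ) {T e : Finset E2} (hT : T ∈ M.tri) (he : e ∈ edgesOf T) {i : E2}
    (hi : i ∈ M.nodes) (hie : i ∉ e) : ∀ x ∈ hull e, φ i x = 0 := by
  intro x hx
  have hxT := hull_mono (Finset.mem_powersetCard.1 he).1 hx
  by_cases hiT : i ∈ T
  · obtain ⟨p, a, b, h⟩ := (M.isTriangle hT).exists_edgeOf he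
    have hip : i = p := by
      rw [h.tri.mem_iff h.hp h.ha h.hb h.hpa h.hpb h.hab] at hiT
      rcases hiT with rfl | rfl | rfl
      · rfl
      · exact absurd ((h.mem_iff i).2 (Or.inl rfl)) hie
      · exact absurd ((h.mem_iff i).2 (Or.inr rfl)) hie
    rw [hip, hφ.eqOn_bary hT h.hp hxT, h.bary_opposite hx]
  · exact hφ.eq_zero hT hi hiT x hxT

/-! ### Bubble functions -/

/-- Product of the nodal functions of the vertices in `s`. -/
def bubble (φ : E2 → E2 → ℝ) (s : Finset E2) (x : E2) : ℝ := ∏ i ∈ s, φ i x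

/-- Product of barycentric coordinates. -/
def baryProd (T s : Finset E2) (x : E2) : ℝ := ∏ i ∈ s, bary T i x

theorem contDiff_baryProd (T s : Finset E2) : ContDiff ℝ ∞ (baryProd T s) :=
  contDiff_prod fun i _ => contDiff_affine (bary T i)

section Bubble

variable {M : TriMesh} {φ : E2 → E2 → ℝ} (hφ : M.IsNodalBasis φ) {s : Finset E2}
include hφ

theorem bubble_eqOn {T : Finset E2} (hT : T ∈ M.tri) (hs : s ⊆ T) :
    Set.EqOn (bubble φ s) (baryProd T s) (hull T) := fun x hx =>
  Finset.prod_congr rfl fun i hi => hφ.eqOn_bary hT (hs hi) hx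

theorem bubble_eq_zero (hsn : s ⊆ M.nodes) {T : Finset E2} (hT : T ∈ M.tri) (hs : ¬ s ⊆ T) :
    ∀ x ∈ hull T, bubble φ s x = 0 := fun x hx => by
  obtain ⟨i, hi, hiT⟩ := Finset.not_subset.1 hs
  exact Finset.prod_eq_zero hi (hφ.eq_zero hT (hsn hi) hiT x hx)

theorem bubble_eq_zero_on_edge (hsn : s ⊆ M.nodes) {T e : Finset E2} (hT : T ∈ M.tri)
    (he : e ∈ edgesOf T) (hs : ¬ s ⊆ e) : ∀ x ∈ hull e, bubble φ s x = 0 := fun x hx => by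
  obtain ⟨i, hi, hiT⟩ := Finset.not_subset.1 hs
  exact Finset.prod_eq_zero hi (hφ.eq_zero_on_edge hT he (hsn hi) hiT x hx)

theorem bubble_piecewiseSmooth (hsn : s ⊆ M.nodes) : PiecewiseSmooth M (bubble φ s) := by
  intro T hT
  by_cases hs : s ⊆ T
  · exact ⟨_, contDiff_baryProd T s, bubble_eqOn hφ hT hs⟩
  · exact ⟨fun _ => 0, contDiff_const, fun x hx => bubble_eq_zero hφ hsn hT hs x hx⟩

end Bubble

/-! ### Size of the bubbles on a shape regular triangle -/

namespace ShapeRegular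

variable {κ : ℝ} {T : Finset E2} {c : E2} {r : ℝ} (h : ShapeRegular κ T c r) {s : Finset E2}
include h

theorem abs_baryProd_le (hs : s ⊆ T) {x : E2} (hx : x ∈ hull T) : |baryProd T s x| ≤ 1 := by
  rw [baryProd, Finset.abs_prod]
  refine Finset.prod_le_one (fun i _ => abs_nonneg _) fun i hi => ?_
  rw [abs_of_nonneg (h.tri.mem_hull_iff.1 hx i (hs hi))]
  exact h.tri.bary_le_one hx (hs hi)

theorem norm_gradient_baryProd_le (hs : s ⊆ T) {x : E2} (hx : x ∈ hull T) :
    ‖gradient (baryProd T s) x‖ ≤ 3 / (2 * r) := by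
  classical
  have hd := HasFDerivAt.finsetProd (u := s) (x := x) (g := fun i => (bary T i : E2 → ℝ))
    (g' := fun i => fderiv ℝ (bary T i) x)
    (fun i _ => (differentiableAt_affine (bary T i) x).hasFDerivAt)
  have hr := h.pos
  have hcard : (s.card : ℝ) ≤ 3 := by
    have := Finset.card_le_card hs
    rw [h.tri.1] at this
    exact_mod_cast this
  have hfd : fderiv ℝ (baryProd T s) x
      = ∑ i ∈ s, (∏ j ∈ s.erase i, bary T j x) • fderiv ℝ (bary T i) x := hd.fderiv
  rw [norm_gradient, hfd]
  calc ‖∑ i ∈ s, (∏ j ∈ s.erase i, bary T j x) • fderiv ℝ (bary T i) x‖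
      ≤ ∑ i ∈ s, 1 / (2 * r) := by
        refine (norm_sum_le _ _).trans (Finset.sum_le_sum fun i hi => ?_)
        rw [norm_smul, ← norm_gradient, gradient_affine]
        have h1 : ‖∏ j ∈ s.erase i, bary T j x‖ ≤ 1 :=
          h.abs_baryProd_le ((Finset.erase_subset i s).trans hs) hx
        have h2 : ‖agrad (bary T i)‖ ≤ 1 / (2 * r) := by
          rw [le_div_iff₀ (by positivity)]; exact h.norm_agrad_le (hs hi)
        calc _ ≤ 1 * (1 / (2 * r)) := mul_le_mul h1 h2 (norm_nonneg _) zero_le_one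
          _ = _ := one_mul _
    _ = s.card * (1 / (2 * r)) := by rw [Finset.sum_const, nsmul_eq_mul]
    _ ≤ 3 * (1 / (2 * r)) := by gcongr
    _ = 3 / (2 * r) := by ring

theorem sqrt_volume_le : √(volume.real (elt T)) ≤ √discArea * width T := by
  refine Real.sqrt_le_iff.2 ⟨mul_nonneg (Real.sqrt_nonneg _) (width_nonneg T), ?_⟩
  rw [mul_pow, Real.sq_sqrt discArea_pos.le]
  exact h.volume_elt_le

theorem lpNorm_baryProd_le (hs : s ⊆ T) :
    lpNorm (baryProd T s) 2 (volume.restrict (elt T)) ≤ √discArea * width T := by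
  refine (lpNorm_two_le_of_bound zero_le_one ?_).trans ?_
  · exact ae_restrict_of_forall_mem (isOpen_elt T).measurableSet fun x hx =>
      h.abs_baryProd_le hs (elt_subset_hull T hx)
  · rw [one_mul, measureReal_restrict_apply_univ]
    exact h.sqrt_volume_le

/-- Scale invariance in the plane: the gradient is of size 1/r and the square root of the area of
size at most κ r, so the mesh size cancels. -/
theorem lpNorm_gradient_baryProd_le (hs : s ⊆ T) :
    lpNorm (gradient (baryProd T s)) 2 (volume.restrict (elt T)) ≤ 3 / 2 * κ * √discArea := by
  have hr := h.pos
  refine (lpNorm_two_le_of_bound (C := 3 / (2 * r)) (by positivity) ?_).trans ?_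
  · exact ae_restrict_of_forall_mem (isOpen_elt T).measurableSet fun x hx =>
      h.norm_gradient_baryProd_le hs (elt_subset_hull T hx)
  · rw [measureReal_restrict_apply_univ]
    calc 3 / (2 * r) * √(volume.real (elt T)) ≤ 3 / (2 * r) * (√discArea * (κ * r)) := by
          gcongr
          refine h.sqrt_volume_le.trans ?_
          gcongr
          exact h.diam
      _ = _ := by field_simp

/-- At the centre of the disc each coordinate is at least r ‖∇λ‖, and on the concentric disc of half
the radius it varies by at most half of that. As ‖∇λ‖ ≥ 1/(κ r), every coordinate is at least 1/(2κ)
there. The cube of this times the area of the half disc is the bound. -/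
theorem integral_baryProd_ge :
    discArea / (32 * κ ^ 3) * r ^ 2 ≤ ∫ x in elt T, baryProd T T x := by
  have hr := h.pos
  have hκ := h.kappa_pos
  set B := Metric.closedBall c (r / 2) with hB
  have hBs : B ⊆ elt T := by
    refine (Metric.closedBall_subset_ball (by linarith)).trans h.ball_subset_elt
  have hbar : ∀ x ∈ B, ∀ i ∈ T, 1 / (2 * κ) ≤ bary T i x := by
    intro x hx i hi
    have h1 := h.mul_norm_agrad_le_bary hi
    have h2 := affine_sub_eq_inner (bary T i) x c
    have h3 : |inner ℝ (agrad (bary T i)) (x - c)| ≤ ‖agrad (bary T i)‖ * (r / 2) := by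
      refine (abs_real_inner_le_norm _ _).trans ?_
      gcongr
      rw [← dist_eq_norm]; exact hx
    have h4 := (abs_le.1 h3).1
    have h5 := h.one_le_norm_agrad_mul_width hi
    have h6 : 1 ≤ ‖agrad (bary T i)‖ * (κ * r) :=
      h5.trans (mul_le_mul_of_nonneg_left h.diam (norm_nonneg _))
    rw [div_le_iff₀ (by positivity)]
    nlinarith
  have hintegrable : Integrable (baryProd T T) (volume.restrict (elt T)) :=
    (memLp_elt_of_contDiff (contDiff_baryProd T T) T).integrable (by norm_num)
  have hnn : ∀ x ∈ elt T, 0 ≤ baryProd T T x := fun x hx =>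
    Finset.prod_nonneg fun i hi => h.tri.mem_hull_iff.1 (elt_subset_hull T hx) i hi
  calc discArea / (32 * κ ^ 3) * r ^ 2 = ∫ x in B, (1 / (2 * κ)) ^ 3 := by
        rw [setIntegral_const, hB, volume_real_closedBall c (by positivity), smul_eq_mul]
        field_simp
        ring
    _ ≤ ∫ x in B, baryProd T T x := by
        refine setIntegral_mono_on (integrableOn_const (by
          exact Metric.isBounded_closedBall.measure_lt_top.ne)) (hintegrable.mono_measure
          (Measure.restrict_mono hBs le_rfl)) Metric.isClosed_closedBall.measurableSet
          fun x hx => ?_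
        rw [← h.tri.1, ← Finset.prod_const]
        exact Finset.prod_le_prod (fun i _ => by positivity) fun i hi => hbar x hx i hi
    _ ≤ ∫ x in elt T, baryProd T T x := by
        refine setIntegral_mono_set hintegrable ?_ hBs.eventuallyLE
        exact ae_restrict_of_forall_mem (isOpen_elt T).measurableSet hnn

end ShapeRegular

/-- `L²` norm on a triangle. -/
abbrev nrm {G : Type*} [NormedAddCommGroup G] (T : Finset E2) (F : E2 → G) : ℝ :=
  lpNorm F 2 (volume.restrict (elt T))

/-- The local error and data oscillation terms that bound the estimator. -/
def locErr (Df Du : E2 → E2) (uh : E2 → ℝ) (T : Finset E2) : ℝ :=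
  nrm T (fun x => Du x - gradient uh x) + width T ^ 2 * nrm T Df

theorem locErr_nonneg (Df Du : E2 → E2) (uh : E2 → ℝ) (T : Finset E2) :
    0 ≤ locErr Df Du uh T :=
  add_nonneg lpNorm_nonneg (mul_nonneg (sq_nonneg _) lpNorm_nonneg)

theorem edgeInt_congr {e : Finset E2} {F G : E2 → ℝ} (h : ∀ x ∈ hull e, F x = G x) :
    edgeInt e F = edgeInt e G :=
  setIntegral_congr_fun (isCompact_hull e).isClosed.measurableSet h

theorem edgeInt_congr_ae {e : Finset E2} {F G : E2 → ℝ} (h : F =ᵐ[edgeMeasure e] G) :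
    edgeInt e F = edgeInt e G :=
  integral_congr_ae h

theorem edgeInt_eq_zero {e : Finset E2} {F : E2 → ℝ} (h : ∀ x ∈ hull e, F x = 0) :
    edgeInt e F = 0 := by
  rw [edgeInt_congr h]; simp [edgeInt]

variable {amin amax κ : ℝ} {N : ℕ} {P : Problem} {M : TriMesh} {Df : E2 → E2}
    {u : E2 → ℝ} {Du : E2 → E2} {uh : E2 → ℝ} {φ : E2 → E2 → ℝ}
    {η : Finset E2 → Finset E2 → E2 → ℝ}

theorem Problem.mem_neumannEdges {e : Finset E2} :
    e ∈ P.neumannEdges M ↔ P.IsNeumannEdge M e := by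
  classical
  simp only [Problem.neumannEdges, Finset.mem_filter, and_iff_right_iff_imp]
  exact fun h => h.1.1

theorem openEdge_nonempty {T e : Finset E2} {p a b : E2} (h : EdgeOf T e p a b) :
    (openEdge e).Nonempty := by
  refine ⟨a + (1 / 2 : ℝ) • (b - a), h.mem_hull_iff.2 ⟨1 / 2, by norm_num, rfl⟩, ?_⟩
  intro hmem
  rw [Finset.mem_coe, h.mem_iff] at hmem
  rcases hmem with h1 | h1
  · have := h.bary_left (1 / 2)
    rw [h1, h.tri.bary_self h.ha] at this
    norm_num at this
  · have := h.bary_right (1 / 2)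
    rw [h1, h.tri.bary_self h.hb] at this
    norm_num at this

namespace Setting

variable (S : Setting amin amax κ N P M Df u Du uh φ η)
include S

theorem amax_pos : 0 < amax := S.hmin.trans_le S.hmax

theorem not_neumann_of_dirichlet {e : Finset E2} (h : P.IsDirichletEdge M e) :
    ¬ P.IsNeumannEdge M e := by
  intro hN
  obtain ⟨T, hT, he⟩ := M.mem_edges.1 h.1.1
  obtain ⟨p, a, b, hE⟩ := (M.isTriangle hT).exists_edgeOf he
  obtain ⟨x, hx⟩ := openEdge_nonempty hE
  exact Set.disjoint_left.1 S.adm.disjoint (h.2 hx) (hN.2 hx)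

theorem memLp_err : MemLp (fun x => Du x - gradient uh x) 2 (volume.restrict P.Ω) :=
  S.weak.1.1.memLp_grad.sub (S.uhP1.piecewiseSmooth.memLp_gradient S.meshed)

omit S in
theorem _root_.MeasureTheory.MemLp.restrict_elt {G : Type*} [NormedAddCommGroup G] {F : E2 → G}
    (hF : MemLp F 2 (volume.restrict P.Ω)) (hM : P.Meshed M) {T : Finset E2} (hT : T ∈ M.tri) :
    MemLp F 2 (volume.restrict (elt T)) :=
  hF.mono_measure (Measure.restrict_mono (hM.elt_subset hT) le_rfl)

theorem memLp_flux : MemLp (P.flux uh) 2 (volume.restrict P.Ω) :=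
  S.adm.memLp_mulV S.hmin subset_rfl (S.uhP1.piecewiseSmooth.memLp_gradient S.meshed)

theorem memLp_eta {T e : Finset E2} (hT : T ∈ M.tri) (he : e ∈ edgesOf T) :
    MemLp (η T e) 2 (edgeMeasure e) := (S.edgeFlux T hT).1 e he

/-- The end points of the edge need not lie in `ΓN`, but they are null for arc length. -/
theorem memLp_g {e : Finset E2} (he : P.IsNeumannEdge M e) : MemLp P.g 2 (edgeMeasure e) := by
  have hae : (hull e : Set E2) =ᵐ[Measure.hausdorffMeasure 1] openEdge e := by
    refine (sdiff_null_ae_eq_self ?_).symm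
    have := Measure.nullSingletonClass_hausdorff E2 (d := 1) zero_lt_one
    exact Set.Countable.measure_zero e.countable_toSet _
  rw [edgeMeasure, Measure.restrict_congr_set hae]
  exact S.adm.g_memLp.mono_measure (Measure.restrict_mono he.2 le_rfl)

theorem green {T : Finset E2} (hT : T ∈ M.tri) {v w : E2 → ℝ} (hw : ContDiff ℝ ∞ w)
    (hvw : Set.EqOn v w (hull T)) :
    ∫ x in elt T, inner ℝ (P.flux uh x) (gradient v x)
      = ∑ e ∈ edgesOf T, edgeInt e (fun x => η T e x * v x) := by
  have h1 := (S.edgeFlux T hT).2 w hw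
  simp only [zero_mul, integral_zero, add_zero] at h1
  have h2 : ∫ x in elt T, inner ℝ (P.flux uh x) (gradient v x)
      = ∫ x in elt T, inner ℝ (P.flux uh x) (gradient w x) :=
    setIntegral_congr_fun (isOpen_elt T).measurableSet fun x hx => by
      simp only [gradient_eq_of_eqOn_hull hvw hx]
  rw [h2, h1]
  refine Finset.sum_congr rfl fun e he => edgeInt_congr fun x hx => ?_
  rw [hvw (hull_mono (Finset.mem_powersetCard.1 he).1 hx)]

/-- The residual equation, for piecewise smooth test functions that vanish on `ΓD`. -/
theorem residual {v : E2 → ℝ} (hv : PiecewiseSmooth M v)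
    (hD : ∀ e, P.IsDirichletEdge M e → ∀ x ∈ hull e, v x = 0) :
    ∑ T ∈ M.tri, ∫ x in elt T, inner ℝ (mulV (P.A x) (Du x - gradient uh x)) (gradient v x)
      = (∑ T ∈ M.tri, ∫ x in elt T, P.f x * v x)
        + ∑ e ∈ P.neumannEdges M, edgeInt e (fun x => P.g x * v x)
        - ∑ T ∈ M.tri, ∑ e ∈ edgesOf T, edgeInt e (fun x => η T e x * v x) := by
  have hH1 := hv.memH1 S.meshed S.adm.isOpen S.adm.bounded
  have hmV : P.MemV M v (gradient v) :=
    ⟨hH1, fun T hT e he hDe => hv.hasTrace hT he fun x hx => by simp [hD e hDe x hx]⟩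
  have hweak := S.weak.2 v (gradient v) hmV (fun _ => v)
    (fun T hT e he _ => hv.hasTrace hT he fun x _ => rfl)
  have i1 : Integrable (fun x => inner ℝ (mulV (P.A x) (Du x)) (gradient v x))
      (volume.restrict P.Ω) :=
    integrable_inner_of_memLp (S.adm.memLp_mulV S.hmin subset_rfl S.weak.1.1.memLp_grad)
      hH1.memLp_grad
  have i2 : Integrable (fun x => P.f x * v x) (volume.restrict P.Ω) :=
    S.adm.f_memLp.integrable_mul hH1.memLp
  rw [S.meshed.integral_eq_sum i1, S.meshed.integral_eq_sum i2] at hweak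
  rw [← hweak, ← Finset.sum_sub_distrib]
  refine Finset.sum_congr rfl fun T hT => ?_
  obtain ⟨w, hw, hvw⟩ := hv T hT
  rw [← S.green hT hw hvw, ← integral_sub]
  · refine integral_congr_ae (ae_of_all _ fun x => ?_)
    simp only [mulV_sub, inner_sub_left]
    rfl
  · exact i1.mono_measure (Measure.restrict_mono (S.meshed.elt_subset hT) le_rfl)
  · exact integrable_inner_of_memLp (S.memLp_flux.restrict_elt S.meshed hT)
      (hH1.memLp_grad.restrict_elt S.meshed hT)

theorem nrm_bubble_le {s T : Finset E2} (hT : T ∈ M.tri) (hs : s ⊆ T) :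
    nrm T (bubble φ s) ≤ √discArea * width T ∧
      nrm T (gradient (bubble φ s)) ≤ 3 / 2 * κ * √discArea := by
  obtain ⟨c, r, hr⟩ := S.shape T hT
  have h1 : bubble φ s =ᵐ[volume.restrict (elt T)] baryProd T s :=
    ae_restrict_of_forall_mem (isOpen_elt T).measurableSet fun x hx =>
      bubble_eqOn S.basis hT hs (elt_subset_hull T hx)
  have h2 : gradient (bubble φ s) =ᵐ[volume.restrict (elt T)] gradient (baryProd T s) :=
    ae_restrict_of_forall_mem (isOpen_elt T).measurableSet fun x hx =>
      gradient_eq_of_eqOn_hull (bubble_eqOn S.basis hT hs) hx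
  have hcongr : ∀ {G : Type} [NormedAddCommGroup G] {F F' : E2 → G},
      F =ᵐ[volume.restrict (elt T)] F' → MemLp F' 2 (volume.restrict (elt T)) →
      nrm T F = nrm T F' := fun {G} _ {F F'} hF hF' => by
    rw [nrm, nrm, ← toReal_eLpNorm hF'.1, ← toReal_eLpNorm (hF'.ae_eq hF.symm).1,
      eLpNorm_congr_ae hF]
  rw [hcongr h1 (memLp_elt_of_contDiff (contDiff_baryProd T s) T),
    hcongr h2 (memLp_gradient_elt_of_contDiff (contDiff_baryProd T s) T)]
  exact ⟨hr.lpNorm_baryProd_le hs, hr.lpNorm_gradient_baryProd_le hs⟩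

theorem abs_integral_err_bubble_le {s T : Finset E2} (hT : T ∈ M.tri) (hs : s ⊆ T) :
    |∫ x in elt T, inner ℝ (mulV (P.A x) (Du x - gradient uh x)) (gradient (bubble φ s) x)|
      ≤ 3 / 2 * κ * √discArea * amax * nrm T (fun x => Du x - gradient uh x) := by
  have hsn : s ⊆ M.nodes := fun i hi => M.mem_nodes.2 ⟨T, hT, hs hi⟩
  refine (S.adm.abs_integral_mulV_le S.hmin S.hmax (S.meshed.elt_subset hT)
    (S.memLp_err.restrict_elt S.meshed hT)
    (((bubble_piecewiseSmooth S.basis hsn).memLp_gradient S.meshed).restrict_elt S.meshed hT)).trans ?_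
  have h0 : 0 ≤ amax * nrm T (fun x => Du x - gradient uh x) :=
    mul_nonneg S.amax_pos.le lpNorm_nonneg
  calc _ ≤ amax * nrm T (fun x => Du x - gradient uh x) * (3 / 2 * κ * √discArea) :=
        mul_le_mul_of_nonneg_left (S.nrm_bubble_le hT hs).2 h0
    _ = _ := by ring

theorem memLp_bubble {s T : Finset E2} (hT : T ∈ M.tri) (hs : s ⊆ T) :
    MemLp (bubble φ s) 2 (volume.restrict (elt T)) :=
  (memLp_elt_of_contDiff (contDiff_baryProd T s) T).ae_eq
    (ae_restrict_of_forall_mem (isOpen_elt T).measurableSet fun x hx =>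
      (bubble_eqOn S.basis hT hs (elt_subset_hull T hx)).symm)

theorem abs_integral_mul_bubble_le {s T : Finset E2} (hT : T ∈ M.tri) (hs : s ⊆ T) {F : E2 → ℝ}
    (hF : MemLp F 2 (volume.restrict (elt T))) :
    |∫ x in elt T, F x * bubble φ s x| ≤ √discArea * width T * nrm T F := by
  refine (abs_integral_mul_le hF (S.memLp_bubble hT hs)).trans ?_
  rw [mul_comm]
  exact mul_le_mul_of_nonneg_right (S.nrm_bubble_le hT hs).1 lpNorm_nonneg

end Setting

/-! ### Bounds for the residual by the error -/

/-- The Poincaré inequality for a smooth approximation of f. The constant c depends on the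
approximation, so an arbitrarily small excess δ is allowed instead of passing to the limit. -/
theorem MemH1.exists_nrm_sub_const_le {T : Finset E2} (hne : (elt T).Nonempty) {f : E2 → ℝ}
    {Df : E2 → E2} (hf : MemH1 (elt T) f Df) {δ : ℝ} (hδ : 0 < δ) :
    ∃ c : ℝ, nrm T (fun x => f x - c) ≤ 2 * width T * nrm T Df + δ := by
  have hh := width_nonneg T
  set ε : ℝ := δ / (1 + 2 * width T) with hε
  have hεp : 0 < ε := by positivity
  obtain ⟨w, hw, h1, h2⟩ := hf.exists_smooth_approx (isOpen_elt T) (convex_elt T) (isBounded_elt T)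
    hne (ε := ENNReal.ofReal ε) (by simpa using hεp)
  obtain ⟨c, hc⟩ := exists_lpNorm_sub_const_le (isOpen_elt T) (convex_elt T) (isBounded_elt T) hne hw
  have mw := memLp_elt_of_contDiff hw T
  have mg := memLp_gradient_elt_of_contDiff hw T
  have m1 : MemLp (fun x => w x - f x) 2 (volume.restrict (elt T)) := mw.sub hf.memLp
  have m2 : MemLp (fun x => gradient w x - Df x) 2 (volume.restrict (elt T)) :=
    mg.sub hf.memLp_grad
  have n1 : nrm T (fun x => w x - f x) ≤ ε := by
    rw [nrm, ← toReal_eLpNorm m1.1]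
    exact ENNReal.toReal_le_of_le_ofReal hεp.le h1
  have n2 : nrm T (fun x => gradient w x - Df x) ≤ ε := by
    rw [nrm, ← toReal_eLpNorm m2.1]
    exact ENNReal.toReal_le_of_le_ofReal hεp.le h2
  have n3 : nrm T (gradient w) ≤ nrm T Df + ε := by
    have := lpNorm_add_le (f := Df) (g := fun x => gradient w x - Df x) hf.memLp_grad
      (p := 2) (by norm_num)
    have e1 : Df + (fun x => gradient w x - Df x) = gradient w := by ext1 x; simp
    rw [e1] at this
    exact this.trans (by gcongr)
  refine ⟨c, ?_⟩
  have mc : MemLp (fun x => w x - c) 2 (volume.restrict (elt T)) := mw.sub (memLp_const c)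
  have n4 := lpNorm_sub_le (f := fun x => w x - c) (g := fun x => w x - f x) mc (p := 2) (by norm_num)
  have e2 : (fun x => w x - c) - (fun x => w x - f x) = fun x => f x - c := by
    ext1 x; simp
  rw [e2] at n4
  have n5 : 2 * Metric.diam (elt T) * nrm T (gradient w) ≤ 2 * width T * (nrm T Df + ε) := by
    have := diam_elt_le T
    have : 0 ≤ nrm T (gradient w) := lpNorm_nonneg
    gcongr
  have hδε : ε + 2 * width T * ε = δ := by rw [hε]; field_simp
  calc nrm T (fun x => f x - c) ≤ nrm T (fun x => w x - c) + nrm T (fun x => w x - f x) := n4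
    _ ≤ 2 * width T * (nrm T Df + ε) + ε := add_le_add (hc.trans n5) n1
    _ = _ := by rw [← hδε]; ring

/-- Constant in the bound of the load by the error. -/
def loadConst (amax κ : ℝ) : ℝ := 2 + 64 * κ ^ 5 + 48 * κ ^ 6 * amax

/-- Constant in the bound of the flux jumps by the error. -/
def jumpBound (amax κ : ℝ) : ℝ := 6 * (√discArea * (loadConst amax κ + 3 / 2 * κ * amax))

variable {amin amax κ : ℝ} {N : ℕ} {P : Problem} {M : TriMesh} {Df : E2 → E2}
    {u : E2 → ℝ} {Du : E2 → E2} {uh : E2 → ℝ} {φ : E2 → E2 → ℝ}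
    {η : Finset E2 → Finset E2 → E2 → ℝ}

namespace Setting

variable (S : Setting amin amax κ N P M Df u Du uh φ η)
include S

theorem memLp_f {T : Finset E2} (hT : T ∈ M.tri) : MemLp P.f 2 (volume.restrict (elt T)) :=
  S.adm.f_memLp.restrict_elt S.meshed hT

theorem kappa_pos : 0 < κ := by
  obtain ⟨T, hT⟩ := M.nonempty
  obtain ⟨c, r, h⟩ := S.shape T hT
  exact h.kappa_pos

theorem loadConst_pos : 0 < loadConst amax κ := by
  have := S.kappa_pos
  have := S.amax_pos
  unfold loadConst; positivity

theorem jumpBound_pos : 0 < jumpBound amax κ := by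
  have := S.kappa_pos
  have := S.amax_pos
  have := S.loadConst_pos
  have := discArea_pos
  unfold jumpBound; positivity

/-- The element bubble vanishes on every edge and outside T, so all edge terms of the residual
disappear. Since q_h is divergence free in T, the element residual that remains is f alone. -/
theorem integral_err_bubble_self {T : Finset E2} (hT : T ∈ M.tri) :
    ∫ x in elt T, inner ℝ (mulV (P.A x) (Du x - gradient uh x)) (gradient (bubble φ T) x)
      = ∫ x in elt T, P.f x * bubble φ T x := by
  have hsn : T ⊆ M.nodes := fun i hi => M.mem_nodes.2 ⟨T, hT, hi⟩
  have hedge : ∀ T' ∈ M.tri, ∀ e ∈ edgesOf T', ∀ x ∈ hull e, bubble φ T x = 0 := by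
    intro T' hT' e he
    refine bubble_eq_zero_on_edge S.basis hsn hT' he fun hsub => ?_
    have := Finset.card_le_card hsub
    rw [M.card_eq T hT, (Finset.mem_powersetCard.1 he).2] at this
    omega
  have hel : ∀ T' ∈ M.tri, T' ≠ T → ∀ x ∈ hull T', bubble φ T x = 0 := by
    intro T' hT' hne
    refine bubble_eq_zero S.basis hsn hT' fun hsub => hne ?_
    exact (Finset.eq_of_subset_of_card_le hsub (by rw [M.card_eq T hT, M.card_eq T' hT'])).symm
  have hres := S.residual (bubble_piecewiseSmooth S.basis hsn) (fun e hD => by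
    obtain ⟨T', hT', he⟩ := M.mem_edges.1 hD.1.1
    exact hedge T' hT' e he)
  have hN : ∑ e ∈ P.neumannEdges M, edgeInt e (fun x => P.g x * bubble φ T x) = 0 := by
    refine Finset.sum_eq_zero fun e he => edgeInt_eq_zero fun x hx => ?_
    obtain ⟨T', hT', he'⟩ := M.mem_edges.1 (Problem.mem_neumannEdges.1 he).1.1
    rw [hedge T' hT' e he' x hx, mul_zero]
  have hη : ∑ T' ∈ M.tri, ∑ e ∈ edgesOf T', edgeInt e (fun x => η T' e x * bubble φ T x) = 0 :=
    Finset.sum_eq_zero fun T' hT' => Finset.sum_eq_zero fun e he => edgeInt_eq_zero fun x hx => by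
      rw [hedge T' hT' e he x hx, mul_zero]
  rw [hN, hη, Finset.sum_eq_single_of_mem T hT, Finset.sum_eq_single_of_mem T hT] at hres
  · simpa using hres
  · intro T' hT' hne
    refine (setIntegral_congr_fun (isOpen_elt T').measurableSet fun x hx => ?_).trans
      (integral_zero _ _)
    simp [hel T' hT' hne x (elt_subset_hull T' hx)]
  · intro T' hT' hne
    refine (setIntegral_congr_fun (isOpen_elt T').measurableSet fun x hx => ?_).trans
      (integral_zero _ _)
    have : gradient (bubble φ T) x = gradient (fun _ => (0 : ℝ)) x :=
      gradient_eq_of_eqOn_hull (fun y hy => hel T' hT' hne y hy) hx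
    show inner ℝ _ (gradient (bubble φ T) x) = 0
    rw [this]; simp [gradient]

/-- The load is bounded by the error and the oscillation of the data. -/
theorem width_mul_nrm_f_le {T : Finset E2} (hT : T ∈ M.tri) :
    width T * nrm T P.f ≤ loadConst amax κ * locErr Df Du uh T := by
  obtain ⟨c₀, r, hr⟩ := S.shape T hT
  have hκ := S.kappa_pos
  have ha := S.amax_pos
  have hr0 := hr.pos
  have hh := width_nonneg T
  have hπ := discArea_pos
  set s := √discArea with hs
  have hs0 : 0 < s := Real.sqrt_pos.2 hπ
  have hs2 : s ^ 2 = discArea := Real.sq_sqrt hπ.le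
  set D := nrm T (fun x => Du x - gradient uh x) with hD
  have hD0 : 0 ≤ D := lpNorm_nonneg
  set G := nrm T Df with hG
  have hG0 : 0 ≤ G := lpNorm_nonneg
  have hf := S.memLp_f hT
  -- Testing with the bubble controls a constant load c, because |c| times the integral of the
  -- bubble is at least of order |c| r². The error and f - c bound the same quantity from above. The
  -- factor 32 κ⁵ converts the lower bound on the integral of the bubble into κ² r², which dominates
  -- the squared width.
  have key : ∀ c : ℝ, width T * nrm T P.f
      ≤ (1 + 32 * κ ^ 5) * (width T * nrm T (fun x => P.f x - c)) + 48 * κ ^ 6 * amax * D := by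
    intro c
    have hfc : MemLp (fun x => P.f x - c) 2 (volume.restrict (elt T)) := hf.sub (memLp_const c)
    set F := nrm T (fun x => P.f x - c) with hF
    have hF0 : 0 ≤ F := lpNorm_nonneg
    have hb := S.memLp_bubble hT (subset_refl T)
    have e1 : c * ∫ x in elt T, bubble φ T x
        = (∫ x in elt T, inner ℝ (mulV (P.A x) (Du x - gradient uh x)) (gradient (bubble φ T) x))
          - ∫ x in elt T, (P.f x - c) * bubble φ T x := by
      rw [S.integral_err_bubble_self hT, ← integral_const_mul, ← integral_sub]
      · exact integral_congr_ae (ae_of_all _ fun x => by ring)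
      · exact hf.integrable_mul hb
      · exact hfc.integrable_mul hb
    have e2 : ∫ x in elt T, bubble φ T x = ∫ x in elt T, baryProd T T x :=
      setIntegral_congr_fun (isOpen_elt T).measurableSet fun x hx =>
        bubble_eqOn S.basis hT subset_rfl (elt_subset_hull T hx)
    have e3 := hr.integral_baryProd_ge
    have e4 : |c| * (discArea / (32 * κ ^ 3) * r ^ 2) ≤ 3 / 2 * κ * s * amax * D + s * width T * F := by
      have a1 : |c| * (discArea / (32 * κ ^ 3) * r ^ 2) ≤ |c * ∫ x in elt T, bubble φ T x| := by
        rw [abs_mul, e2]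
        exact mul_le_mul_of_nonneg_left (e3.trans (le_abs_self _)) (abs_nonneg c)
      refine a1.trans ?_
      rw [e1]
      exact (abs_sub _ _).trans (add_le_add (S.abs_integral_err_bubble_le hT subset_rfl)
        (S.abs_integral_mul_bubble_le hT subset_rfl hfc))
    have e5 : nrm T P.f ≤ F + |c| * (s * width T) := by
      have := lpNorm_add_le (f := fun x => P.f x - c) (g := fun _ => c) hfc (p := 2) (by norm_num)
      have e6 : (fun x => P.f x - c) + (fun _ => c) = P.f := by ext1 x; simp
      rw [e6] at this
      refine this.trans (add_le_add le_rfl ?_)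
      refine (lpNorm_two_le_of_bound (abs_nonneg c) (ae_of_all _ fun x => le_rfl)).trans ?_
      rw [measureReal_restrict_apply_univ]
      exact mul_le_mul_of_nonneg_left hr.sqrt_volume_le (abs_nonneg c)
    have e7 : width T ^ 2 ≤ κ ^ 2 * r ^ 2 := by
      rw [← mul_pow]; exact pow_le_pow_left₀ hh hr.diam 2
    have e8 : |c| * s * (κ ^ 2 * r ^ 2)
        ≤ 32 * κ ^ 5 * (width T * F) + 48 * κ ^ 6 * amax * D := by
      have b1 : |c| * s * (κ ^ 2 * r ^ 2)
          = (32 * κ ^ 5 / s) * (|c| * (discArea / (32 * κ ^ 3) * r ^ 2)) := by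
        rw [← hs2]; field_simp
      have b2 : (32 * κ ^ 5 / s) * (3 / 2 * κ * s * amax * D + s * width T * F)
          = 32 * κ ^ 5 * (width T * F) + 48 * κ ^ 6 * amax * D := by
        field_simp; ring
      rw [b1, ← b2]
      exact mul_le_mul_of_nonneg_left e4 (by positivity)
    calc width T * nrm T P.f ≤ width T * (F + |c| * (s * width T)) :=
          mul_le_mul_of_nonneg_left e5 hh
      _ = width T * F + |c| * s * width T ^ 2 := by ring
      _ ≤ width T * F + |c| * s * (κ ^ 2 * r ^ 2) := by gcongr
      _ ≤ _ := by linarith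
  have hle : width T * nrm T P.f
      ≤ (1 + 32 * κ ^ 5) * (width T * (2 * width T * G)) + 48 * κ ^ 6 * amax * D := by
    -- The constant c may change with the excess δ, because `key` holds for every c. The excess is
    -- divided by its total weight so that it sums to at most δ.
    refine le_of_forall_pos_le_add fun δ hδ => ?_
    have hfT : MemH1 (elt T) P.f Df := S.fH1.mono (S.meshed.elt_subset hT)
    obtain ⟨c, hc⟩ := hfT.exists_nrm_sub_const_le hr.elt_nonempty
      (δ := δ / ((1 + 32 * κ ^ 5) * width T + 1)) (by positivity)
    refine (key c).trans ?_
    have : (1 + 32 * κ ^ 5) * (width T * nrm T (fun x => P.f x - c))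
        ≤ (1 + 32 * κ ^ 5) * (width T * (2 * width T * G + δ / ((1 + 32 * κ ^ 5) * width T + 1))) := by
      gcongr
    have h2 : (1 + 32 * κ ^ 5) * width T * (δ / ((1 + 32 * κ ^ 5) * width T + 1)) ≤ δ := by
      rw [mul_div_assoc', div_le_iff₀ (by positivity)]
      nlinarith
    nlinarith
  refine hle.trans ?_
  unfold loadConst locErr
  rw [← hD, ← hG]
  have p1 : 0 ≤ (2 + 64 * κ ^ 5) * D := by positivity
  have p2 : 0 ≤ 48 * κ ^ 6 * amax * (width T ^ 2 * G) := by positivity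
  nlinarith

omit S in
theorem eq_of_subset_edge {T e e' : Finset E2} (he : e ∈ M.edges) (he' : e' ∈ edgesOf T)
    (hsub : e ⊆ e') : e = e' := by
  obtain ⟨T', -, h⟩ := M.mem_edges.1 he
  exact Finset.eq_of_subset_of_card_le hsub
    (by rw [(Finset.mem_powersetCard.1 he').2, (Finset.mem_powersetCard.1 h).2])

/-- The edge bubble vanishes on all other edges and outside the triangles adjacent to e, so it
isolates the flux jump on e. On a Dirichlet edge it would not be an admissible test function. -/
theorem residual_edge_bubble {e : Finset E2} (he : e ∈ M.edges) (hD : ¬ P.IsDirichletEdge M e) :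
    (∑ T ∈ M.adj e, edgeInt e (fun x => η T e x * bubble φ e x))
        - (if e ∈ P.neumannEdges M then edgeInt e (fun x => P.g x * bubble φ e x) else 0)
      = ∑ T ∈ M.adj e, ((∫ x in elt T, P.f x * bubble φ e x) - ∫ x in elt T,
          inner ℝ (mulV (P.A x) (Du x - gradient uh x)) (gradient (bubble φ e) x)) := by
  classical
  have hsn : e ⊆ M.nodes := by
    obtain ⟨T, hT, h⟩ := M.mem_edges.1 he
    exact fun i hi => M.mem_nodes.2 ⟨T, hT, (Finset.mem_powersetCard.1 h).1 hi⟩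
  have hedge : ∀ T' ∈ M.tri, ∀ e' ∈ edgesOf T', e' ≠ e → ∀ x ∈ hull e', bubble φ e x = 0 := by
    intro T' hT' e' he' hne
    exact bubble_eq_zero_on_edge S.basis hsn hT' he'
      fun hsub => hne (eq_of_subset_edge he he' hsub).symm
  have hel : ∀ T ∈ M.tri, T ∉ M.adj e → ∀ x ∈ hull T, bubble φ e x = 0 := by
    intro T hT hn
    exact bubble_eq_zero S.basis hsn hT fun hsub => hn (M.mem_adj.2 ⟨hT, hsub⟩)
  have hadj : M.adj e ⊆ M.tri := fun T hT => (M.mem_adj.1 hT).1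
  have hres := S.residual (bubble_piecewiseSmooth S.basis hsn) (fun e' hD' => by
    obtain ⟨T', hT', he'⟩ := M.mem_edges.1 hD'.1.1
    exact hedge T' hT' e' he' (by rintro rfl; exact hD hD'))
  have h1 : ∑ T ∈ M.tri, ∫ x in elt T,
        inner ℝ (mulV (P.A x) (Du x - gradient uh x)) (gradient (bubble φ e) x)
      = ∑ T ∈ M.adj e, ∫ x in elt T,
        inner ℝ (mulV (P.A x) (Du x - gradient uh x)) (gradient (bubble φ e) x) := by
    refine (Finset.sum_subset hadj fun T hT hn => ?_).symm
    refine (setIntegral_congr_fun (isOpen_elt T).measurableSet fun x hx => ?_).trans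
      (integral_zero _ _)
    have : gradient (bubble φ e) x = gradient (fun _ => (0 : ℝ)) x :=
      gradient_eq_of_eqOn_hull (fun y hy => hel T hT hn y hy) hx
    show inner ℝ _ (gradient (bubble φ e) x) = 0
    rw [this]; simp [gradient]
  have h2 : ∑ T ∈ M.tri, ∫ x in elt T, P.f x * bubble φ e x
      = ∑ T ∈ M.adj e, ∫ x in elt T, P.f x * bubble φ e x := by
    refine (Finset.sum_subset hadj fun T hT hn => ?_).symm
    refine (setIntegral_congr_fun (isOpen_elt T).measurableSet fun x hx => ?_).trans
      (integral_zero _ _)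
    simp [hel T hT hn x (elt_subset_hull T hx)]
  have h3 : ∑ T ∈ M.tri, ∑ e' ∈ edgesOf T, edgeInt e' (fun x => η T e' x * bubble φ e x)
      = ∑ T ∈ M.adj e, edgeInt e (fun x => η T e x * bubble φ e x) := by
    have : ∀ T ∈ M.tri, ∑ e' ∈ edgesOf T, edgeInt e' (fun x => η T e' x * bubble φ e x)
        = if T ∈ M.adj e then edgeInt e (fun x => η T e x * bubble φ e x) else 0 := by
      intro T hT
      split_ifs with hTe
      · refine Finset.sum_eq_single_of_mem e ((M.mem_edgesOf_iff he).2 (M.mem_adj.1 hTe).2)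
          fun e' he' hne => edgeInt_eq_zero fun x hx => ?_
        rw [hedge T hT e' he' hne x hx, mul_zero]
      · refine Finset.sum_eq_zero fun e' he' => edgeInt_eq_zero fun x hx => ?_
        rw [hel T hT hTe x (hull_mono (Finset.mem_powersetCard.1 he').1 hx), mul_zero]
    rw [Finset.sum_congr rfl this, Finset.sum_ite_mem, Finset.inter_eq_right.2 hadj]
  have h4 : ∑ e' ∈ P.neumannEdges M, edgeInt e' (fun x => P.g x * bubble φ e x)
      = if e ∈ P.neumannEdges M then edgeInt e (fun x => P.g x * bubble φ e x) else 0 := by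
    rw [← Finset.sum_ite_eq' (P.neumannEdges M) e
      (fun e' => edgeInt e' (fun x => P.g x * bubble φ e x))]
    refine Finset.sum_congr rfl fun e' he' => ?_
    split_ifs with h
    · rfl
    · obtain ⟨T', hT', he''⟩ := M.mem_edges.1 (Problem.mem_neumannEdges.1 he').1.1
      exact edgeInt_eq_zero fun x hx => by rw [hedge T' hT' e' he'' h x hx, mul_zero]
  rw [h1, h2, h3, h4] at hres
  rw [Finset.sum_sub_distrib]
  linarith

omit S in
theorem integrable_mul_bubble {T e : Finset E2} (hφ : M.IsNodalBasis φ) (hT : T ∈ M.tri)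
    (he : e ∈ edgesOf T) {F : E2 → ℝ} (hF : MemLp F 2 (edgeMeasure e)) :
    Integrable (fun x => F x * bubble φ e x) (edgeMeasure e) := by
  have heT := (Finset.mem_powersetCard.1 he).1
  obtain ⟨p, a, b, h⟩ := (M.isTriangle hT).exists_edgeOf he
  have hb : MemLp (bubble φ e) 2 (edgeMeasure e) :=
    (h.memLp (contDiff_baryProd T e).continuous).ae_eq <| by
      filter_upwards [ae_mem_hull e] with x hx
      exact (bubble_eqOn hφ hT heT (hull_mono heT hx)).symm
  exact hF.integrable_mul hb

theorem edgeInt_bubble {T e : Finset E2} (hT : T ∈ M.tri) (he : e ∈ edgesOf T) :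
    edgeInt e (bubble φ e) = len e / 6 := by
  obtain ⟨p, a, b, h⟩ := (M.isTriangle hT).exists_edgeOf he
  have heT := (Finset.mem_powersetCard.1 he).1
  rw [← h.edgeInt_bary_mul_bary]
  refine edgeInt_congr fun x hx => ?_
  rw [bubble_eqOn S.basis hT heT (hull_mono heT hx), baryProd]
  classical
  have : e = {a, b} := by ext y; simp [h.mem_iff]
  rw [this, Finset.prod_pair h.hab]

/-- A constant jump of the normal flux across an edge is bounded by the error nearby. -/
theorem abs_jump_mul_len_le {e : Finset E2} (he : e ∈ M.edges) (hD : ¬ P.IsDirichletEdge M e)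
    {J : ℝ} (hJ : ∀ᵐ x ∂(edgeMeasure e), (∑ T ∈ M.adj e, η T e x)
      - (if e ∈ P.neumannEdges M then P.g x else 0) = J) :
    |J| * len e ≤ jumpBound amax κ * ∑ T ∈ M.adj e, locErr Df Du uh T := by
  classical
  obtain ⟨T₀, hT₀, he₀⟩ := M.mem_edges.1 he
  have hκ := S.kappa_pos
  have ha := S.amax_pos
  have hL := S.loadConst_pos
  -- The constant jump comes out of the integral, and the edge bubble has integral `len e / 6`. This
  -- is the source of the 6 in `jumpBound`.
  have key : J * (len e / 6) = ∑ T ∈ M.adj e, ((∫ x in elt T, P.f x * bubble φ e x)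
      - ∫ x in elt T, inner ℝ (mulV (P.A x) (Du x - gradient uh x)) (gradient (bubble φ e) x)) := by
    rw [← S.residual_edge_bubble he hD, ← S.edgeInt_bubble hT₀ he₀, edgeInt,
      ← integral_const_mul]
    have hi : ∀ T ∈ M.adj e, Integrable (fun x => η T e x * bubble φ e x) (edgeMeasure e) :=
      fun T hT => integrable_mul_bubble S.basis hT₀ he₀
        (S.memLp_eta (M.mem_adj.1 hT).1 ((M.mem_edgesOf_iff he).2 (M.mem_adj.1 hT).2))
    have hcong : (fun x => J * bubble φ e x) =ᵐ[edgeMeasure e] fun x =>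
        (∑ T ∈ M.adj e, η T e x * bubble φ e x)
          - (if e ∈ P.neumannEdges M then P.g x * bubble φ e x else 0) := by
      filter_upwards [hJ] with x hx
      rw [← hx, sub_mul, Finset.sum_mul, ite_mul, zero_mul]
    have h1 := edgeInt_congr_ae hcong
    rw [edgeInt, edgeInt] at h1
    rw [h1]
    by_cases hN : e ∈ P.neumannEdges M
    · simp only [if_pos hN]
      rw [integral_sub (integrable_finsetSum _ hi) (integrable_mul_bubble S.basis hT₀ he₀
        (S.memLp_g (Problem.mem_neumannEdges.1 hN))), integral_finsetSum _ hi]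
      rfl
    · simp only [if_neg hN, sub_zero]
      rw [integral_finsetSum _ hi]
      rfl
  have hlen : 0 ≤ len e := Metric.diam_nonneg
  have h6 : |J| * len e = 6 * |J * (len e / 6)| := by
    rw [abs_mul, abs_of_nonneg (by positivity : 0 ≤ len e / 6)]; ring
  rw [h6, key, jumpBound, mul_assoc, Finset.mul_sum]
  refine mul_le_mul_of_nonneg_left ((Finset.abs_sum_le_sum_abs _ _).trans
    (Finset.sum_le_sum fun T hT => ?_)) (by norm_num)
  have hTt := (M.mem_adj.1 hT).1
  have hsub := (M.mem_adj.1 hT).2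
  refine (abs_sub _ _).trans ?_
  have b1 := S.abs_integral_mul_bubble_le hTt hsub (S.memLp_f hTt)
  have b2 := S.abs_integral_err_bubble_le hTt hsub
  have b3 := S.width_mul_nrm_f_le hTt
  have b4 : nrm T (fun x => Du x - gradient uh x) ≤ locErr Df Du uh T :=
    le_add_of_nonneg_right (mul_nonneg (sq_nonneg _) lpNorm_nonneg)
  have hs := Real.sqrt_nonneg discArea
  calc _ ≤ √discArea * width T * nrm T P.f
        + 3 / 2 * κ * √discArea * amax * nrm T (fun x => Du x - gradient uh x) := add_le_add b1 b2
    _ = √discArea * (width T * nrm T P.f)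
        + 3 / 2 * κ * √discArea * amax * nrm T (fun x => Du x - gradient uh x) := by ring
    _ ≤ √discArea * (loadConst amax κ * locErr Df Du uh T)
        + 3 / 2 * κ * √discArea * amax * locErr Df Du uh T := by gcongr
    _ = _ := by ring

end Setting

/-! ### Bounded solutions of sign systems, and comparison along paths -/

/-- L has a linear right inverse on its range, which is bounded because the dimension is finite.
Starting from L x keeps the right side in the range. -/
theorem _root_.LinearMap.exists_bounded_preimage {ι κ : Type*} [Fintype ι] [Fintype κ]
    (L : (ι → ℝ) →ₗ[ℝ] (κ → ℝ)) :
    ∃ C : ℝ, 0 ≤ C ∧ ∀ x, ∃ y, L y = L x ∧ ‖y‖ ≤ C * ‖L x‖ := by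
  obtain ⟨g, hg⟩ := L.rangeRestrict.exists_rightInverse_of_surjective L.range_rangeRestrict
  refine ⟨‖LinearMap.toContinuousLinearMap g‖, ContinuousLinearMap.opNorm_nonneg _, fun x => ?_⟩
  refine ⟨g ⟨L x, LinearMap.mem_range_self L x⟩, ?_, ?_⟩
  · exact congrArg Subtype.val (LinearMap.congr_fun hg ⟨L x, LinearMap.mem_range_self L x⟩)
  · exact (LinearMap.toContinuousLinearMap g).le_opNorm ⟨L x, LinearMap.mem_range_self L x⟩

/-- There are finitely many sign matrices of a given size, and the sum of their constants serves all
of them. Thus the stability of the node systems depends on the number of triangles at a vertex and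
not on their geometry. -/
theorem exists_signSystem_const (n m : ℕ) :
    ∃ C : ℝ, 0 ≤ C ∧ ∀ (s : Fin n → Fin m → SignType) (x : Fin m → ℝ) (B : ℝ), 0 ≤ B →
      (∀ i, |∑ j, (s i j : ℝ) * x j| ≤ B) →
      ∃ y : Fin m → ℝ, (∀ i, ∑ j, (s i j : ℝ) * y j = ∑ j, (s i j : ℝ) * x j) ∧
        ∀ j, |y j| ≤ C * B := by
  have h := fun s : Fin n → Fin m → SignType =>
    (Matrix.toLin' (Matrix.of fun i j => (s i j : ℝ))).exists_bounded_preimage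
  choose C hC hL using h
  refine ⟨∑ s, C s, Finset.sum_nonneg fun s _ => hC s, fun s x B hB hx => ?_⟩
  obtain ⟨y, h1, h2⟩ := hL s x
  have happ : ∀ z : Fin m → ℝ, ∀ i, Matrix.toLin' (Matrix.of fun i j => (s i j : ℝ)) z i
      = ∑ j, (s i j : ℝ) * z j := fun z i => by
    simp [Matrix.toLin'_apply, Matrix.mulVec, dotProduct]
  refine ⟨y, fun i => ?_, fun j => ?_⟩
  · rw [← happ, ← happ, h1]
  · have h3 : ‖Matrix.toLin' (Matrix.of fun i j => (s i j : ℝ)) x‖ ≤ B :=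
      (pi_norm_le_iff_of_nonneg hB).2 fun i => by rw [happ]; exact hx i
    calc |y j| ≤ ‖y‖ := norm_le_pi_norm y j
      _ ≤ C s * ‖Matrix.toLin' (Matrix.of fun i j => (s i j : ℝ)) x‖ := h2
      _ ≤ C s * B := mul_le_mul_of_nonneg_left h3 (hC s)
      _ ≤ (∑ s, C s) * B := mul_le_mul_of_nonneg_right
          (Finset.single_le_sum (fun s _ => hC s) (Finset.mem_univ s)) hB

/-- Solvable linear systems with coefficients `0`, `1`, `-1` and bounded size have solutions that are
uniformly bounded by the right-hand side. -/
theorem exists_signSystem_const_of_card_le (n m : ℕ) :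
    ∃ C : ℝ, 0 ≤ C ∧ ∀ {τ ε : Type} (R : Finset τ) (X : Finset ε), R.card ≤ n → X.card ≤ m →
      ∀ (s : τ → ε → SignType) (x : ε → ℝ) (B : ℝ), 0 ≤ B →
      (∀ i ∈ R, |∑ j ∈ X, (s i j : ℝ) * x j| ≤ B) →
      ∃ y : ε → ℝ, (∀ i ∈ R, ∑ j ∈ X, (s i j : ℝ) * y j = ∑ j ∈ X, (s i j : ℝ) * x j) ∧
        ∀ j ∈ X, |y j| ≤ C * B := by
  classical
  choose C hC hS using exists_signSystem_const
  refine ⟨∑ k ∈ Finset.range (n + 1), ∑ l ∈ Finset.range (m + 1), C k l,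
    Finset.sum_nonneg fun k _ => Finset.sum_nonneg fun l _ => hC k l, ?_⟩
  intro τ ε R X hR hX s x B hB hx
  have hsum : ∀ F : ε → ℝ, ∑ j : Fin X.card, F (X.equivFin.symm j) = ∑ j ∈ X, F j := fun F => by
    rw [Equiv.sum_comp X.equivFin.symm (fun j : X => F j), Finset.sum_coe_sort X F]
  obtain ⟨y, h1, h2⟩ := hS R.card X.card (fun i j => s (R.equivFin.symm i) (X.equivFin.symm j))
    (fun j => x (X.equivFin.symm j)) B hB (fun i => by
      rw [hsum fun j => (s (R.equivFin.symm i) j : ℝ) * x j]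
      exact hx _ (R.equivFin.symm i).2)
  set z : ε → ℝ := fun e => if h : e ∈ X then y (X.equivFin ⟨e, h⟩) else 0 with hz
  have hzy : ∀ j, z (X.equivFin.symm j) = y j := fun j => by simp [hz]
  refine ⟨z, fun i hi => ?_, fun j hj => ?_⟩
  · have := h1 (R.equivFin ⟨i, hi⟩)
    simp only [Equiv.symm_apply_apply] at this
    rw [← hsum fun j => (s i j : ℝ) * z j, ← hsum fun j => (s i j : ℝ) * x j, ← this]
    simp only [hzy]
  · have h3 := h2 (X.equivFin ⟨j, hj⟩)
    have h4 : z j = y (X.equivFin ⟨j, hj⟩) := by simp [hz, hj]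
    rw [h4]
    refine h3.trans (mul_le_mul_of_nonneg_right ?_ hB)
    calc C R.card X.card ≤ ∑ l ∈ Finset.range (m + 1), C R.card l :=
          Finset.single_le_sum (fun l _ => hC R.card l) (Finset.mem_range.2 (by omega))
      _ ≤ _ := Finset.single_le_sum (f := fun k => ∑ l ∈ Finset.range (m + 1), C k l)
          (fun k _ => Finset.sum_nonneg fun l _ => hC k l) (Finset.mem_range.2 (by omega))

theorem _root_.SimpleGraph.Walk.le_pow_length_mul {V : Type*} {G : SimpleGraph V} {F : V → ℝ} {K : ℝ}
    (hK : 0 ≤ K) (hF : ∀ a b, G.Adj a b → F a ≤ K * F b) {a b : V} (w : G.Walk a b) :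
    F a ≤ K ^ w.length * F b := by
  induction w with
  | nil => simp
  | cons h w ih =>
    rw [SimpleGraph.Walk.length_cons, pow_succ', mul_assoc]
    exact (hF _ _ h).trans (mul_le_mul_of_nonneg_left ih hK)

/-- Each step of a path costs a factor K. A path without repeated vertices that stays in s has fewer
steps than s has elements. -/
theorem _root_.SimpleGraph.Reachable.le_pow_card_mul {V : Type*} {G : SimpleGraph V} {F : V → ℝ}
    {K : ℝ} (hK : 1 ≤ K) (hF0 : ∀ a, 0 ≤ F a) (hF : ∀ a b, G.Adj a b → F a ≤ K * F b)
    {s : Finset V} (hs : ∀ a b, G.Adj a b → a ∈ s) {a b : V} (hb : b ∈ s) (h : G.Reachable a b) :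
    F a ≤ K ^ s.card * F b := by
  classical
  obtain ⟨p, hp⟩ := h.exists_isPath
  have hsub : ∀ {c d : V} (w : G.Walk c d), d ∈ s → ∀ v ∈ w.support, v ∈ s := by
    intro c d w hd
    induction w with
    | nil => simpa using hd
    | cons h w ih =>
      intro v hv
      rw [SimpleGraph.Walk.support_cons, List.mem_cons] at hv
      rcases hv with rfl | hv
      · exact hs _ _ h
      · exact ih hd v hv
  have hlen : p.length ≤ s.card := by
    have h1 : p.support.toFinset ⊆ s := fun v hv => hsub p hb v (List.mem_toFinset.1 hv)
    have h2 := Finset.card_le_card h1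
    rw [List.toFinset_card_of_nodup hp.support_nodup, SimpleGraph.Walk.length_support] at h2
    omega
  calc F a ≤ K ^ p.length * F b := p.le_pow_length_mul (by linarith) hF
    _ ≤ K ^ s.card * F b := mul_le_mul_of_nonneg_right (pow_le_pow_right₀ hK hlen) (hF0 b)

/-! ### The node systems -/

/-- Sum of the local errors over the triangles around a vertex. -/
def patchErr (M : TriMesh) (Df Du : E2 → E2) (uh : E2 → ℝ) (i : E2) : ℝ :=
  ∑ T ∈ M.patch i, locErr Df Du uh T

theorem patchErr_nonneg (M : TriMesh) (Df Du : E2 → E2) (uh : E2 → ℝ) (i : E2) :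
    0 ≤ patchErr M Df Du uh i :=
  Finset.sum_nonneg fun _ _ => locErr_nonneg _ _ _ _

variable {amin amax κ : ℝ} {N : ℕ} {P : Problem} {M : TriMesh} {Df : E2 → E2}
    {u : E2 → ℝ} {Du : E2 → E2} {uh : E2 → ℝ} {φ : E2 → E2 → ℝ}
    {η : Finset E2 → Finset E2 → E2 → ℝ}

theorem TriMesh.adj_subset_patch {e : Finset E2} {i : E2} (hi : i ∈ e) : M.adj e ⊆ M.patch i :=
  fun _ hT => M.mem_patch.2 ⟨(M.mem_adj.1 hT).1, (M.mem_adj.1 hT).2 hi⟩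

theorem TriMesh.adj_eq_singleton {T e : Finset E2} (hT : T ∈ M.adj e) (h : (M.adj e).card = 1) :
    M.adj e = {T} := by
  obtain ⟨T', h'⟩ := Finset.card_eq_one.1 h
  rw [h', Finset.mem_singleton] at hT
  rw [h', hT]

theorem TriMesh.adj_eq_insert [DecidableEq (Finset E2)] {e T T' : Finset E2} (he : e ∈ M.edges)
    (h : T ∈ M.adj e) (h' : T' ∈ M.adj e) (hne : T ≠ T') : M.adj e = {T, T'} := by
  ext S
  rw [adj_eq_pair he h h' hne, Finset.mem_insert, Finset.mem_singleton]

theorem meanProj_of_singleton {T e : Finset E2} (h : M.adj e = {T}) (i : E2) :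
    Problem.meanProj M φ η i T e = edgeInt e (fun x => η T e x * φ i x) := by
  classical
  unfold Problem.meanProj
  refine edgeInt_congr fun x _ => ?_
  rw [h]; simp [mul_comm]

theorem meanProj_of_pair {T T' e : Finset E2} (he : e ∈ M.edges) (h : T ∈ M.adj e)
    (h' : T' ∈ M.adj e) (hne : T ≠ T') (i : E2) :
    Problem.meanProj M φ η i T e
      = edgeInt e (fun x => 1 / 2 * (η T e x - η T' e x) * φ i x) := by
  classical
  unfold Problem.meanProj
  refine edgeInt_congr fun x _ => ?_
  rw [TriMesh.adj_eq_insert he h h' hne, Finset.card_pair hne, Finset.sum_pair hne, if_pos rfl,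
    if_neg hne.symm]
  push_cast
  ring

theorem meanProj_neg {T T' e : Finset E2} (he : e ∈ M.edges) (h : T ∈ M.adj e)
    (h' : T' ∈ M.adj e) (hne : T ≠ T') (i : E2) :
    Problem.meanProj M φ η i T e = - Problem.meanProj M φ η i T' e := by
  rw [meanProj_of_pair he h h' hne, meanProj_of_pair he h' h hne.symm, edgeInt, edgeInt,
    ← integral_neg]
  congr 1
  ext x
  ring

theorem sum_adj_le_patchErr {e : Finset E2} {i : E2} (hi : i ∈ e) :
    ∑ T ∈ M.adj e, locErr Df Du uh T ≤ patchErr M Df Du uh i :=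
  Finset.sum_le_sum_of_subset_of_nonneg (TriMesh.adj_subset_patch hi)
    fun _ _ _ => locErr_nonneg _ _ _ _

theorem TriMesh.mem_edgesOf_of_adj {T e : Finset E2} (he : e ∈ M.edges) (h : T ∈ M.adj e) :
    e ∈ edgesOf T := (M.mem_edgesOf_iff he).2 (M.mem_adj.1 h).2

theorem TriMesh.not_boundary_of_pair {e T T' : Finset E2} (h : T ∈ M.adj e)
    (h' : T' ∈ M.adj e) (hne : T ≠ T') : ¬ M.IsBoundaryEdge e := fun hB => by
  have := Finset.one_lt_card.2 ⟨T, h, T', h', hne⟩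
  have := hB.2
  omega

namespace Setting

variable (S : Setting amin amax κ N P M Df u Du uh φ η)
include S

theorem edgeInt_nodal {T e : Finset E2} (hT : T ∈ M.tri) (he : e ∈ edgesOf T) {i : E2}
    (hi : i ∈ e) : edgeInt e (φ i) = len e / 2 := by
  obtain ⟨p, a, b, h⟩ := (M.isTriangle hT).exists_edgeOf he
  have heT := (Finset.mem_powersetCard.1 he).1
  have h1 : edgeInt e (φ i) = edgeInt e (fun x => bary T i x) := edgeInt_congr fun x hx =>
    S.basis.eqOn_bary hT (heT hi) (hull_mono heT hx)
  rw [h1]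
  rcases (h.mem_iff i).1 hi with rfl | rfl
  · exact h.edgeInt_bary
  · exact h.swap.edgeInt_bary

theorem memLp_nodal {T e : Finset E2} (hT : T ∈ M.tri) (he : e ∈ edgesOf T) {i : E2}
    (hi : i ∈ T) : MemLp (φ i) 2 (edgeMeasure e) := by
  obtain ⟨p, a, b, h⟩ := (M.isTriangle hT).exists_edgeOf he
  refine (h.memLp (continuous_affine (bary T i))).ae_eq ?_
  filter_upwards [ae_mem_hull e] with x hx
  exact (S.basis.eqOn_bary hT hi (hull_mono h.subset hx)).symm

theorem integrable_eta_mul_nodal {T T' e : Finset E2} (he : e ∈ M.edges) (h : T ∈ M.adj e)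
    (h' : T' ∈ M.adj e) {i : E2} (hi : i ∈ e) :
    Integrable (fun x => η T' e x * φ i x) (edgeMeasure e) :=
  (S.memLp_eta (M.mem_adj.1 h').1 (TriMesh.mem_edgesOf_of_adj he h')).integrable_mul
    (S.memLp_nodal (M.mem_adj.1 h).1 (TriMesh.mem_edgesOf_of_adj he h) ((M.mem_adj.1 h).2 hi))

/-- On an interior edge the one-sided flux minus the average is half the jump, a constant by (H3),
and φ_i has integral `len e / 2`. These two halves make the 4. On a boundary edge the average is the
flux itself. -/
theorem abs_edgeInt_eta_sub_meanProj_le {T e : Finset E2} (he : e ∈ M.edges) (h : T ∈ M.adj e)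
    {i : E2} (hi : i ∈ e) :
    |edgeInt e (fun x => η T e x * φ i x) - Problem.meanProj M φ η i T e|
      ≤ jumpBound amax κ / 4 * patchErr M Df Du uh i := by
  classical
  have hY := patchErr_nonneg M Df Du uh i
  have hj := S.jumpBound_pos
  by_cases hT' : ∃ T' ∈ M.adj e, T ≠ T'
  · obtain ⟨T', h', hne⟩ := hT'
    have hB := TriMesh.not_boundary_of_pair h h' hne
    obtain ⟨J, hJ⟩ := S.jumpConst.1 e he T h T' h' hne
    have hJ' : ∀ᵐ x ∂(edgeMeasure e), (∑ T ∈ M.adj e, η T e x)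
        - (if e ∈ P.neumannEdges M then P.g x else 0) = J := by
      filter_upwards [hJ] with x hx
      rw [if_neg fun hN => hB (Problem.mem_neumannEdges.1 hN).1,
        TriMesh.adj_eq_insert he h h' hne, Finset.sum_pair hne, sub_zero, hx]
    have h1 := S.abs_jump_mul_len_le he (fun hD => hB hD.1) hJ'
    have h2 : edgeInt e (fun x => η T e x * φ i x) - Problem.meanProj M φ η i T e
        = 1 / 2 * J * (len e / 2) := by
      rw [meanProj_of_pair he h h' hne, ← S.edgeInt_nodal (M.mem_adj.1 h).1
        (TriMesh.mem_edgesOf_of_adj he h) hi, edgeInt, edgeInt, edgeInt, ← integral_const_mul,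
        ← integral_sub (S.integrable_eta_mul_nodal he h h hi)]
      · refine integral_congr_ae ?_
        filter_upwards [hJ] with x hx
        rw [← hx]; ring
      · refine (((S.integrable_eta_mul_nodal he h h hi).sub
          (S.integrable_eta_mul_nodal he h h' hi)).const_mul (1 / 2)).congr (ae_of_all _ fun x => ?_)
        simp only [Pi.sub_apply]; ring
    rw [h2, abs_mul, abs_mul, abs_of_nonneg (by positivity : (0 : ℝ) ≤ 1 / 2),
      abs_of_nonneg (div_nonneg Metric.diam_nonneg zero_le_two : 0 ≤ len e / 2)]
    have h3 := mul_le_mul_of_nonneg_left 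
      (sum_adj_le_patchErr (M := M) (Df := Df) (Du := Du) (uh := uh) hi) hj.le
    linarith
  · push Not at hT'
    have : M.adj e = {T} := by
      ext T'; rw [Finset.mem_singleton]
      exact ⟨fun h' => (hT' T' h').symm, fun h' => h' ▸ h⟩
    rw [meanProj_of_singleton this, sub_self, abs_zero]
    positivity

/-- On a Neumann edge the constant deviation g - q_h·n plays the role of the jump. It counts in full
and not by half, hence the 2. -/
theorem abs_edgeInt_g_sub_eta_le {T e : Finset E2} (hN : P.IsNeumannEdge M e) (h : T ∈ M.adj e)
    {i : E2} (hi : i ∈ e) :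
    |edgeInt e (fun x => P.g x * φ i x) - edgeInt e (fun x => η T e x * φ i x)|
      ≤ jumpBound amax κ / 2 * patchErr M Df Du uh i := by
  classical
  have he := hN.1.1
  have hj := S.jumpBound_pos
  obtain ⟨J, hJ⟩ := S.jumpConst.2 e hN T h
  have hJ' : ∀ᵐ x ∂(edgeMeasure e), (∑ T ∈ M.adj e, η T e x)
      - (if e ∈ P.neumannEdges M then P.g x else 0) = -J := by
    filter_upwards [hJ] with x hx
    rw [if_pos (Problem.mem_neumannEdges.2 hN), TriMesh.adj_eq_singleton h hN.1.2,
      Finset.sum_singleton, ← hx]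
    ring
  have h1 := S.abs_jump_mul_len_le he (fun hD => S.not_neumann_of_dirichlet hD hN) hJ'
  have h2 : edgeInt e (fun x => P.g x * φ i x) - edgeInt e (fun x => η T e x * φ i x)
      = J * (len e / 2) := by
    have hTt := (M.mem_adj.1 h).1
    have heT := TriMesh.mem_edgesOf_of_adj he h
    have hig : Integrable (fun x => P.g x * φ i x) (edgeMeasure e) :=
      (S.memLp_g hN).integrable_mul (S.memLp_nodal hTt heT ((M.mem_adj.1 h).2 hi))
    rw [← S.edgeInt_nodal hTt heT hi, edgeInt, edgeInt, edgeInt, ← integral_const_mul,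
      ← integral_sub hig (S.integrable_eta_mul_nodal he h h hi)]
    refine integral_congr_ae ?_
    filter_upwards [hJ] with x hx
    rw [← hx]; ring
  rw [h2, abs_mul, abs_of_nonneg (div_nonneg Metric.diam_nonneg zero_le_two : 0 ≤ len e / 2)]
  rw [abs_neg] at h1
  have h3 := mul_le_mul_of_nonneg_left 
      (sum_adj_le_patchErr (M := M) (Df := Df) (Du := Du) (uh := uh) hi) hj.le
  linarith

-- By Green's formula the moments of q_h·n solve the prolongation condition up to the term ∫ f φ_i.
-- Here φ_i appears as the bubble of a single vertex, so that the bubble bounds apply to that term.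
open Classical in
theorem nodeLoad_eq {T : Finset E2} (hT : T ∈ M.tri) {i : E2} (hi : i ∈ T) :
    P.nodeLoad φ uh i T = (∑ e ∈ (edgesOf T).filter (fun e => i ∈ e),
      edgeInt e (fun x => η T e x * φ i x)) - ∫ x in elt T, P.f x * bubble φ {i} x := by
  have hin : i ∈ M.nodes := M.mem_nodes.2 ⟨T, hT, hi⟩
  have hsm := (S.basis i hin).1.piecewiseSmooth
  have hb : bubble φ {i} = φ i := by ext x; simp [bubble]
  have hH1 := hsm.memH1 S.meshed S.adm.isOpen S.adm.bounded
  unfold Problem.nodeLoad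
  rw [integral_sub, hb, S.green hT (contDiff_affine (bary T i)) (S.basis.eqOn_bary hT hi)]
  · congr 1
    rw [Finset.sum_filter]
    refine Finset.sum_congr rfl fun e he => ?_
    split_ifs with hie
    · rfl
    · exact edgeInt_eq_zero fun x hx => by
        rw [S.basis.eq_zero_on_edge hT he hin hie x hx, mul_zero]
  · exact integrable_inner_of_memLp (S.memLp_flux.restrict_elt S.meshed hT)
      (hH1.memLp_grad.restrict_elt S.meshed hT)
  · exact (S.memLp_f hT).integrable_mul (hH1.memLp.restrict_elt S.meshed hT)

end Setting

/-! ### Stability of the node systems -/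

/-- Triangles with vertex `i` that share an edge with end point `i`. -/
def fanGraph (M : TriMesh) (i : E2) : SimpleGraph (Finset E2) where
  Adj T T' := T ≠ T' ∧ ∃ e ∈ M.edges, i ∈ e ∧ T ∈ M.adj e ∧ T' ∈ M.adj e
  symm := ⟨fun _ _ ⟨hne, e, he, hi, h, h'⟩ => ⟨hne.symm, e, he, hi, h', h⟩⟩
  loopless := ⟨fun _ h => h.1 rfl⟩

/-- A uniform bound for solutions of the node systems. -/
def signConst (N : ℕ) : ℝ := (exists_signSystem_const_of_card_le N (3 * N)).choose

/-- Constant in the bound for the right-hand side of the node systems. -/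
def rhsConst (amax κ : ℝ) : ℝ := √discArea * loadConst amax κ + 3 * jumpBound amax κ

/-- Constant in the stability bound for the node systems. -/
def nodeConst (amax κ : ℝ) (N : ℕ) : ℝ :=
  jumpBound amax κ + 3 * N * (signConst N * rhsConst amax κ * ((1 + κ) ^ N * κ))

variable {amin amax κ : ℝ} {N : ℕ} {P : Problem} {M : TriMesh} {Df : E2 → E2}
    {u : E2 → ℝ} {Du : E2 → E2} {uh : E2 → ℝ} {φ : E2 → E2 → ℝ}
    {η : Finset E2 → Finset E2 → E2 → ℝ}

theorem TriMesh.card_edges_at_le (hv : ∀ i ∈ M.nodes, (M.patch i).card ≤ N) {i : E2}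
    (hi : i ∈ M.nodes) {E : Finset (Finset E2)} (hE : ∀ e ∈ E, e ∈ M.edges ∧ i ∈ e) :
    E.card ≤ 3 * N := by
  classical
  have hsub : E ⊆ (M.patch i).biUnion edgesOf := by
    intro e he
    obtain ⟨T, hT, heT⟩ := M.mem_edges.1 (hE e he).1
    exact Finset.mem_biUnion.2
      ⟨T, M.mem_patch.2 ⟨hT, (Finset.mem_powersetCard.1 heT).1 (hE e he).2⟩, heT⟩
  calc _ ≤ ((M.patch i).biUnion edgesOf).card := Finset.card_le_card hsub
    _ ≤ ∑ T ∈ M.patch i, (edgesOf T).card := Finset.card_biUnion_le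
    _ = ∑ T ∈ M.patch i, 3 := Finset.sum_congr rfl fun T hT => by
        rw [edgesOf, Finset.card_powersetCard, M.card_eq T (M.mem_patch.1 hT).1]; rfl
    _ = 3 * (M.patch i).card := by rw [Finset.sum_const, smul_eq_mul, mul_comm]
    _ ≤ 3 * N := by gcongr; exact hv i hi

namespace Setting

variable (S : Setting amin amax κ N P M Df u Du uh φ η)
include S

theorem width_le_len {T e : Finset E2} (he : e ∈ M.edges) (h : T ∈ M.adj e) :
    width T ≤ κ / 2 * len e := by
  obtain ⟨c, r, hr⟩ := S.shape T (M.mem_adj.1 h).1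
  obtain ⟨p, a, b, hE⟩ := TriMesh.exists_edgeOf_of_adj h he
  have h1 := hr.two_mul_le_dist hE.ha hE.hb hE.hab
  rw [← hE.len_eq] at h1
  have h2 := hr.diam
  have := S.kappa_pos
  nlinarith

omit S in
theorem len_le_width {T e : Finset E2} (he : e ∈ M.edges) (h : T ∈ M.adj e) :
    len e ≤ width T := by
  obtain ⟨p, a, b, hE⟩ := TriMesh.exists_edgeOf_of_adj h he
  exact hE.len_le

/-- Edges of the same fan of triangles have comparable lengths. -/
theorem len_le_of_reachable {i : E2} (hi : i ∈ M.nodes) {T T' e e' : Finset E2} (he : e ∈ M.edges)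
    (he' : e' ∈ M.edges) (hie' : i ∈ e') (h : T ∈ M.adj e) (h' : T' ∈ M.adj e')
    (hr : (fanGraph M i).Reachable T T') : len e ≤ (1 + κ) ^ N * κ * len e' := by
  have hκ := S.kappa_pos
  -- Two triangles with a common edge satisfy width T ≤ (κ/2) len e ≤ (κ/2) width T'. The ratio is
  -- enlarged to 1 + κ, which is at least 1, so that longer paths only increase the bound.
  have h1 := hr.le_pow_card_mul (G := fanGraph M i) (F := width) (K := 1 + κ) (s := M.patch i) (by linarith)
    width_nonneg (fun T T' ⟨_, e, he, _, h, h'⟩ => by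
      have a1 := S.width_le_len he h
      have a2 := len_le_width he h'
      have a3 := width_nonneg T'
      nlinarith)
    (fun T T' ⟨_, e, he, hi, h, _⟩ => TriMesh.adj_subset_patch hi h)
    (TriMesh.adj_subset_patch hie' h')
  have h2 : (1 + κ) ^ (M.patch i).card ≤ (1 + κ) ^ N :=
    pow_le_pow_right₀ (by linarith) (S.valence i hi)
  have h3 := S.width_le_len he' h'
  have h4 : 0 ≤ len e' := Metric.diam_nonneg
  calc len e ≤ width T := len_le_width he h
    _ ≤ (1 + κ) ^ (M.patch i).card * width T' := h1
    _ ≤ (1 + κ) ^ N * (κ / 2 * len e') :=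
        mul_le_mul h2 h3 (width_nonneg _) (by positivity)
    _ ≤ (1 + κ) ^ N * (κ * len e') := by gcongr; linarith
    _ = _ := by ring

theorem rhsConst_nonneg : 0 ≤ rhsConst amax κ := by
  have := S.jumpBound_pos
  have := S.loadConst_pos
  have := Real.sqrt_nonneg discArea
  unfold rhsConst; positivity

omit S in
theorem signConst_nonneg (N : ℕ) : 0 ≤ signConst N :=
  (exists_signSystem_const_of_card_le N (3 * N)).choose_spec.1

theorem nodeConst_nonneg : 0 ≤ nodeConst amax κ N := by
  have := S.jumpBound_pos
  have := S.rhsConst_nonneg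
  have := signConst_nonneg N
  have := S.kappa_pos
  unfold nodeConst; positivity

variable {b : Finset E2 → Finset E2 → ℝ} {i : E2}

theorem abs_sub_meanProj_neumann_le (hb : P.NodeSystem M φ uh i b) {T e : Finset E2}
    (hN : P.IsNeumannEdge M e) (hie : i ∈ e) (h : T ∈ M.adj e) :
    |b T e - Problem.meanProj M φ η i T e| ≤ jumpBound amax κ / 2 * patchErr M Df Du uh i := by
  rw [hb.neumann e hN hie T h, meanProj_of_singleton (TriMesh.adj_eq_singleton h hN.1.2)]
  exact S.abs_edgeInt_g_sub_eta_le hN h hie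

-- This bounds the defect with which the averages b^m satisfy the equation of T. The load is the sum
-- of the one-sided moments minus ∫ f φ_i, the one-sided moments differ from the averages by jumps,
-- and the Neumann edges, where b is prescribed, are moved to the right side. The jumps contribute
-- at most 3 (1/4 + 1/2) ≤ 3 times `jumpBound`.
open Classical in
theorem abs_sum_sub_meanProj_le (hb : P.NodeSystem M φ uh i b) {T : Finset E2}
    (hT : T ∈ M.patch i) :
    |∑ e ∈ (edgesOf T).filter (fun e => i ∈ e ∧ ¬ P.IsNeumannEdge M e),
        (b T e - Problem.meanProj M φ η i T e)|
      ≤ rhsConst amax κ * patchErr M Df Du uh i := by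
  obtain ⟨hTt, hiT⟩ := M.mem_patch.1 hT
  set Y := patchErr M Df Du uh i with hYdef
  have hY : 0 ≤ Y := patchErr_nonneg M Df Du uh i
  have hj := S.jumpBound_pos
  set c := fun e => b T e - Problem.meanProj M φ η i T e with hc
  have hpro : ∑ e ∈ (edgesOf T).filter (fun e => i ∈ e), b T e = P.nodeLoad φ uh i T := by
    convert hb.prolong T hT
  rw [S.nodeLoad_eq hTt hiT] at hpro
  have hsplit : ∑ e ∈ (edgesOf T).filter (fun e => i ∈ e ∧ ¬ P.IsNeumannEdge M e), c e
      = (∑ e ∈ (edgesOf T).filter (fun e => i ∈ e), c e)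
        - ∑ e ∈ (edgesOf T).filter (fun e => i ∈ e ∧ P.IsNeumannEdge M e), c e := by
    rw [← Finset.filter_filter, ← Finset.filter_filter, eq_sub_iff_add_eq, add_comm]
    exact Finset.sum_filter_add_sum_filter_not _ _ _
  have hall : ∑ e ∈ (edgesOf T).filter (fun e => i ∈ e), c e
      = (∑ e ∈ (edgesOf T).filter (fun e => i ∈ e),
          (edgeInt e (fun x => η T e x * φ i x) - Problem.meanProj M φ η i T e))
        - ∫ x in elt T, P.f x * bubble φ {i} x := by
    simp only [hc, Finset.sum_sub_distrib, hpro]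
    ring
  have hcard : ∀ (p : Finset E2 → Prop) [DecidablePred p],
      (((edgesOf T).filter p).card : ℝ) ≤ 3 := fun p _ => by
    have h1 : (edgesOf T).card = 3 := by
      rw [edgesOf, Finset.card_powersetCard, M.card_eq T hTt]; rfl
    have := Finset.card_filter_le (edgesOf T) p
    rw [h1] at this
    exact_mod_cast this
  have hsum : ∀ (p : Finset E2 → Prop) [DecidablePred p] (F : Finset E2 → ℝ) (B : ℝ), 0 ≤ B →
      (∀ e ∈ (edgesOf T).filter p, |F e| ≤ B) → |∑ e ∈ (edgesOf T).filter p, F e| ≤ 3 * B := by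
    intro p _ F B hB hF
    refine (Finset.abs_sum_le_sum_abs _ _).trans ((Finset.sum_le_card_nsmul _ _ _ hF).trans ?_)
    rw [nsmul_eq_mul]
    exact mul_le_mul_of_nonneg_right (hcard p) hB
  have hedge : ∀ e ∈ edgesOf T, e ∈ M.edges ∧ T ∈ M.adj e := fun e he =>
    ⟨M.mem_edges.2 ⟨T, hTt, he⟩, M.mem_adj_of_mem_edgesOf hTt he⟩
  have b1 := hsum (fun e => i ∈ e)
    (fun e => edgeInt e (fun x => η T e x * φ i x) - Problem.meanProj M φ η i T e)
    (jumpBound amax κ / 4 * Y) (by positivity) (fun e he => by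
      obtain ⟨he, hie⟩ := Finset.mem_filter.1 he
      exact S.abs_edgeInt_eta_sub_meanProj_le (hedge e he).1 (hedge e he).2 hie)
  have b2 := hsum (fun e => i ∈ e ∧ P.IsNeumannEdge M e) c
    (jumpBound amax κ / 2 * Y) (by positivity) (fun e he => by
      obtain ⟨he, hie, hN⟩ := Finset.mem_filter.1 he
      exact S.abs_sub_meanProj_neumann_le hb hN hie (hedge e he).2)
  have b3 : |∫ x in elt T, P.f x * bubble φ {i} x| ≤ √discArea * loadConst amax κ * Y := by
    refine (S.abs_integral_mul_bubble_le hTt (Finset.singleton_subset_iff.2 hiT)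
      (S.memLp_f hTt)).trans ?_
    rw [mul_assoc, mul_assoc]
    refine mul_le_mul_of_nonneg_left ((S.width_mul_nrm_f_le hTt).trans
      (mul_le_mul_of_nonneg_left ?_ S.loadConst_pos.le)) (Real.sqrt_nonneg _)
    exact Finset.single_le_sum (f := fun T => locErr Df Du uh T)
      (fun _ _ => locErr_nonneg _ _ _ _) hT
  rw [hsplit, hall]
  unfold rhsConst
  have t1 := abs_sub (∑ e ∈ (edgesOf T).filter (fun e => i ∈ e),
          (edgeInt e (fun x => η T e x * φ i x) - Problem.meanProj M φ η i T e))
        (∫ x in elt T, P.f x * bubble φ {i} x)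
  refine (abs_sub _ _).trans ((add_le_add t1 le_rfl).trans ?_)
  have : 0 ≤ jumpBound amax κ * Y := by positivity
  nlinarith

/-- A solution of the node system that is close to the average finite element fluxes in the fan of
triangles of a given edge, and unchanged elsewhere. -/
theorem exists_competitor (hi : i ∈ M.nodes) (hb : P.NodeSystem M φ uh i b)
    {T₀ e₀ : Finset E2} (he₀ : e₀ ∈ M.edges) (hie₀ : i ∈ e₀) (h₀ : T₀ ∈ M.adj e₀)
    (hN₀ : ¬ P.IsNeumannEdge M e₀) :
    ∃ (E : Finset (Finset E2)) (b' : Finset E2 → Finset E2 → ℝ), e₀ ∈ E ∧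
      (∀ e ∈ E, e ∈ M.edges ∧ i ∈ e ∧ ¬ P.IsNeumannEdge M e ∧
        ∃ T ∈ M.adj e, (fanGraph M i).Reachable T₀ T) ∧
      P.NodeSystem M φ uh i b' ∧ (∀ T, ∀ e ∉ E, b' T e = b T e) ∧
      ∀ e ∈ E, ∀ T ∈ M.adj e, |b' T e - Problem.meanProj M φ η i T e|
        ≤ signConst N * (rhsConst amax κ * patchErr M Df Du uh i) := by
  classical
  set Y := patchErr M Df Du uh i with hYdef
  have hY : 0 ≤ Y := patchErr_nonneg M Df Du uh i
  have hrc := S.rhsConst_nonneg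
  set m := Problem.meanProj M φ η i with hm
  -- Triangles at i may form several fans that meet in i alone, whose sizes need not be comparable.
  -- Only the fan of `T₀` is changed. The equations decouple, since edges at i join triangles of the
  -- same fan only.
  set comp := (M.patch i).filter (fun T => (fanGraph M i).Reachable T₀ T) with hcomp
  set E := M.edges.filter
    (fun e => i ∈ e ∧ ¬ P.IsNeumannEdge M e ∧ ∃ T ∈ comp, T ∈ M.adj e) with hE
  have hclosed : ∀ e ∈ M.edges, i ∈ e → ∀ T ∈ M.adj e, T ∈ comp → ∀ T' ∈ M.adj e, T' ∈ comp := by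
    intro e he hie T hT hTc T' hT'
    by_cases hne : T = T'
    · exact hne ▸ hTc
    · refine Finset.mem_filter.2 ⟨TriMesh.adj_subset_patch hie hT', ?_⟩
      have hadj : (fanGraph M i).Adj T T' := ⟨hne, e, he, hie, hT, hT'⟩
      exact (Finset.mem_filter.1 hTc).2.trans hadj.reachable
  have hEall : ∀ e ∈ E, e ∈ M.edges ∧ i ∈ e ∧ ¬ P.IsNeumannEdge M e ∧ ∀ T ∈ M.adj e, T ∈ comp := by
    intro e he
    obtain ⟨he, hie, hN, T, hT, hTe⟩ := Finset.mem_filter.1 he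
    exact ⟨he, hie, hN, hclosed e he hie T hTe hT⟩
  have ho : ∀ e ∈ M.edges, ∃ T, T ∈ M.adj e := fun e he =>
    Finset.card_pos.1 (TriMesh.adj_card_pos he)
  choose! o ho using ho
  -- There is one unknown per edge, its value as seen from a chosen adjacent triangle `o e`. The
  -- other adjacent triangle, if any, sees it with the opposite sign.
  set s : Finset E2 → Finset E2 → SignType := fun T e =>
    if T ∈ M.adj e then (if T = o e then 1 else -1) else 0 with hs
  set c : Finset E2 → Finset E2 → ℝ := fun T e => b T e - m T e with hc
  have hanti : ∀ e ∈ M.edges, i ∈ e → ∀ T ∈ M.adj e, ∀ T' ∈ M.adj e, T ≠ T' →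
      c T e = - c T' e := by
    intro e he hie T hT T' hT' hne
    have h1 := hb.cont e he hie T hT T' hT' hne
    have h2 : m T e = - m T' e := meanProj_neg he hT hT' hne i
    simp only [hc, h1, h2]; ring
  have hsc' : ∀ e ∈ M.edges, i ∈ e → ∀ T ∈ M.adj e, (s T e : ℝ) * c (o e) e = c T e := by
    intro e he hie T hT
    by_cases hTo : T = o e
    · simp [hs, hT, ← hTo]
    · simp [hs, hT, hTo, hanti e he hie T hT (o e) (ho e he) hTo]
  have hsneg : ∀ e ∈ M.edges, ∀ T ∈ M.adj e, ∀ T' ∈ M.adj e, T ≠ T' →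
      (s T e : ℝ) = - (s T' e : ℝ) := by
    intro e he T hT T' hT' hne
    by_cases hTo : T = o e
    · have : T' ≠ o e := fun h => hne (hTo.trans h.symm)
      simp [hs, hT, hT', ← hTo, hne.symm]
    · have : T' = o e := TriMesh.eq_of_adj he hT hT' (ho e he) hne hTo
      simp [hs, hT, hT', ← this, hne]
  have hsabs : ∀ T e, |(s T e : ℝ)| ≤ 1 := by
    intro T e
    simp only [hs]
    split_ifs <;> simp
  have hrow : ∀ T ∈ comp, ∀ F : Finset E2 → ℝ, ∑ e ∈ E, (s T e : ℝ) * F e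
      = ∑ e ∈ (edgesOf T).filter (fun e => i ∈ e ∧ ¬ P.IsNeumannEdge M e), (s T e : ℝ) * F e := by
    intro T hT F
    have hTt := (M.mem_patch.1 (Finset.mem_filter.1 hT).1).1
    refine (Finset.sum_subset (fun e he => ?_) fun e he hn => ?_).symm
    · obtain ⟨he, hie, hN⟩ := Finset.mem_filter.1 he
      exact Finset.mem_filter.2 ⟨M.mem_edges.2 ⟨T, hTt, he⟩, hie, hN, T, hT,
        M.mem_adj_of_mem_edgesOf hTt he⟩
    · obtain ⟨he, hie, hN, -⟩ := hEall e he
      have : T ∉ M.adj e := fun h => hn (Finset.mem_filter.2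
        ⟨TriMesh.mem_edgesOf_of_adj he h, hie, hN⟩)
      simp [hs, this]
  have hrowc : ∀ T ∈ comp, ∑ e ∈ E, (s T e : ℝ) * c (o e) e
      = ∑ e ∈ (edgesOf T).filter (fun e => i ∈ e ∧ ¬ P.IsNeumannEdge M e), c T e := by
    intro T hT
    have hTt := (M.mem_patch.1 (Finset.mem_filter.1 hT).1).1
    rw [hrow T hT]
    refine Finset.sum_congr rfl fun e he => ?_
    obtain ⟨he, hie, hN⟩ := Finset.mem_filter.1 he
    exact hsc' e (M.mem_edges.2 ⟨T, hTt, he⟩) hie T (M.mem_adj_of_mem_edgesOf hTt he)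
  have hEcard : E.card ≤ 3 * N := TriMesh.card_edges_at_le S.valence hi
    fun e he => ⟨(hEall e he).1, (hEall e he).2.1⟩
  -- The deviation c = b - b^m already solves this system, so the right side is attainable. The
  -- lemma trades c, whose size is unknown, for a solution y bounded by the right side.
  obtain ⟨y, hy, hyb⟩ := (exists_signSystem_const_of_card_le N (3 * N)).choose_spec.2 comp E
    ((Finset.card_filter_le _ _).trans (S.valence i hi)) hEcard
    s (fun e => c (o e) e) (rhsConst amax κ * Y) (by positivity) (fun T hT => by
      rw [hrowc T hT]
      exact S.abs_sum_sub_meanProj_le hb (Finset.mem_filter.1 hT).1)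
  have hyb' : ∀ e ∈ E, |y e| ≤ signConst N * (rhsConst amax κ * Y) := hyb
  set b' : Finset E2 → Finset E2 → ℝ := fun T e => if e ∈ E then m T e + s T e * y e else b T e
    with hb'
  have hsys : P.NodeSystem M φ uh i b' := by
    refine ⟨fun e he hie T hT T' hT' hne => ?_, fun e hN hie T hT => ?_, fun T hT => ?_⟩
    · have h1 := hb.cont e he hie T hT T' hT' hne
      have h2 : m T e = - m T' e := meanProj_neg he hT hT' hne i
      simp only [hb']
      split_ifs
      · rw [h2, hsneg e he T hT T' hT' hne]; ring
      · exact h1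
    · have : e ∉ E := fun he => (hEall e he).2.2.1 hN
      simp only [hb', if_neg this]
      exact hb.neumann e hN hie T hT
    · have hTt := (M.mem_patch.1 hT).1
      rw [← hb.prolong T hT]
      by_cases hTc : T ∈ comp
      · have hmem : ∀ e ∈ edgesOf T, i ∈ e → (e ∈ E ↔ ¬ P.IsNeumannEdge M e) := by
          intro e he hie
          refine ⟨fun h => (hEall e h).2.2.1, fun h => ?_⟩
          exact Finset.mem_filter.2 ⟨M.mem_edges.2 ⟨T, hTt, he⟩, hie, h, T, hTc,
            M.mem_adj_of_mem_edgesOf hTt he⟩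
        have h1 := (hrow T hTc y).symm.trans ((hy T hTc).trans (hrowc T hTc))
        rw [← Finset.filter_filter] at h1
        rw [← Finset.sum_filter_add_sum_filter_not _ (fun e => ¬ P.IsNeumannEdge M e),
          ← Finset.sum_filter_add_sum_filter_not ((edgesOf T).filter (fun e => i ∈ e))
            (fun e => ¬ P.IsNeumannEdge M e) (fun e => b T e)]
        congr 1
        · have h2 : ∀ e ∈ ((edgesOf T).filter (fun e => i ∈ e)).filter
              (fun e => ¬ P.IsNeumannEdge M e), b' T e = m T e + s T e * y e := by
            intro e he
            obtain ⟨he, hN⟩ := Finset.mem_filter.1 he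
            obtain ⟨he, hie⟩ := Finset.mem_filter.1 he
            simp only [hb', if_pos ((hmem e he hie).2 hN)]
          have h3 : ∑ e ∈ ((edgesOf T).filter (fun e => i ∈ e)).filter
              (fun e => ¬ P.IsNeumannEdge M e), (s T e : ℝ) * y e
              = ∑ e ∈ ((edgesOf T).filter (fun e => i ∈ e)).filter
              (fun e => ¬ P.IsNeumannEdge M e), c T e := by convert h1
          rw [Finset.sum_congr rfl h2, Finset.sum_add_distrib, h3]
          simp only [hc, Finset.sum_sub_distrib]
          ring
        · refine Finset.sum_congr rfl fun e he => ?_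
          obtain ⟨he, hN⟩ := Finset.mem_filter.1 he
          obtain ⟨he, hie⟩ := Finset.mem_filter.1 he
          simp only [hb', if_neg fun h => hN ((hmem e he hie).1 h)]
      · refine Finset.sum_congr rfl fun e he => ?_
        obtain ⟨he, hie⟩ := Finset.mem_filter.1 he
        have : e ∉ E := fun h => hTc ((hEall e h).2.2.2 T (M.mem_adj_of_mem_edgesOf hTt he))
        simp only [hb', if_neg this]
  have hT₀c : T₀ ∈ comp :=
    Finset.mem_filter.2 ⟨TriMesh.adj_subset_patch hie₀ h₀, SimpleGraph.Reachable.refl T₀⟩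
  refine ⟨E, b', Finset.mem_filter.2 ⟨he₀, hie₀, hN₀, T₀, hT₀c, h₀⟩, fun e he => ?_, hsys,
    fun T e he => if_neg he, fun e he T hT => ?_⟩
  · obtain ⟨hee, hie, hN, hall⟩ := hEall e he
    exact ⟨hee, hie, hN, o e, ho e hee, (Finset.mem_filter.1 (hall _ (ho e hee))).2⟩
  · simp only [hb', if_pos he, add_sub_cancel_left]
    rw [abs_mul]
    have := mul_le_mul (hsabs T e) (hyb' e he) (abs_nonneg _) zero_le_one
    rwa [one_mul] at this

/-- Stability: the minimizer of the cost is close to the average finite element fluxes. -/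
theorem abs_sub_meanProj_le (hi : i ∈ M.nodes) (hb : P.NodeSystem M φ uh i b)
    (hmin : ∀ b', P.NodeSystem M φ uh i b' → P.nodeCost M φ η i b ≤ P.nodeCost M φ η i b')
    {T₀ e₀ : Finset E2} (he₀ : e₀ ∈ M.edges) (hie₀ : i ∈ e₀) (h₀ : T₀ ∈ M.adj e₀) :
    |b T₀ e₀ - Problem.meanProj M φ η i T₀ e₀|
      ≤ nodeConst amax κ N * patchErr M Df Du uh i := by
  classical
  set Y := patchErr M Df Du uh i with hYdef
  have hY : 0 ≤ Y := patchErr_nonneg M Df Du uh i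
  have hj := S.jumpBound_pos
  have hκ := S.kappa_pos
  have hrc := S.rhsConst_nonneg
  have hsc := signConst_nonneg N
  by_cases hN₀ : P.IsNeumannEdge M e₀
  · refine (S.abs_sub_meanProj_neumann_le hb hN₀ hie₀ h₀).trans
      (mul_le_mul_of_nonneg_right ?_ hY)
    unfold nodeConst
    have : 0 ≤ 3 * N * (signConst N * rhsConst amax κ * ((1 + κ) ^ N * κ)) := by positivity
    linarith
  obtain ⟨E, b', he₀E, hEall, hsys, hbE, hbb⟩ := S.exists_competitor hi hb he₀ hie₀ h₀ hN₀
  set m := Problem.meanProj M φ η i with hm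
  set q : (Finset E2 → Finset E2 → ℝ) → Finset E2 → ℝ := fun b e =>
    (((M.adj e).card : ℝ)⁻¹ * ∑ T ∈ M.adj e, (b T e - m T e) ^ 2) / len e ^ 2 with hq
  have hcost : ∀ b, P.nodeCost M φ η i b
      = ∑ e ∈ M.edges.filter (fun e => i ∈ e ∧ ¬ P.IsNeumannEdge M e), q b e := fun b => by
    unfold Problem.nodeCost
    congr!
  have hEsub : E ⊆ M.edges.filter (fun e => i ∈ e ∧ ¬ P.IsNeumannEdge M e) := fun e he =>
    Finset.mem_filter.2 ⟨(hEall e he).1, (hEall e he).2.1, (hEall e he).2.2.1⟩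
  -- The competitor agrees with b off `E`, so the minimality of the total cost descends to the edges
  -- of the fan.
  have hqE : ∑ e ∈ E, q b e ≤ ∑ e ∈ E, q b' e := by
    have h1 := hmin b' hsys
    rw [hcost, hcost, ← Finset.sum_sdiff hEsub, ← Finset.sum_sdiff (f := q b') hEsub] at h1
    have h2 : ∑ e ∈ M.edges.filter (fun e => i ∈ e ∧ ¬ P.IsNeumannEdge M e) \ E, q b' e
        = ∑ e ∈ M.edges.filter (fun e => i ∈ e ∧ ¬ P.IsNeumannEdge M e) \ E, q b e :=
      Finset.sum_congr rfl fun e he => by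
        simp only [hq, hbE _ e (Finset.mem_sdiff.1 he).2]
    linarith
  have hq0 : ∀ e, 0 ≤ q b e := fun e => by simp only [hq]; positivity
  have hlen : ∀ e ∈ M.edges, 0 < len e := fun e he => by
    obtain ⟨T, hT⟩ := Finset.card_pos.1 (TriMesh.adj_card_pos he)
    obtain ⟨p, a, b, h⟩ := TriMesh.exists_edgeOf_of_adj hT he
    exact h.len_pos
  have hcard : ∀ e ∈ M.edges, (1 : ℝ) ≤ (M.adj e).card := fun e he => by
    exact_mod_cast TriMesh.adj_card_pos he
  set B := signConst N * (rhsConst amax κ * Y) with hB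
  have hB0 : 0 ≤ B := by positivity
  set L := (1 + κ) ^ N * κ with hL
  have hL0 : 0 < L := by positivity
  have hl₀ := hlen e₀ he₀
  -- Since `len e₀ ≤ L * len e` in the fan, the weight of any of its edges is at most L² times that
  -- of `e₀`.
  have hqb' : ∀ e ∈ E, q b' e ≤ (B * L) ^ 2 / len e₀ ^ 2 := by
    intro e he
    obtain ⟨hee, hie, hN, T₁, hT₁, hreach⟩ := hEall e he
    have hl := hlen e hee
    have hr := S.len_le_of_reachable hi he₀ hee hie h₀ hT₁ hreach
    have h1 : ∑ T ∈ M.adj e, (b' T e - m T e) ^ 2 ≤ (M.adj e).card * B ^ 2 := by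
      rw [← nsmul_eq_mul]
      refine Finset.sum_le_card_nsmul _ _ _ fun T hT => ?_
      rw [← sq_abs]
      exact pow_le_pow_left₀ (abs_nonneg _) (hbb e he T hT) 2
    have h2 : ((M.adj e).card : ℝ)⁻¹ * ∑ T ∈ M.adj e, (b' T e - m T e) ^ 2 ≤ B ^ 2 := by
      rw [inv_mul_le_iff₀ (by linarith [hcard e hee])]; exact h1
    rw [div_le_div_iff₀ (by positivity) (by positivity)]
    calc _ ≤ B ^ 2 * len e₀ ^ 2 := mul_le_mul_of_nonneg_right h2 (by positivity)
      _ ≤ B ^ 2 * (L * len e) ^ 2 := by gcongr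
      _ = _ := by ring
  have hEcard : E.card ≤ 3 * N := TriMesh.card_edges_at_le S.valence hi
    fun e he => ⟨(hEall e he).1, (hEall e he).2.1⟩
  have hsum : q b e₀ ≤ 3 * N * ((B * L) ^ 2 / len e₀ ^ 2) := by
    calc q b e₀ ≤ ∑ e ∈ E, q b e := Finset.single_le_sum (fun e _ => hq0 e) he₀E
      _ ≤ ∑ e ∈ E, q b' e := hqE
      _ ≤ E.card • ((B * L) ^ 2 / len e₀ ^ 2) := Finset.sum_le_card_nsmul _ _ _ hqb'
      _ = E.card * ((B * L) ^ 2 / len e₀ ^ 2) := nsmul_eq_mul _ _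
      _ ≤ _ := by
        gcongr
        exact_mod_cast hEcard
  have hcN : ((M.adj e₀).card : ℝ) ≤ N := by
    exact_mod_cast (Finset.card_le_card (TriMesh.adj_subset_patch hie₀)).trans (S.valence i hi)
  have hfin : (b T₀ e₀ - m T₀ e₀) ^ 2 ≤ (3 * N * (B * L)) ^ 2 := by
    have h1 : (b T₀ e₀ - m T₀ e₀) ^ 2 ≤ ∑ T ∈ M.adj e₀, (b T e₀ - m T e₀) ^ 2 :=
      Finset.single_le_sum (f := fun T => (b T e₀ - m T e₀) ^ 2) (fun T _ => sq_nonneg _) h₀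
    have h2 : ∑ T ∈ M.adj e₀, (b T e₀ - m T e₀) ^ 2
        = (M.adj e₀).card * (q b e₀ * len e₀ ^ 2) := by
      have := hcard e₀ he₀
      simp only [hq]
      rw [div_mul_cancel₀ _ (pow_pos hl₀ 2).ne', mul_inv_cancel_left₀ (zero_lt_one.trans_le this).ne']
    have h3 : q b e₀ * len e₀ ^ 2 ≤ 3 * N * (B * L) ^ 2 := by
      rw [mul_div_assoc', le_div_iff₀ (pow_pos hl₀ 2)] at hsum
      exact hsum
    have hN1 : (1 : ℝ) ≤ N := (hcard e₀ he₀).trans hcN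
    calc (b T₀ e₀ - m T₀ e₀) ^ 2 ≤ (M.adj e₀).card * (q b e₀ * len e₀ ^ 2) := h1.trans h2.le
      _ ≤ N * (3 * N * (B * L) ^ 2) :=
          mul_le_mul hcN h3 (mul_nonneg (hq0 e₀) (sq_nonneg _)) (by positivity)
      _ ≤ (3 * N * (B * L)) ^ 2 := by
          have : 0 ≤ (N : ℝ) ^ 2 * (B * L) ^ 2 := by positivity
          nlinarith
  refine (abs_le_of_sq_le_sq hfin (by positivity)).trans ?_
  unfold nodeConst
  have : 3 * N * (B * L) = 3 * N * (signConst N * rhsConst amax κ * L) * Y := by rw [hB]; ring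
  rw [this]
  refine mul_le_mul_of_nonneg_right ?_ hY
  linarith

end Setting

/-! ### The local estimate -/

/-- Sum of the errors over the patches of the three vertices of a triangle. -/
def nbhdErr (M : TriMesh) (Df Du : E2 → E2) (uh : E2 → ℝ) (T : Finset E2) : ℝ :=
  ∑ i ∈ T, patchErr M Df Du uh i

/-- Constant in the bound for the moments of the difference of the tractions. -/
def momentConst (amax κ : ℝ) (N : ℕ) : ℝ := nodeConst amax κ N + jumpBound amax κ

/-- Constant in the local estimate. -/
def estConst (amax κ : ℝ) (N : ℕ) : ℝ :=
  2 * loadConst amax κ + 18 * κ / √discArea * momentConst amax κ N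

variable {amin amax κ : ℝ} {N : ℕ} {P : Problem} {M : TriMesh} {Df : E2 → E2}
    {u : E2 → ℝ} {Du : E2 → E2} {uh : E2 → ℝ} {φ : E2 → E2 → ℝ}
    {η ghat : Finset E2 → Finset E2 → E2 → ℝ}

theorem nbhdErr_nonneg (T : Finset E2) : 0 ≤ nbhdErr M Df Du uh T :=
  Finset.sum_nonneg fun _ _ => patchErr_nonneg _ _ _ _ _

theorem patchErr_le_nbhdErr {T : Finset E2} {i : E2} (hi : i ∈ T) :
    patchErr M Df Du uh i ≤ nbhdErr M Df Du uh T :=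
  Finset.single_le_sum (f := fun i => patchErr M Df Du uh i)
    (fun _ _ => patchErr_nonneg _ _ _ _ _) hi

theorem locErr_le_nbhdErr {T : Finset E2} (hT : T ∈ M.tri) :
    locErr Df Du uh T ≤ nbhdErr M Df Du uh T := by
  obtain ⟨i, hi⟩ : T.Nonempty := Finset.card_pos.1 (by rw [M.card_eq T hT]; norm_num)
  refine le_trans ?_ (patchErr_le_nbhdErr hi)
  exact Finset.single_le_sum (f := fun T => locErr Df Du uh T)
    (fun _ _ => locErr_nonneg _ _ _ _) (M.mem_patch.2 ⟨hT, hi⟩)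

namespace Setting

variable (S : Setting amin amax κ N P M Df u Du uh φ η)
include S

theorem momentConst_nonneg : 0 ≤ momentConst amax κ N :=
  add_nonneg S.nodeConst_nonneg S.jumpBound_pos.le

theorem estConst_nonneg : 0 ≤ estConst amax κ N := by
  have := S.loadConst_pos
  have := S.kappa_pos
  have := S.momentConst_nonneg
  unfold estConst; positivity

/-- On an interior edge the flux is half the sum of the two expressions that (H2) and (H3) make
constant. A boundary edge that is not a Neumann edge is a Dirichlet edge, and (H2) applies. -/
theorem eta_ae_const {T e : Finset E2} (he : e ∈ M.edges) (hT : T ∈ M.adj e)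
    (hN : ¬ P.IsNeumannEdge M e) : ∃ k : ℝ, ∀ᵐ x ∂(edgeMeasure e), η T e x = k := by
  by_cases hT' : ∃ T' ∈ M.adj e, T ≠ T'
  · obtain ⟨T', h', hne⟩ := hT'
    obtain ⟨c₁, h₁⟩ := S.sumConst.1 e he T hT T' h' hne
    obtain ⟨c₂, h₂⟩ := S.jumpConst.1 e he T hT T' h' hne
    refine ⟨(c₁ + c₂) / 2, ?_⟩
    filter_upwards [h₁, h₂] with x h₁ h₂
    linarith
  · push Not at hT'
    have hB : M.IsBoundaryEdge e := ⟨he, Finset.card_eq_one.2 ⟨T, by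
      ext T'; rw [Finset.mem_singleton]
      exact ⟨fun h' => (hT' T' h').symm, fun h' => h' ▸ hT⟩⟩⟩
    rcases S.meshed.boundary e hB with h | h
    · exact S.sumConst.2 e ⟨hB, h⟩ T hT
    · exact absurd ⟨hB, h⟩ hN

variable (hG : P.IsTraction M φ uh η ghat)
include hG

/-- On a Neumann edge the difference is g - q_h·n, a constant by (H3), and the two coordinates sum
to 1 on the edge. On any other edge q_h·n is constant and ĝ is a combination of nodal functions.
Affinity is what lets two moments control the whole difference. -/
theorem exists_affine_traction {T e : Finset E2} {p a b : E2} (hT : T ∈ M.tri)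
    (h : EdgeOf T e p a b) : ∃ α β : ℝ, ∀ᵐ x ∂(edgeMeasure e),
      ghat T e x - η T e x = α * bary T a x + β * bary T b x := by
  have heT := h.mem_edgesOf
  have he : e ∈ M.edges := M.mem_edges.2 ⟨T, hT, heT⟩
  have hadj := M.mem_adj_of_mem_edgesOf hT heT
  by_cases hN : P.IsNeumannEdge M e
  · obtain ⟨c, hc⟩ := S.jumpConst.2 e hN T hadj
    refine ⟨c, c, ?_⟩
    filter_upwards [hc, ae_mem_hull e] with x hx hxe
    rw [hG.neumann e hN T hadj x hxe, hx, ← mul_add, h.bary_add_bary hxe, mul_one]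
  · obtain ⟨k, hk⟩ := S.eta_ae_const he hadj hN
    obtain ⟨c, hc⟩ := hG.affine e he hN T hadj
    refine ⟨c a - k, c b - k, ?_⟩
    filter_upwards [hk, ae_mem_hull e] with x hx hxe
    have hxT := hull_mono h.subset hxe
    rw [hc x hxe, hx, h.sum_eq, S.basis.eqOn_bary hT h.ha hxT, S.basis.eqOn_bary hT h.hb hxT]
    have := h.bary_add_bary hxe
    linear_combination k * this

theorem memLp_traction_sub {T e : Finset E2} (hT : T ∈ M.tri) (he : e ∈ edgesOf T) :
    MemLp (fun x => ghat T e x - η T e x) 2 (edgeMeasure e) := by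
  obtain ⟨p, a, b, h⟩ := (M.isTriangle hT).exists_edgeOf he
  obtain ⟨α, β, hαβ⟩ := S.exists_affine_traction hG hT h
  have hc : Continuous fun x => α * bary T a x + β * bary T b x :=
    (continuous_const.mul (continuous_affine _)).add (continuous_const.mul (continuous_affine _))
  exact (h.memLp hc).ae_eq (hαβ.mono fun x hx => hx.symm)

theorem memLp_traction {T e : Finset E2} (hT : T ∈ M.tri) (he : e ∈ edgesOf T) :
    MemLp (ghat T e) 2 (edgeMeasure e) := by
  refine ((S.memLp_traction_sub hG hT he).add (S.memLp_eta hT he)).ae_eq (ae_of_all _ fun x => ?_)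
  simp

theorem edgeInt_traction_sub_mul {T e : Finset E2} (hT : T ∈ M.tri) (he : e ∈ edgesOf T)
    {v : E2 → ℝ} (hv : MemLp v 2 (edgeMeasure e)) :
    edgeInt e (fun x => (ghat T e x - η T e x) * v x)
      = edgeInt e (fun x => ghat T e x * v x) - edgeInt e (fun x => η T e x * v x) := by
  have i1 : Integrable (fun x => ghat T e x * v x) (edgeMeasure e) :=
    (S.memLp_traction hG hT he).integrable_mul hv
  have i2 : Integrable (fun x => η T e x * v x) (edgeMeasure e) :=
    (S.memLp_eta hT he).integrable_mul hv
  rw [edgeInt, edgeInt, edgeInt, ← integral_sub i1 i2]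
  simp only [sub_mul]

/-- Triangle inequality through the averaged moment: stability of the minimizer on one side, half a
flux jump on the other. -/
theorem abs_moment_le {T e : Finset E2} (hT : T ∈ M.tri) (he : e ∈ edgesOf T) {i : E2}
    (hi : i ∈ e) : |edgeInt e (fun x => (ghat T e x - η T e x) * bary T i x)|
      ≤ momentConst amax κ N * patchErr M Df Du uh i := by
  have heT := (Finset.mem_powersetCard.1 he).1
  have hee : e ∈ M.edges := M.mem_edges.2 ⟨T, hT, he⟩
  have hadj := M.mem_adj_of_mem_edgesOf hT he
  have hin : i ∈ M.nodes := M.mem_nodes.2 ⟨T, hT, heT hi⟩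
  have h1 : edgeInt e (fun x => (ghat T e x - η T e x) * bary T i x)
      = edgeInt e (fun x => (ghat T e x - η T e x) * φ i x) := edgeInt_congr fun x hx => by
    rw [S.basis.eqOn_bary hT (heT hi) (hull_mono heT hx)]
  rw [h1, S.edgeInt_traction_sub_mul hG hT he (S.memLp_nodal hT he (heT hi))]
  have b1 := S.abs_sub_meanProj_le hin (hG.system i hin) (hG.minimal i hin) hee hi hadj
  have b2 := S.abs_edgeInt_eta_sub_meanProj_le hee hadj hi
  have b3 : 0 ≤ jumpBound amax κ * patchErr M Df Du uh i :=
    mul_nonneg S.jumpBound_pos.le (patchErr_nonneg _ _ _ _ _)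
  have t := abs_sub (edgeInt e (fun x => ghat T e x * φ i x) - Problem.meanProj M φ η i T e)
    (edgeInt e (fun x => η T e x * φ i x) - Problem.meanProj M φ η i T e)
  rw [sub_sub_sub_cancel_right] at t
  unfold momentConst
  linarith

/-- The residual of the local problems for smooth test functions. -/
theorem local_residual {T : Finset E2} (hT : T ∈ M.tri) {w : E2 → ℝ} {Dw : E2 → E2}
    (hw : P.IsLocalSolution T (ghat T) w Dw) {v : E2 → ℝ} (hv : ContDiff ℝ ∞ v) :
    ∫ x in elt T, inner ℝ (mulV (P.A x) (Dw x - gradient uh x)) (gradient v x)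
      = (∫ x in elt T, P.f x * v x)
        + ∑ e ∈ edgesOf T, edgeInt e (fun x => (ghat T e x - η T e x) * v x) := by
  have hps : PiecewiseSmooth M v := fun T _ => ⟨v, hv, fun x _ => rfl⟩
  have h1 := hw.2 v (gradient v) (memH1_of_contDiff hv (isOpen_elt T) (isBounded_elt T))
    (fun _ => v) (fun e he => hps.hasTrace hT he fun x _ => rfl)
  have h2 := S.green hT hv (fun x _ => rfl)
  have hgv := memLp_gradient_elt_of_contDiff hv T
  have h3 : ∀ e ∈ edgesOf T, edgeInt e (fun x => (ghat T e x - η T e x) * v x)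
      = edgeInt e (fun x => ghat T e x * v x) - edgeInt e (fun x => η T e x * v x) := by
    intro e he
    obtain ⟨p, a, b, h⟩ := (M.isTriangle hT).exists_edgeOf he
    exact S.edgeInt_traction_sub_mul hG hT he (h.memLp hv.continuous)
  rw [Finset.sum_congr rfl h3, Finset.sum_sub_distrib, ← h2, ← add_sub_assoc, ← h1, ← integral_sub]
  · refine integral_congr_ae (ae_of_all _ fun x => ?_)
    simp only [mulV_sub, inner_sub_left]
    rfl
  · exact integrable_inner_of_memLp
      (S.adm.memLp_mulV S.hmin (S.meshed.elt_subset hT) hw.1.memLp_grad) hgv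
  · exact integrable_inner_of_memLp (S.memLp_flux.restrict_elt S.meshed hT) hgv

/-- The left side depends on ∇v only, so a constant may be subtracted from v to make the Poincaré
and trace inequalities available. The load is paired with v in the triangle and the affine traction
defect with v on the three edges. -/
theorem abs_local_residual_le {T : Finset E2} (hT : T ∈ M.tri) {w : E2 → ℝ} {Dw : E2 → E2}
    (hw : P.IsLocalSolution T (ghat T) w Dw) {v : E2 → ℝ} (hv : ContDiff ℝ ∞ v) :
    |∫ x in elt T, inner ℝ (mulV (P.A x) (Dw x - gradient uh x)) (gradient v x)|
      ≤ estConst amax κ N * nbhdErr M Df Du uh T * nrm T (gradient v) := by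
  obtain ⟨c₀, r, hr⟩ := S.shape T hT
  have hκ := S.kappa_pos
  have hmom := S.momentConst_nonneg
  have hπ := discArea_pos
  obtain ⟨c, hc⟩ := exists_lpNorm_sub_const_le (isOpen_elt T) (convex_elt T) (isBounded_elt T)
    hr.elt_nonempty hv
  set v' : E2 → ℝ := fun x => v x - c with hv'
  have hv's : ContDiff ℝ ∞ v' := hv.sub contDiff_const
  have hgrad : gradient v' = gradient v := by
    ext1 x
    simp only [gradient, hv', fderiv_sub_const]
  set D := nrm T (gradient v) with hD
  have hD0 : 0 ≤ D := lpNorm_nonneg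
  set Y := nbhdErr M Df Du uh T with hYdef
  have hY : 0 ≤ Y := nbhdErr_nonneg T
  have hP : nrm T v' ≤ 2 * width T * D := hc.trans (by
    have := diam_elt_le T
    gcongr)
  have h1 := S.local_residual hG hT hw hv's
  rw [hgrad] at h1
  rw [h1]
  have bf : |∫ x in elt T, P.f x * v' x| ≤ 2 * loadConst amax κ * Y * D := by
    refine (abs_integral_mul_le (S.memLp_f hT) (memLp_elt_of_contDiff hv's T)).trans ?_
    have h2 := S.width_mul_nrm_f_le hT
    have h3 : loadConst amax κ * locErr Df Du uh T ≤ loadConst amax κ * Y :=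
      mul_le_mul_of_nonneg_left (locErr_le_nbhdErr hT) S.loadConst_pos.le
    have hf0 : 0 ≤ nrm T P.f := lpNorm_nonneg
    calc nrm T P.f * nrm T v' ≤ nrm T P.f * (2 * width T * D) := by gcongr
      _ = 2 * (width T * nrm T P.f) * D := by ring
      _ ≤ 2 * (loadConst amax κ * Y) * D := by
          have := h2.trans h3
          gcongr
      _ = _ := by ring
  have be : ∀ e ∈ edgesOf T, |edgeInt e (fun x => (ghat T e x - η T e x) * v' x)|
      ≤ 6 * κ / √discArea * momentConst amax κ N * Y * D := by
    intro e he
    obtain ⟨p, a, b, h⟩ := (M.isTriangle hT).exists_edgeOf he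
    obtain ⟨α, β, hαβ⟩ := S.exists_affine_traction hG hT h
    have q1 := h.sq_edgeInt_mul_le hαβ hv's.continuous
    have q2 := hr.trace_le h hv's (by rw [hgrad]; exact hP)
    rw [hgrad] at q2
    have qa := S.abs_moment_le hG hT he ((h.mem_iff a).2 (Or.inl rfl))
    have qb := S.abs_moment_le hG hT he ((h.mem_iff b).2 (Or.inr rfl))
    have ya := patchErr_nonneg M Df Du uh a
    have yb := patchErr_nonneg M Df Du uh b
    have hab : patchErr M Df Du uh a + patchErr M Df Du uh b ≤ Y := by
      rw [hYdef, nbhdErr, h.tri.sum_eq h.hp h.ha h.hb h.hpa h.hpb h.hab]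
      have := patchErr_nonneg M Df Du uh p
      linarith
    set Ma := edgeInt e (fun x => (ghat T e x - η T e x) * bary T a x)
    set Mb := edgeInt e (fun x => (ghat T e x - η T e x) * bary T b x)
    have qm : Ma ^ 2 + Mb ^ 2 ≤ (momentConst amax κ N * Y) ^ 2 := by
      have s1 : |Ma| + |Mb| ≤ momentConst amax κ N * Y := by
        have := mul_le_mul_of_nonneg_left hab hmom
        linarith
      have s2 := pow_le_pow_left₀ (by positivity) s1 2
      rw [← sq_abs Ma, ← sq_abs Mb]
      nlinarith [abs_nonneg Ma, abs_nonneg Mb, mul_nonneg (abs_nonneg Ma) (abs_nonneg Mb)]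
    refine abs_le_of_sq_le_sq ?_ (by positivity)
    have hI : 0 ≤ ∫ t in (0 : ℝ)..1, v' (a + t • (b - a)) ^ 2 :=
      intervalIntegral.integral_nonneg zero_le_one fun t _ => sq_nonneg _
    -- The 6 of the mass matrix and the 6 κ² / `discArea` of the trace inequality combine into the
    -- square of 6 κ / √`discArea`. Three edges then give the 18 of `estConst`.
    calc _ ≤ 6 * (Ma ^ 2 + Mb ^ 2) * ∫ t in (0 : ℝ)..1, v' (a + t • (b - a)) ^ 2 := q1
      _ ≤ 6 * (momentConst amax κ N * Y) ^ 2 * (6 * κ ^ 2 / discArea * D ^ 2) := by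
          gcongr
      _ = _ := by
          have : √discArea ^ 2 = discArea := Real.sq_sqrt hπ.le
          simp only [mul_pow, div_pow, this]
          ring
  have hcard : (edgesOf T).card = 3 := by
    rw [edgesOf, Finset.card_powersetCard, M.card_eq T hT]; rfl
  have bs : |∑ e ∈ edgesOf T, edgeInt e (fun x => (ghat T e x - η T e x) * v' x)|
      ≤ 3 * (6 * κ / √discArea * momentConst amax κ N * Y * D) := by
    refine (Finset.abs_sum_le_sum_abs _ _).trans ((Finset.sum_le_card_nsmul _ _ _ be).trans ?_)
    rw [hcard, nsmul_eq_mul]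
    norm_num
  refine (abs_add_le _ _).trans ((add_le_add bf bs).trans (le_of_eq ?_))
  unfold estConst
  ring

end Setting

/-! ### The global estimate -/

variable {amin amax κ : ℝ} {N : ℕ} {P : Problem} {M : TriMesh} {Df : E2 → E2}
    {u : E2 → ℝ} {Du : E2 → E2} {uh : E2 → ℝ} {φ : E2 → E2 → ℝ}
    {η ghat : Finset E2 → Finset E2 → E2 → ℝ}

/-- After exchanging sums, Z T' is counted for each of the 3 vertices i of T' and each of the at
most N triangles at i. -/
theorem TriMesh.sum_nbhd_le (hv : ∀ i ∈ M.nodes, (M.patch i).card ≤ N) {Z : Finset E2 → ℝ}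
    (hZ : ∀ T, 0 ≤ Z T) :
    ∑ T ∈ M.tri, ∑ i ∈ T, ∑ T' ∈ M.patch i, Z T' ≤ 3 * N * ∑ T ∈ M.tri, Z T := by
  classical
  have h1 : ∑ T ∈ M.tri, ∑ i ∈ T, ∑ T' ∈ M.patch i, Z T'
      = ∑ i ∈ M.nodes, ∑ T ∈ M.patch i, ∑ T' ∈ M.patch i, Z T' :=
    Finset.sum_comm' fun T i => by
      rw [M.mem_patch, M.mem_nodes]
      exact ⟨fun ⟨hT, hi⟩ => ⟨⟨hT, hi⟩, T, hT, hi⟩, fun ⟨h, _⟩ => h⟩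
  have h2 : ∑ i ∈ M.nodes, ∑ T' ∈ M.patch i, Z T' = ∑ T' ∈ M.tri, ∑ _i ∈ T', Z T' :=
    Finset.sum_comm' fun i T' => by
      rw [M.mem_patch, M.mem_nodes]
      exact ⟨fun ⟨_, hT, hi⟩ => ⟨hi, hT⟩, fun ⟨hi, hT⟩ => ⟨⟨T', hT, hi⟩, hT, hi⟩⟩
  have h3 : ∑ T' ∈ M.tri, ∑ _i ∈ T', Z T' = 3 * ∑ T ∈ M.tri, Z T := by
    rw [Finset.mul_sum]
    refine Finset.sum_congr rfl fun T hT => ?_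
    rw [Finset.sum_const, M.card_eq T hT, nsmul_eq_mul]; norm_num
  calc _ = ∑ i ∈ M.nodes, ∑ T ∈ M.patch i, ∑ T' ∈ M.patch i, Z T' := h1
    _ ≤ ∑ i ∈ M.nodes, N * ∑ T' ∈ M.patch i, Z T' := by
        refine Finset.sum_le_sum fun i hi => ?_
        rw [Finset.sum_const, nsmul_eq_mul]
        exact mul_le_mul_of_nonneg_right (by exact_mod_cast hv i hi)
          (Finset.sum_nonneg fun T _ => hZ T)
    _ = 3 * N * ∑ T ∈ M.tri, Z T := by rw [← Finset.mul_sum, h2, h3]; ring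

/-- Cauchy–Schwarz twice, over the 3 vertices of T and over the at most N triangles at a vertex. -/
theorem sq_nbhdErr_le (hv : ∀ i ∈ M.nodes, (M.patch i).card ≤ N) {T : Finset E2} (hT : T ∈ M.tri) :
    nbhdErr M Df Du uh T ^ 2
      ≤ 3 * N * ∑ i ∈ T, ∑ T' ∈ M.patch i, locErr Df Du uh T' ^ 2 := by
  have h1 : nbhdErr M Df Du uh T ^ 2 ≤ T.card * ∑ i ∈ T, patchErr M Df Du uh i ^ 2 :=
    sq_sum_le_card_mul_sum_sq
  have h2 : ∀ i ∈ T, patchErr M Df Du uh i ^ 2 ≤ N * ∑ T' ∈ M.patch i, locErr Df Du uh T' ^ 2 := by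
    intro i hi
    have h3 : patchErr M Df Du uh i ^ 2
        ≤ (M.patch i).card * ∑ T' ∈ M.patch i, locErr Df Du uh T' ^ 2 := sq_sum_le_card_mul_sum_sq
    refine h3.trans (mul_le_mul_of_nonneg_right ?_ (Finset.sum_nonneg fun _ _ => sq_nonneg _))
    exact_mod_cast hv i (M.mem_nodes.2 ⟨T, hT, hi⟩)
  rw [M.card_eq T hT] at h1
  calc _ ≤ ((3 : ℕ) : ℝ) * ∑ i ∈ T, patchErr M Df Du uh i ^ 2 := h1
    _ ≤ ((3 : ℕ) : ℝ) * ∑ i ∈ T, N * ∑ T' ∈ M.patch i, locErr Df Du uh T' ^ 2 := by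
        gcongr with i hi
        exact h2 i hi
    _ = _ := by rw [← Finset.mul_sum]; push_cast; ring

namespace Setting

variable (S : Setting amin amax κ N P M Df u Du uh φ η)
include S

theorem memLp_gradient_uh {T : Finset E2} (hT : T ∈ M.tri) :
    MemLp (gradient uh) 2 (volume.restrict (elt T)) :=
  (S.uhP1.piecewiseSmooth.memLp_gradient S.meshed).restrict_elt S.meshed hT

theorem mul_sq_nrm_le {T : Finset E2} (hT : T ∈ M.tri) {d : E2 → E2}
    (hd : MemLp d 2 (volume.restrict (elt T))) :
    amin * nrm T d ^ 2 ≤ ∫ x in elt T, inner ℝ (mulV (P.A x) (d x)) (d x) := by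
  rw [nrm, sq_lpNorm_two hd, ← integral_const_mul]
  refine integral_mono_ae (hd.integrable_norm_pow (by norm_num) |>.const_mul amin) ?_ ?_
  · exact integrable_inner_of_memLp (S.adm.memLp_mulV S.hmin (S.meshed.elt_subset hT) hd) hd
  · filter_upwards [S.adm.ae_elliptic_elt S.meshed hT] with x hx
    exact hx.lower (d x)

/-- Formally this tests the local residual with w - u_h. Write ε for the constant of that residual
and n for ‖d‖. The energy I is then at most ε n, and amin n² ≤ I gives n ≤ ε / amin. -/
theorem integral_sq_local_le (hG : P.IsTraction M φ uh η ghat) {T : Finset E2} (hT : T ∈ M.tri)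
    {w : E2 → ℝ} {Dw : E2 → E2} (hw : P.IsLocalSolution T (ghat T) w Dw) :
    ∫ x in elt T, inner ℝ (mulV (P.A x) (Dw x - gradient uh x)) (Dw x - gradient uh x)
      ≤ (estConst amax κ N * nbhdErr M Df Du uh T) ^ 2 / amin := by
  obtain ⟨c₀, r, hr⟩ := S.shape T hT
  obtain ⟨a, ha⟩ := S.uhP1 T hT
  have hmin := S.hmin
  have hamax := S.amax_pos
  set ε := estConst amax κ N * nbhdErr M Df Du uh T with hε
  have hε0 : 0 ≤ ε := mul_nonneg S.estConst_nonneg (nbhdErr_nonneg T)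
  set d : E2 → E2 := fun x => Dw x - gradient uh x with hd
  have hdm : MemLp d 2 (volume.restrict (elt T)) :=
    hw.1.memLp_grad.sub (S.memLp_gradient_uh hT)
  have hsub := S.meshed.elt_subset hT
  have hAd := S.adm.memLp_mulV S.hmin hsub hdm
  set n := nrm T d with hn
  have hn0 : 0 ≤ n := lpNorm_nonneg
  set I := ∫ x in elt T, inner ℝ (mulV (P.A x) (d x)) (d x) with hI
  -- The residual bound is for smooth test functions, so w is replaced by a smooth z within t in H¹.
  -- On T the function u_h is the affine function `a`, already smooth. The terms of order t
  -- disappear as t tends to 0.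
  have key : ∀ t : ℝ, 0 < t → I ≤ ε * n + t * (ε + amax * n) := by
    intro t ht
    obtain ⟨z, hz, -, h2⟩ := hw.1.exists_smooth_approx (isOpen_elt T) (convex_elt T)
      (isBounded_elt T) hr.elt_nonempty (ε := ENNReal.ofReal t) (by simpa using ht)
    set v : E2 → ℝ := fun x => z x - a x with hvdef
    have hv : ContDiff ℝ ∞ v := hz.sub (contDiff_affine a)
    have hgv : ∀ x ∈ elt T, d x - gradient v x = -(gradient z x - Dw x) := by
      intro x hx
      have g1 : gradient v x = gradient z x - gradient a x := by
        simp only [gradient, hvdef]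
        rw [fderiv_fun_sub (hz.differentiable (by norm_num) x) (differentiableAt_affine a x), map_sub]
      rw [g1, hd]
      simp only [gradient_eq_of_eqOn_hull ha hx]
      abel
    have mgv := memLp_gradient_elt_of_contDiff hv T
    have mr : MemLp (fun x => d x - gradient v x) 2 (volume.restrict (elt T)) := hdm.sub mgv
    have hr' : nrm T (fun x => d x - gradient v x) ≤ t := by
      have hcg : (fun x => d x - gradient v x) =ᵐ[volume.restrict (elt T)]
          fun x => -(gradient z x - Dw x) :=
        ae_restrict_of_forall_mem (isOpen_elt T).measurableSet hgv
      rw [nrm, ← toReal_eLpNorm mr.1, eLpNorm_congr_ae hcg]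
      refine ENNReal.toReal_le_of_le_ofReal ht.le ?_
      have := eLpNorm_neg (fun x => gradient z x - Dw x) 2 (volume.restrict (elt T))
      exact (le_of_eq this).trans h2
    have hgn : nrm T (gradient v) ≤ n + t := by
      have := lpNorm_sub_le (f := d) (g := fun x => d x - gradient v x) hdm (p := 2) (by norm_num)
      have e1 : d - (fun x => d x - gradient v x) = gradient v := by ext1 x; simp
      rw [e1] at this
      exact this.trans (by gcongr)
    have e2 : I = (∫ x in elt T, inner ℝ (mulV (P.A x) (d x)) (gradient v x))
        + ∫ x in elt T, inner ℝ (mulV (P.A x) (d x)) (d x - gradient v x) := by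
      rw [hI, ← integral_add (integrable_inner_of_memLp hAd mgv) (integrable_inner_of_memLp hAd mr)]
      refine integral_congr_ae (ae_of_all _ fun x => ?_)
      simp only [inner_sub_right]; ring
    have b1 := (le_abs_self _).trans (S.abs_local_residual_le hG hT hw hv)
    have b2 := (le_abs_self _).trans (S.adm.abs_integral_mulV_le S.hmin S.hmax hsub hdm mr)
    have b3 : ε * nrm T (gradient v) ≤ ε * (n + t) := mul_le_mul_of_nonneg_left hgn hε0
    have b4 : amax * n * nrm T (fun x => d x - gradient v x) ≤ amax * n * t :=
      mul_le_mul_of_nonneg_left hr' (by positivity)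
    rw [e2]
    calc _ ≤ ε * (n + t) + amax * n * t := add_le_add (b1.trans b3) (b2.trans b4)
      _ = _ := by ring
  have hIle : I ≤ ε * n := by
    refine le_of_forall_pos_le_add fun δ hδ => ?_
    refine (key (δ / (ε + amax * n + 1)) (by positivity)).trans ?_
    have : δ / (ε + amax * n + 1) * (ε + amax * n) ≤ δ := by
      rw [div_mul_eq_mul_div, div_le_iff₀ (by positivity)]
      nlinarith
    linarith
  have hlow : amin * n ^ 2 ≤ I := S.mul_sq_nrm_le hT hdm
  have hne : amin * n ≤ ε := by
    rcases hn0.eq_or_lt with h | h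
    · rw [← h, mul_zero]; exact hε0
    · nlinarith
  rw [le_div_iff₀ hmin]
  nlinarith

/-- With q̂_h - A∇u_h = A d on T, the density A⁻¹(A d)·(A d) is the energy density A d·d. -/
theorem creSq_le {qhat : E2 → E2} (hq : P.IsHybridFlux M φ uh η qhat) :
    P.creSq uh qhat
      ≤ 1 / 2 * ∑ T ∈ M.tri, (estConst amax κ N * nbhdErr M Df Du uh T) ^ 2 / amin := by
  obtain ⟨ghat, hG, hloc⟩ := hq
  choose! w Dw hw hqw using hloc
  have hsub : ∀ T ∈ M.tri, elt T ⊆ P.Ω := fun T hT => S.meshed.elt_subset hT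
  have hdm : ∀ T ∈ M.tri, MemLp (fun x => Dw T x - gradient uh x) 2 (volume.restrict (elt T)) :=
    fun T hT => (hw T hT).1.memLp_grad.sub (S.memLp_gradient_uh hT)
  have hflux : ∀ T ∈ M.tri, ∀ᵐ x ∂(volume.restrict (elt T)),
      qhat x - P.flux uh x = mulV (P.A x) (Dw T x - gradient uh x) := by
    intro T hT
    filter_upwards [hqw T hT] with x hx
    rw [hx, mulV_sub]; rfl
  have hinv : ∀ T ∈ M.tri, ∀ᵐ x ∂(volume.restrict (elt T)),
      mulV (P.A x)⁻¹ (qhat x - P.flux uh x) = Dw T x - gradient uh x := by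
    intro T hT
    filter_upwards [hflux T hT, S.adm.ae_elliptic_elt S.meshed hT] with x hx he
    rw [hx, he.inv_mulV S.hmin]
  have m1 := S.meshed.memLp _ hflux fun T hT => S.adm.memLp_mulV S.hmin (hsub T hT) (hdm T hT)
  have m2 := S.meshed.memLp _ hinv hdm
  rw [Problem.creSq, S.meshed.integral_eq_sum (integrable_inner_of_memLp m2 m1)]
  refine mul_le_mul_of_nonneg_left (Finset.sum_le_sum fun T hT => ?_) (by norm_num)
  refine le_trans (le_of_eq ?_) (S.integral_sq_local_le hG hT (hw T hT))
  refine integral_congr_ae ?_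
  filter_upwards [hflux T hT, hinv T hT] with x h1 h2
  rw [h2, h1, real_inner_comm]

theorem sum_sq_locErr_le :
    ∑ T ∈ M.tri, locErr Df Du uh T ^ 2
      ≤ 2 / amin * P.energySq (fun x => Du x - gradient uh x)
        + 2 * (M.meshSize ^ 4 * ∫ x in P.Ω, ‖Df x‖ ^ 2) := by
  have hmin := S.hmin
  have hDf := S.fH1.memLp_grad
  have herr := S.memLp_err
  have i1 : Integrable (fun x => ‖Df x‖ ^ 2) (volume.restrict P.Ω) :=
    hDf.integrable_norm_pow (by norm_num)
  have i2 : Integrable (fun x => inner ℝ (mulV (P.A x) (Du x - gradient uh x))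
      (Du x - gradient uh x)) (volume.restrict P.Ω) :=
    integrable_inner_of_memLp (S.adm.memLp_mulV S.hmin subset_rfl herr) herr
  rw [Problem.energySq, S.meshed.integral_eq_sum i1, S.meshed.integral_eq_sum i2, Finset.mul_sum,
    Finset.mul_sum, Finset.mul_sum, ← Finset.sum_add_distrib]
  refine Finset.sum_le_sum fun T hT => ?_
  have hwT : width T ≤ M.meshSize :=
    Finset.le_sup' (fun T => Metric.diam (hull T)) hT
  have h1 := S.mul_sq_nrm_le hT (herr.restrict_elt S.meshed hT)
  rw [← sq_lpNorm_two (hDf.restrict_elt S.meshed hT)]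
  set D := nrm T (fun x => Du x - gradient uh x) with hD
  have hG0 : 0 ≤ nrm T Df := lpNorm_nonneg
  have h2 : D ^ 2 ≤ 1 / amin * ∫ x in elt T,
      inner ℝ (mulV (P.A x) (Du x - gradient uh x)) (Du x - gradient uh x) := by
    rw [div_mul_eq_mul_div, one_mul, le_div_iff₀ hmin]; linarith
  have h3 : (width T ^ 2 * nrm T Df) ^ 2 ≤ M.meshSize ^ 4 * nrm T Df ^ 2 := by
    rw [mul_pow, ← pow_mul]
    have := width_nonneg T
    gcongr
  have h4 : locErr Df Du uh T ^ 2 ≤ 2 * D ^ 2 + 2 * (width T ^ 2 * nrm T Df) ^ 2 := by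
    unfold locErr
    nlinarith [sq_nonneg (D - width T ^ 2 * nrm T Df)]
  refine h4.trans ?_
  rw [show (2 : ℝ) / amin = 2 * (1 / amin) by ring, mul_assoc]
  exact add_le_add (mul_le_mul_of_nonneg_left h2 zero_le_two)
    (mul_le_mul_of_nonneg_left h3 zero_le_two)

theorem creSq_le_energySq {qhat : E2 → E2} (hq : P.IsHybridFlux M φ uh η qhat) :
    P.creSq uh qhat
      ≤ 9 * N ^ 2 * estConst amax κ N ^ 2 / amin * (1 / amin * P.energySq (fun x => Du x - gradient uh x)
        + M.meshSize ^ 4 * ∫ x in P.Ω, ‖Df x‖ ^ 2) := by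
  have hmin := S.hmin
  refine (S.creSq_le hq).trans ?_
  have h1 : ∑ T ∈ M.tri, nbhdErr M Df Du uh T ^ 2
      ≤ 9 * N ^ 2 * ∑ T ∈ M.tri, locErr Df Du uh T ^ 2 := by
    calc _ ≤ ∑ T ∈ M.tri, 3 * N * ∑ i ∈ T, ∑ T' ∈ M.patch i, locErr Df Du uh T' ^ 2 :=
          Finset.sum_le_sum fun T hT => sq_nbhdErr_le S.valence hT
      _ = 3 * N * ∑ T ∈ M.tri, ∑ i ∈ T, ∑ T' ∈ M.patch i, locErr Df Du uh T' ^ 2 := by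
          rw [Finset.mul_sum]
      _ ≤ 3 * N * (3 * N * ∑ T ∈ M.tri, locErr Df Du uh T ^ 2) := by
          gcongr
          exact TriMesh.sum_nbhd_le S.valence fun T => sq_nonneg (locErr Df Du uh T)
      _ = _ := by ring
  have h2 : ∑ T ∈ M.tri, (estConst amax κ N * nbhdErr M Df Du uh T) ^ 2 / amin
      = estConst amax κ N ^ 2 / amin * ∑ T ∈ M.tri, nbhdErr M Df Du uh T ^ 2 := by
    rw [Finset.mul_sum]
    exact Finset.sum_congr rfl fun T _ => by ring
  rw [h2]
  calc _ ≤ 1 / 2 * (estConst amax κ N ^ 2 / amin * (9 * N ^ 2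
        * (2 / amin * P.energySq (fun x => Du x - gradient uh x)
        + 2 * (M.meshSize ^ 4 * ∫ x in P.Ω, ‖Df x‖ ^ 2)))) := by
        gcongr
        exact h1.trans (mul_le_mul_of_nonneg_left S.sum_sq_locErr_le (by positivity))
    _ = _ := by ring

theorem energySq_nonneg : 0 ≤ P.energySq (fun x => Du x - gradient uh x) := by
  refine integral_nonneg_of_ae ?_
  filter_upwards [S.adm.ae_elliptic] with x hx
  exact (mul_nonneg S.hmin.le (sq_nonneg _)).trans (hx.lower _)

end Setting

end CRE

end

/-! ### The theorem -/

theorem corollary1 (amin amax γ₀ : ℝ) (N : ℕ) (hmin : 0 < amin) (hmax : amin ≤ amax)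
    (hγ : 0 < γ₀) :
    ∃ C : ℝ, 0 < C ∧
      ∀ (P : CRE.Problem) (M : CRE.TriMesh) (Df : CRE.E2 → CRE.E2)
        (u : CRE.E2 → ℝ) (Du : CRE.E2 → CRE.E2) (uh : CRE.E2 → ℝ)
        (φ : CRE.E2 → CRE.E2 → ℝ) (η : Finset CRE.E2 → Finset CRE.E2 → CRE.E2 → ℝ)
        (qhat : CRE.E2 → CRE.E2),
        P.Admissible amin amax →
        P.Meshed M →
        M.Regular γ₀ N →
        CRE.MemH1 P.Ω P.f Df →
        P.IsWeakSolution M u Du →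
        P.IsFESolution M uh →
        M.IsNodalBasis φ →
        P.FluxDivFree M uh →
        P.IsEdgeFlux M uh η →
        P.FluxSumConst M η →
        P.FluxJumpConst M η →
        P.IsHybridFlux M φ uh η qhat →
        P.creSq uh qhat
          ≤ C * P.energySq (fun x => Du x - gradient uh x)
            + C * M.meshSize ^ 4 * ∫ x in P.Ω, ‖Df x‖ ^ 2 := by
  set Q := 9 * (N : ℝ) ^ 2 * CRE.estConst amax (4 * γ₀) N ^ 2 / amin with hQ
  have hQ0 : 0 ≤ Q := by positivity
  -- The constant dominates both `Q / amin` and `Q`. The summand 1 keeps it positive when `Q`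
  -- vanishes, as for N = 0.
  refine ⟨1 + Q * (1 / amin) + Q, by positivity, ?_⟩
  intro P M Df u Du uh φ η qhat hadm hmesh hreg hf hu huh hφ _ hη hsum hjump hq
  have S : CRE.Setting amin amax (4 * γ₀) N P M Df u Du uh φ η :=
    { hmin := hmin, hmax := hmax, adm := hadm, meshed := hmesh
      shape := fun T hT => CRE.exists_shapeRegular (M.isTriangle hT) hγ (hreg.shape T hT)
      valence := hreg.valence, fH1 := hf, weak := hu, uhP1 := huh.1.1, basis := hφ
      edgeFlux := hη, sumConst := hsum, jumpConst := hjump }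
  have h1 := S.creSq_le_energySq hq
  have h2 := S.energySq_nonneg
  have h3 : 0 ≤ M.meshSize ^ 4 * ∫ x in P.Ω, ‖Df x‖ ^ 2 :=
    mul_nonneg (by positivity) (integral_nonneg fun x => sq_nonneg _)
  have h4 : 0 ≤ Q * (1 / amin) := by positivity
  refine h1.trans ?_
  rw [mul_assoc (1 + Q * (1 / amin) + Q), mul_add, ← mul_assoc]
  exact add_le_add (mul_le_mul_of_nonneg_right (by linarith) h2)
    (mul_le_mul_of_nonneg_right (by linarith) h3)
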